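/- Let $V$ and $V'$ be left vector spaces of finite dimensions $n$ and $n'$ over division rings $R$ and $R'$, and let $\mathcal G_k(V)$ be the set of $k$-dimensional subspaces of $V$. The Grassmann graph $\Gamma_k(V)$ has vertex set $\mathcal G_k(V)$, two subspaces being adjacent if their intersection is $(k-1)$-dimensional (for $k=0$ and $k=n$ it is a single vertex without edges). The Johnson graph $J(n,k)$ has the $k$-element subsets of $\{1,\dots,n\}$ as vertices, two being adjacent if they have exactly $k-1$ common elements. An isometric embedding of graphs is an injection of the vertex sets that preserves adjacency, non-adjacency and the path distance. A $J(n,k)$-subset of $\mathcal G_{k'}(V')$ is the image of an isometric embedding of $J(n,k)$ in $\Gamma_{k'}(V')$. The apartment of $\mathcal G_k(V)$ associated with a base $B$ of $V$ is the set of all $k$-dimensional subspaces spanned by subsets of $B$. For subspaces $S\subset U$ of $V'$ with $\dim S<k'<\dim U$, the parabolic subspace $[S,U]_{k'}$ is the set of all $P\in\mathcal G_{k'}(V')$ with $S\subset P\subset U$; an apartment in $[S,U]_{k'}$ is the intersection of $[S,U]_{k'}$ with the apartment of $\mathcal G_{k'}(V')$ associated with a base of $V'$ such that $S$ and $U$ are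 spanned by subsets of this base. A mapping $f:\mathcal G_k(V)\to\mathcal G_{k'}(V')$ is a $J$-mapping if it sends every apartment of $\mathcal G_k(V)$ to a $J(n,k)$-subset of $\mathcal G_{k'}(V')$; it is a strong $J$-mapping if, moreover, the image of at least one apartment of $\mathcal G_k(V)$ is an apartment in a parabolic subspace of $\mathcal G_{k'}(V')$. A mapping $l:V\to W$ to a left vector space $W$ over a division ring $Q$ is semilinear if it is additive and $l(ax)=\sigma(a)l(x)$ for all $a\in R$, $x\in V$, with a ring homomorphism $\sigma:R\to Q$ (not necessarily surjective). A semilinear embedding of $V$ is a semilinear injection that sends any $n=\dim V$ linearly independent vectors to linearly independent vectors; it induces $(l)_k:\mathcal G_k(V)\to\mathcal G_k(W)$, $P\mapsto\langle l(P)\rangle$. For subspaces $S\subset U$ of a vector space, $\Phi^U_S$ sends a subspace of $U/S$ to the corresponding subspace, between $S$ and $U$, of the whole space. The dual space $V'^*$ is a left vector space over the opposite division ring of $R'$. Suppose that $1<k<n-1$ and $n\ne 2k$. Then for every strong $J$-mapping $f:\mathcal G_k(V)\to\mathcal G_{k'}(V')$ at least one of the following holds: 1. there exist subspaces $S\subset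 U$ of $V'$ with $\dim S=k'-k$ and $\dim U=n+k'-k$, and a semilinear embedding $l:V\to U/S$, such that $f=\Phi^U_S\circ(l)_k$; 2. there exist subspaces $S'\subset U'$ of $V'^*$ with $\dim S'=n'-k'-k$ and $\dim U'=n+n'-k'-k$, and a semilinear embedding $l:V\to U'/S'$, such that $f={\rm A}\circ\Phi^{U'}_{S'}\circ(l)_k$, where ${\rm A}:\mathcal G_{n'-k'}(V'^*)\to\mathcal G_{k'}(V')$ is the annihilator mapping $T\mapsto\{x\in V' : \varphi(x)=0\ \text{for all}\ \varphi\in T\}$. -/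

import Mathlib

namespace StrongJ

open Module

/-- The Grassmannian of `k`-dimensional subspaces of a left vector space `V` over the division
ring `R`. -/
abbrev Gr (R V : Type*) [DivisionRing R] [AddCommGroup V] [Module R V] (k : ℕ) : Type _ :=
  {P : Submodule R V // finrank R P = k}

/-- The Grassmann graph: two `k`-dimensional subspaces are adjacent when their intersection is
`(k-1)`-dimensional. For `k = 0` and for `k = dim V` there is a single vertex and no edge. -/
def grassmannGraph (R V : Type*) [DivisionRing R] [AddCommGroup V] [Module R V] (k : ℕ) :
    SimpleGraph (Gr R V k) where
  Adj P Q := finrank R (P.1 ⊓ Q.1 : Submodule R V) + 1 = k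
  symm := ⟨fun P Q h => by rw [inf_comm]; exact h⟩
  loopless := ⟨fun P h => by rw [inf_idem, P.2] at h; omega⟩

/-- The Johnson graph `J(n,k)`: the vertices are the `k`-element subsets of an `n`-element set,
adjacent when they have `k-1` elements in common. -/
def johnsonGraph (n k : ℕ) : SimpleGraph {X : Finset (Fin n) // X.card = k} where
  Adj X Y := (X.1 ∩ Y.1).card + 1 = k
  symm := ⟨fun X Y h => by rw [Finset.inter_comm]; exact h⟩
  loopless := ⟨fun X h => by rw [Finset.inter_self, X.2] at h; omega⟩

/-- Isometric embeddings of graphs: injective, preserving adjacency and non-adjacency, and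
preserving the path distance. (Johnson and Grassmann graphs are connected, so `SimpleGraph.dist`
is the genuine distance for them.) -/
def IsIsometricEmbedding {α β : Type*} (G : SimpleGraph α) (H : SimpleGraph β) (e : α → β) :
    Prop :=
  Function.Injective e ∧ (∀ a b, H.Adj (e a) (e b) ↔ G.Adj a b) ∧
    ∀ a b, H.dist (e a) (e b) = G.dist a b

section

variable {R V : Type*} [DivisionRing R] [AddCommGroup V] [Module R V]

/-- The set of all `k`-dimensional subspaces spanned by subsets of the base `b`. -/
def apartment {ι : Type*} (b : Basis ι R V) (k : ℕ) : Set (Gr R V k) :=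
  {P | ∃ I : Set ι, P.1 = Submodule.span R (b '' I)}

/-- Apartments of the Grassmannian. -/
def IsApartment (k : ℕ) (A : Set (Gr R V k)) : Prop :=
  ∃ b : Basis (Fin (finrank R V)) R V, A = apartment b k

/-- The set `[S, U]_k` of all `k`-dimensional subspaces `P` with `S ⊆ P ⊆ U`. -/
def interval (S U : Submodule R V) (k : ℕ) : Set (Gr R V k) :=
  {P | S ≤ P.1 ∧ P.1 ≤ U}

/-- `A` is an apartment in the parabolic subspace `[S, U]_k`, where `S ⊆ U` and
`dim S < k < dim U`: the intersection of `[S, U]_k` with the apartment of a base such that `S` and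
`U` are spanned by subsets of this base. -/
def IsApartmentInParabolic (k : ℕ) (S U : Submodule R V) (A : Set (Gr R V k)) : Prop :=
  S ≤ U ∧ finrank R S < k ∧ k < finrank R U ∧
    ∃ b : Basis (Fin (finrank R V)) R V,
      (∃ I : Set (Fin (finrank R V)), S = Submodule.span R (b '' I)) ∧
      (∃ I : Set (Fin (finrank R V)), U = Submodule.span R (b '' I)) ∧
      A = apartment b k ∩ interval S U k

/-- `J(n,k)`-subsets: the images of isometric embeddings of the Johnson graph `J(n,k)` in the
Grassmann graph of index `m` of `V`. -/
def IsJohnsonSubset (n k : ℕ) {m : ℕ} (J : Set (Gr R V m)) : Prop :=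
  ∃ e : {X : Finset (Fin n) // X.card = k} → Gr R V m,
    IsIsometricEmbedding (johnsonGraph n k) (grassmannGraph R V m) e ∧ Set.range e = J

/-- For `S ⊆ U ⊆ V`, the map sending a subspace of `U/S` to the corresponding subspace of `V`
(its preimage in `U`). -/
def phi (S U : Submodule R V) (Q : Submodule R (U ⧸ S.submoduleOf U)) : Submodule R V :=
  (Q.comap (S.submoduleOf U).mkQ).map U.subtype

/-- The dual space `V*`: the `R`-linear forms on `V`. -/
def DualSpace (R V : Type*) [DivisionRing R] [AddCommGroup V] [Module R V] : Type _ :=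
  V →ₗ[R] R

instance : AddCommGroup (DualSpace R V) := inferInstanceAs (AddCommGroup (V →ₗ[R] R))

/-- `V*` is a left vector space over the opposite division ring, through
`(op a • φ) x = φ x * a`. -/
instance : Module Rᵐᵒᵖ (DualSpace R V) := inferInstanceAs (Module Rᵐᵒᵖ (V →ₗ[R] R))

instance : FunLike (DualSpace R V) V R := inferInstanceAs (FunLike (V →ₗ[R] R) V R)

instance : LinearMapClass (DualSpace R V) R V R := inferInstanceAs (LinearMapClass (V →ₗ[R] R) R V R)

/-- The annihilator in `V` of a subspace `T` of the dual space `V*`. Under the identification of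
`V` with `V**` (for `V` of finite dimension) this is the annihilator mapping of `V*`. -/
def annih (T : Submodule Rᵐᵒᵖ (DualSpace R V)) : Submodule R V where
  carrier := {x | ∀ φ ∈ T, φ x = 0}
  zero_mem' := fun φ _ => map_zero φ
  add_mem' := fun {x y} hx hy φ hφ => by rw [map_add, hx φ hφ, hy φ hφ, add_zero]
  smul_mem' := fun a x hx φ hφ => by rw [map_smul, hx φ hφ, smul_zero]

end

section

variable {R V R' V' : Type*} [DivisionRing R] [AddCommGroup V] [Module R V]
  [DivisionRing R'] [AddCommGroup V'] [Module R' V']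

/-- Semilinear `m`-embeddings: semilinear injections sending any `m` linearly independent vectors
to linearly independent vectors. -/
def IsSemilinearMEmbedding {σ : R →+* R'} (m : ℕ) (l : V →ₛₗ[σ] V') : Prop :=
  Function.Injective l ∧
    ∀ v : Fin m → V, LinearIndependent R v → LinearIndependent R' (fun i => l (v i))

/-- Semilinear embeddings: semilinear `m`-embeddings with `m = dim V`. -/
def IsSemilinearEmbedding {σ : R →+* R'} (l : V →ₛₗ[σ] V') : Prop :=
  IsSemilinearMEmbedding (finrank R V) l

/-- The map `P ↦ ⟨l(P)⟩` on subspaces induced by a semilinear map `l`; its restriction to the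
`k`-dimensional subspaces is `(l)_k`. -/
def spanImage {σ : R →+* R'} (l : V →ₛₗ[σ] V') (P : Submodule R V) : Submodule R' V' :=
  Submodule.span R' (l '' (P : Set V))

/-- `J`-mappings: mappings of Grassmannians sending every apartment to a `J(n,k)`-subset, where
`n = dim V`. -/
def IsJMapping {k k' : ℕ} (f : Gr R V k → Gr R' V' k') : Prop :=
  ∀ A : Set (Gr R V k), IsApartment k A → IsJohnsonSubset (finrank R V) k (f '' A)

/-- Strong `J`-mappings: `J`-mappings sending at least one apartment to an apartment in a
parabolic subspace. -/
def IsStrongJMapping {k k' : ℕ} (f : Gr R V k → Gr R' V' k') : Prop :=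
  IsJMapping f ∧ ∃ A : Set (Gr R V k), IsApartment k A ∧
    ∃ S U : Submodule R' V', IsApartmentInParabolic k' S U (f '' A)

end

end StrongJ

/-! A `J`-mapping is only known to send each apartment to some isometric copy of `J(n,k)`, and such
a copy need not lie in an apartment. The point is that one good apartment makes all the others good.
Bases are linked by elementary moves, and replacing `v i₀` by `v i₀ + c • v j₀` changes only the
members of the apartment that contain `v i₀` and not `v j₀`. A third base, containing `v i₀` and the
new vector, shows that the images of the lost members are not attained again. So the new image is a
copy of `J(n,k)` that misses exactly as many members of the old apartment as there are `k`-sets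
separating two given indices (`MapsToJohnson.exists_move`).

Such a copy is rigid. An isometric embedding of `J(n,k)` sends stars to stars, or it does so after
reversing the order (`IsRankIsometry.starType_or_dual`). If stars go to stars and `2k ≤ n`, it
extends to all smaller index sets, respecting ranks and meets (`IsRankIsometry.exists_extension`),
so it has points that can be compared with those of the old apartment. By the count, the missed
members are those separating one ordered pair of indices, and the copy is the old apartment with one
point moved along a line (`IsFrame.exists_frame_of_card`). The order-reversed alternative is ruled
out by comparing the ranks `s + 2k` and `s + n`, which needs `2k < n`. The case `n < 2k` reduces to
it by complementing index sets and reversing the order. For this reason the combinatorics is done in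
a lattice with a modular rank.

Hence all apartments go to apartments with the same bounds. Moreover separating families go to
separating families, and counting them recovers the sizes of intersections, so `f` is given on each
apartment by a permutation of the indices (`MapsToJohnson.exists_frame`). Therefore `f` induces a
map on points which preserves lines and independence, and a fundamental theorem of projective
geometry without surjectivity (`IsPointMap.exists_semilinear`) produces the semilinear map, with
values in the quotient `U/S`.

For the initial apartment, diameter and number of vertices show that the parabolic apartment has `n`
indices and members of index size `k` or `n - k` (`IsRankIsometry.card_eq_of_frame`). The second
possibility becomes the first after passing to annihilators in the dual space. -/

namespace StrongJ

open OrderDual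

/-! ### Modular ranks, and stars under isometric embeddings of Johnson graphs -/

section Lattice

variable {L : Type*} [Lattice L]

/-- A strictly monotone modular valuation on a lattice. -/
structure IsRank (r : L → ℕ) : Prop where
  strictMono : StrictMono r
  modular : ∀ a b, r (a ⊔ b) + r (a ⊓ b) = r a + r b

namespace IsRank

variable {r : L → ℕ} (hr : IsRank r)
include hr

lemma mono {a b : L} (h : a ≤ b) : r a ≤ r b := hr.strictMono.monotone h

lemma eq_of_le {a b : L} (h : a ≤ b) (h' : r b ≤ r a) : a = b := by
  by_contra hne
  exact absurd (hr.strictMono (lt_of_le_of_ne h hne)) (by omega)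

lemma inf_eq {a b c : L} (ha : c ≤ a) (hb : c ≤ b) (h : r (a ⊓ b) ≤ r c) : a ⊓ b = c :=
  (hr.eq_of_le (le_inf ha hb) h).symm

lemma sup_eq {a b c : L} (ha : a ≤ c) (hb : b ≤ c) (h : r c ≤ r (a ⊔ b)) : a ⊔ b = c :=
  hr.eq_of_le (sup_le ha hb) h

lemma dual [OrderTop L] : IsRank (fun x : Lᵒᵈ => r ⊤ - r (ofDual x)) where
  strictMono a b h := by
    have h1 := hr.strictMono (show ofDual b < ofDual a from h)
    have h2 := hr.mono (le_top (a := ofDual a))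
    simp only
    omega
  modular a b := by
    have h1 := hr.modular (ofDual a) (ofDual b)
    have h2 := hr.mono (le_top (a := ofDual a ⊔ ofDual b))
    have h3 := hr.mono (le_top (a := ofDual a))
    have h4 := hr.mono (le_top (a := ofDual b))
    have h5 := hr.mono (le_top (a := ofDual a ⊓ ofDual b))
    simp only [ofDual_sup, ofDual_inf]
    omega

/-- Three pairwise adjacent elements have a common meet or a common join. -/
lemma inf_le_or_le_sup {m : ℕ} {x y z : L} (hz : r z = m)
    (hxy : r (x ⊓ y) + 1 = m) (hxz : r (x ⊓ z) + 1 = m) (hyz : r (y ⊓ z) + 1 = m) :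
    x ⊓ y ≤ z ∨ z ≤ x ⊔ y := by
  by_cases h : x ⊓ z = y ⊓ z
  · left
    have h1 : x ⊓ z ≤ x ⊓ y := le_inf inf_le_left (h ▸ inf_le_left)
    rw [← hr.eq_of_le h1 (by omega)]
    exact inf_le_right
  · right
    -- The two meets are distinct and of corank one under `z`, so they join to `z`.
    have h1 : r (x ⊓ z) < r ((x ⊓ z) ⊔ (y ⊓ z)) := by
      refine hr.strictMono (lt_of_le_of_ne le_sup_left fun h2 => h ?_)
      exact (hr.eq_of_le (sup_eq_left.mp h2.symm) (by omega)).symm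
    have h2 : (x ⊓ z) ⊔ (y ⊓ z) = z := hr.sup_eq inf_le_right inf_le_right (by omega)
    rw [← h2]
    exact sup_le_sup inf_le_left inf_le_left

lemma inf_eq_of_star {m : ℕ} {x y z : L}
    (hxy : r (x ⊓ y) + 1 = m) (hxz : r (x ⊓ z) + 1 = m) (h : x ⊓ y ≤ z) : x ⊓ z = x ⊓ y :=
  hr.inf_eq inf_le_left h (by omega)

/-- If `w` is adjacent to `x` and `y` but not to `z`, then `x`, `y`, `z` do not lie on a line. -/
lemma not_line {m : ℕ} {x y z w : L} (hx : r x = m) (hy : r y = m) (hz : r z = m) (hw : r w = m)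
    (hxy : r (x ⊓ y) + 1 = m) (hxw : r (x ⊓ w) + 1 = m) (hyw : r (y ⊓ w) + 1 = m)
    (hzw : r (z ⊓ w) + 1 < m) (h : x ⊓ y ≤ z) (h' : z ≤ x ⊔ y) : False := by
  rcases hr.inf_le_or_le_sup hw hxy hxw hyw with h1 | h1
  · have := hr.mono (le_inf h h1); omega
  · have h2 := hr.mono (sup_le h' h1)
    have h3 := hr.modular x y
    have h4 := hr.modular z w
    omega

end IsRank

section Embedding

variable {α : Type*} [DecidableEq α]

/-- The rank form of an isometric embedding of a Johnson graph. -/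
def IsRankIsometry (r : L → ℕ) (k m : ℕ) (e : Finset α → L) : Prop :=
  ∀ I J : Finset α, I.card = k → J.card = k → r (e I ⊓ e J) + k = m + (I ∩ J).card

/-- The images of all sets containing a fixed `(k-1)`-set have a common meet. -/
def StarAt (r : L → ℕ) (m : ℕ) (e : Finset α → L) (K : Finset α) : Prop :=
  ∃ s, r s + 1 = m ∧ ∀ a ∉ K, s ≤ e (insert a K)

section

variable {r : L → ℕ} {k m : ℕ} {e : Finset α → L}

lemma IsRankIsometry.rank (he : IsRankIsometry r k m e) {I : Finset α} (hI : I.card = k) :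
    r (e I) = m := by
  have := he I I hI hI
  simp only [inf_idem, Finset.inter_self] at this
  omega

lemma card_insert_inter_insert {K : Finset α} {a b : α} (ha : a ∉ K) (hab : a ≠ b) :
    (insert a K ∩ insert b K).card = K.card := by
  congr 1
  grind

/-- Two elements of a star have images meeting in codimension one. -/
lemma IsRankIsometry.rank_insert_inf (he : IsRankIsometry r k m e) {K : Finset α}
    (hK : K.card + 1 = k) {a b : α} (ha : a ∉ K)
    (hb : b ∉ K) (hab : a ≠ b) : r (e (insert a K) ⊓ e (insert b K)) + 1 = m := by
  have := he (insert a K) (insert b K) (by grind) (by grind)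
  rw [card_insert_inter_insert ha hab] at this
  omega

variable (hr : IsRank r) (he : IsRankIsometry r k m e)
include hr he

/-- Exchanging a point `d` of `K` for `a` and `b` gives a vertex adjacent to the first two members
of the star but at distance two from the third; `not_line` excludes this for collinear images. The
point `d` exists because `k ≥ 2`. -/
lemma IsRankIsometry.not_line_of_star (hk : 2 ≤ k) {K : Finset α} (hK : K.card + 1 = k)
    {a b c : α} (ha : a ∉ K) (hb : b ∉ K) (hc : c ∉ K) (hab : a ≠ b) (hac : a ≠ c) (hbc : b ≠ c)
    (h : e (insert a K) ⊓ e (insert b K) ≤ e (insert c K))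
    (h' : e (insert c K) ≤ e (insert a K) ⊔ e (insert b K)) : False := by
  obtain ⟨d, hd⟩ : K.Nonempty := Finset.card_pos.mp (by omega)
  set W := insert a (insert b (K.erase d)) with hW
  have hcard : (K.erase d).card + 1 = K.card := Finset.card_erase_add_one hd
  have hWc : W.card = k := by grind
  have h1 := he (insert a K) W (by grind) hWc
  have h2 := he (insert b K) W (by grind) hWc
  have h3 := he (insert c K) W (by grind) hWc
  have e1 : insert a K ∩ W = insert a (K.erase d) := by grind
  have e2 : insert b K ∩ W = insert b (K.erase d) := by grind
  have e3 : insert c K ∩ W = K.erase d := by grind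
  have n1 : (insert a (K.erase d)).card = (K.erase d).card + 1 := by grind
  have n2 : (insert b (K.erase d)).card = (K.erase d).card + 1 := by grind
  rw [e1] at h1
  rw [e2] at h2
  rw [e3] at h3
  refine hr.not_line (m := m) (he.rank (by grind)) (he.rank (by grind)) (he.rank (by grind))
    (he.rank hWc) (he.rank_insert_inf hK ha hb hab) ?_ ?_ ?_ h h' <;> omega

lemma IsRankIsometry.star_or_top {K : Finset α} (hK : K.card + 1 = k)
    {a b c : α} (ha : a ∉ K) (hb : b ∉ K) (hc : c ∉ K) (hab : a ≠ b) (hac : a ≠ c) (hbc : b ≠ c) :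
    e (insert a K) ⊓ e (insert b K) ≤ e (insert c K) ∨
      e (insert c K) ≤ e (insert a K) ⊔ e (insert b K) :=
  hr.inf_le_or_le_sup (he.rank (by grind))
    (he.rank_insert_inf hK ha hb hab) (he.rank_insert_inf hK ha hc hac)
    (he.rank_insert_inf hK hb hc hbc)

/-- If some member `u` of the star escaped the meet of the images at `a` and `b`, its image would
lie under their join. The image at `c` would lie under the join of those at `a` and `u`, hence under
the same join, and the triple would be collinear. -/
lemma IsRankIsometry.starAt_of_triple (hk : 2 ≤ k) {K : Finset α} (hK : K.card + 1 = k)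
    {a b c : α} (ha : a ∉ K) (hb : b ∉ K) (hc : c ∉ K) (hab : a ≠ b) (hac : a ≠ c) (hbc : b ≠ c)
    (h : e (insert a K) ⊓ e (insert b K) ≤ e (insert c K)) : StarAt r m e K := by
  have hR : ∀ {x}, x ∉ K → r (e (insert x K)) = m := fun hx => he.rank (by grind)
  have hA : ∀ {x y}, x ∉ K → y ∉ K → x ≠ y → r (e (insert x K) ⊓ e (insert y K)) + 1 = m :=
    fun hx hy => he.rank_insert_inf hK hx hy
  refine ⟨e (insert a K) ⊓ e (insert b K), hA ha hb hab, fun u hu => ?_⟩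
  by_cases hua : u = a
  · exact hua ▸ inf_le_left
  by_cases hub : u = b
  · exact hub ▸ inf_le_right
  by_cases huc : u = c
  · exact huc ▸ h
  by_contra hn
  have t1 := (he.star_or_top hr hK ha hb hu hab (Ne.symm hua) (Ne.symm hub)).resolve_left hn
  have s1 := hr.inf_eq_of_star (hA ha hb hab) (hA ha hc hac) h
  have t2 : e (insert c K) ≤ e (insert a K) ⊔ e (insert u K) := by
    rcases he.star_or_top hr hK ha hu hc (Ne.symm hua) hac huc with h2 | h2
    · have := hr.inf_eq_of_star (hA ha hu (Ne.symm hua)) (hA ha hc hac) h2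
      exact absurd (s1 ▸ this ▸ inf_le_right) hn
    · exact h2
  refine he.not_line_of_star hr hk hK ha hb hc hab hac hbc h (t2.trans ?_)
  exact sup_le le_sup_left t1

lemma StarAt.inf_le {K : Finset α} (h : StarAt r m e K) (hK : K.card + 1 = k)
    {a b c : α} (ha : a ∉ K) (hb : b ∉ K) (hc : c ∉ K) (hab : a ≠ b) :
    e (insert a K) ⊓ e (insert b K) ≤ e (insert c K) := by
  obtain ⟨s, hs, h⟩ := h
  have := he.rank_insert_inf hK ha hb hab
  rw [hr.inf_eq (h a ha) (h b hb) (by omega)]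
  exact h c hc

/-- If the star at `M + a` were not mapped to a star, the image of `M + a + c` would lie under the
join of the images of `M + a + d` and `M + a + b`, hence, by `key`, under that of `M + a + d` and `M
+ b + d`. This join has rank `m + 1`. But `M + a + c` and `M + b + d` share only `M`, so their
images join in rank `m + 2`. -/
lemma StarAt.exchange_insert {M : Finset α} (hM : M.card + 2 = k) {a b c d : α}
    (ha : a ∉ M) (hb : b ∉ M) (hc : c ∉ M) (hd : d ∉ M) (hab : a ≠ b) (hac : a ≠ c) (had : a ≠ d)
    (hbc : b ≠ c) (hbd : b ≠ d) (hcd : c ≠ d) (h : StarAt r m e (insert d M)) :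
    StarAt r m e (insert a M) := by
  have hk : 2 ≤ k := by omega
  have hdM : (insert d M).card + 1 = k := by grind
  have haM : (insert a M).card + 1 = k := by grind
  by_cases hs : e (insert d (insert a M)) ⊓ e (insert b (insert a M)) ≤ e (insert c (insert a M))
  · exact he.starAt_of_triple hr hk haM (by grind) (by grind) (by grind) (Ne.symm hbd)
      (Ne.symm hcd) hbc hs
  have t1 := (he.star_or_top hr haM (by grind) (by grind) (by grind) (Ne.symm hbd)
      (Ne.symm hcd) hbc).resolve_left hs
  have key : e (insert b (insert a M)) ≤ e (insert a (insert d M)) ⊔ e (insert b (insert d M)) := by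
    have c1 := he (insert a (insert d M)) (insert b (insert a M)) (by grind) (by grind)
    have c2 := he (insert b (insert d M)) (insert b (insert a M)) (by grind) (by grind)
    have c3 := he (insert c (insert d M)) (insert b (insert a M)) (by grind) (by grind)
    have e1 : insert a (insert d M) ∩ insert b (insert a M) = insert a M := by grind
    have e2 : insert b (insert d M) ∩ insert b (insert a M) = insert b M := by grind
    have e3 : insert c (insert d M) ∩ insert b (insert a M) = M := by grind
    have n2 : (insert b M).card = M.card + 1 := by grind
    rw [e1] at c1
    rw [e2] at c2
    rw [e3] at c3
    refine (hr.inf_le_or_le_sup (m := m) (he.rank (by grind))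
      -- In the other alternative the star at `M + d` would put the meet, of rank `m - 1`, also
      -- under the image of `M + c + d`, which meets that of `M + a + b` in rank `m - 2` only.
      (he.rank_insert_inf hdM (by grind) (by grind) hab) (by omega) (by omega)).resolve_left ?_
    intro h1
    have h2 := StarAt.inf_le hr he h hdM (a := a) (b := b) (c := c) (by grind) (by grind)
      (by grind) hab
    have h3 := hr.mono (le_inf h2 h1)
    have := he.rank_insert_inf hdM (a := a) (b := b) (by grind) (by grind) hab
    omega
  exfalso
  have hda : insert d (insert a M) = insert a (insert d M) := Finset.insert_comm _ _ _
  have h1 : e (insert c (insert a M)) ≤ e (insert a (insert d M)) ⊔ e (insert b (insert d M)) :=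
    t1.trans (sup_le (hda ▸ le_sup_left) key)
  have h2 := hr.mono (sup_le h1 (le_sup_right : e (insert b (insert d M)) ≤ _))
  have c1 := he (insert c (insert a M)) (insert b (insert d M)) (by grind) (by grind)
  have e1 : insert c (insert a M) ∩ insert b (insert d M) = M := by grind
  rw [e1] at c1
  have h3 := hr.modular (e (insert c (insert a M))) (e (insert b (insert d M)))
  have h4 := hr.modular (e (insert a (insert d M))) (e (insert b (insert d M)))
  have h5 := he.rank_insert_inf hdM (a := a) (b := b) (by grind) (by grind) hab
  have r1 := he.rank (I := insert c (insert a M)) (by grind)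
  have r2 := he.rank (I := insert b (insert d M)) (by grind)
  have r3 := he.rank (I := insert a (insert d M)) (by grind)
  omega

lemma StarAt.forall [Fintype α] (hkn : k + 2 ≤ Fintype.card α) {K : Finset α}
    (hK : K.card + 1 = k) (h : StarAt r m e K) :
    ∀ K' : Finset α, K'.card + 1 = k → StarAt r m e K' := by
  intro K' hK'
  induction hN : (K' \ K).card generalizing K with
  | zero =>
    have h1 : K' ⊆ K := by
      rw [Finset.card_eq_zero] at hN
      exact Finset.sdiff_eq_empty_iff_subset.mp hN
    rw [Finset.eq_of_subset_of_card_le h1 (by omega)]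
    exact h
  | succ N ih =>
    obtain ⟨a, ha⟩ : (K' \ K).Nonempty := Finset.card_pos.mp (by omega)
    obtain ⟨d, hd⟩ : (K \ K').Nonempty := by
      have := Finset.card_sdiff_add_card_inter K K'
      have := Finset.card_sdiff_add_card_inter K' K
      rw [Finset.inter_comm] at this
      exact Finset.card_pos.mp (by omega)
    rw [Finset.mem_sdiff] at ha hd
    have hcd := Finset.card_erase_add_one hd.1
    set T := insert a (insert d (K.erase d)) with hT
    have hTc : T.card = k := by grind
    obtain ⟨b, hb, c, hc, hbc⟩ : ∃ b ∈ Tᶜ, ∃ c ∈ Tᶜ, b ≠ c := by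
      apply Finset.one_lt_card.mp
      rw [Finset.card_compl]
      omega
    rw [Finset.mem_compl] at hb hc
    refine ih (K := insert a (K.erase d)) (by grind) ?_ ?_
    · refine StarAt.exchange_insert hr he (M := K.erase d) (a := a) (b := b) (c := c) (d := d)
        (by omega) (by grind) (by grind) (by grind) (by grind) (by grind) (by grind) (by grind)
        hbc (by grind) (by grind) ?_
      rwa [Finset.insert_erase hd.1]
    · have : K' \ insert a (K.erase d) = (K' \ K).erase a := by
        ext x
        have : x = d → x ∉ K' := fun h => h ▸ hd.2
        simp only [Finset.mem_sdiff, Finset.mem_insert, Finset.mem_erase]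
        tauto
      rw [this, Finset.card_erase_of_mem (by grind)]
      omega

end

end Embedding

end Lattice

open OrderDual

/-! ### Stars go to stars, possibly after order reversal -/

section Dichotomy

variable {L : Type*} [Lattice L] {α : Type*} [DecidableEq α] {r : L → ℕ} {k m : ℕ}
  {e : Finset α → L}

/-- All stars of the Johnson graph are mapped into stars. -/
def StarType (k : ℕ) (e : Finset α → L) : Prop :=
  ∀ (K : Finset α) (a b c : α), K.card + 1 = k → a ∉ K → b ∉ K → c ∉ K → a ≠ b →
    e (insert a K) ⊓ e (insert b K) ≤ e (insert c K)

lemma IsRankIsometry.dual [OrderTop L] (hr : IsRank r) (he : IsRankIsometry r k m e) :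
    IsRankIsometry (fun x : Lᵒᵈ => r ⊤ - r (ofDual x)) k (r ⊤ - m) (fun I => toDual (e I)) := by
  intro I J hI hJ
  have h1 := he I J hI hJ
  have h2 := hr.modular (e I) (e J)
  have h3 := he.rank hI
  have h4 := he.rank hJ
  have h5 := hr.mono (le_top (a := e I ⊔ e J))
  have h6 := hr.mono (inf_le_left : e I ⊓ e J ≤ e I)
  have h7 : (I ∩ J).card ≤ I.card := Finset.card_le_card Finset.inter_subset_left
  simp only [ofDual_inf, ofDual_toDual]
  omega

/-- One star mapped to a star forces all of them by `StarAt.forall`. If there is none, every triple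
of a star lies under a common join, which is the star condition in the order dual. -/
lemma IsRankIsometry.starType_or_dual [Fintype α] [OrderTop L] (hr : IsRank r)
    (he : IsRankIsometry r k m e) (hk : 2 ≤ k) (hkn : k + 2 ≤ Fintype.card α) :
    StarType k e ∨ StarType k (fun I => toDual (e I)) := by
  by_cases h : ∃ K, K.card + 1 = k ∧ StarAt r m e K
  · left
    obtain ⟨K₀, hK₀, h⟩ := h
    intro K a b c hK ha hb hc hab
    exact StarAt.inf_le hr he (h.forall hr he hkn hK₀ K hK) hK ha hb hc hab
  · right
    intro K a b c hK ha hb hc hab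
    change e (insert c K) ≤ e (insert a K) ⊔ e (insert b K)
    by_cases hac : a = c
    · exact hac ▸ le_sup_left
    by_cases hbc : b = c
    · exact hbc ▸ le_sup_right
    refine (he.star_or_top hr hK ha hb hc hab hac hbc).resolve_left fun h1 => h ⟨K, hK, ?_⟩
    exact he.starAt_of_triple hr hk hK ha hb hc hab hac hbc h1

/-- Under `e J'` the elements `e I ⊓ e J'` and `e J ⊓ e J'` are so large that their meet has at
least the rank of `e I ⊓ e J`; being below it, that meet equals it. -/
lemma IsRankIsometry.inf_le_exchange (hr : IsRank r) (he : IsRankIsometry r k m e)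
    {I J : Finset α} (hI : I.card = k) (hJ : J.card = k) {a b : α} (ha : a ∈ I) (ha' : a ∉ J)
    (hb : b ∈ J) (hb' : b ∉ I) : e I ⊓ e J ≤ e (insert a (J.erase b)) := by
  set J' := insert a (J.erase b) with hJ'
  have hbc := Finset.card_erase_add_one hb
  have hJ'c : J'.card = k := by
    rw [hJ', Finset.card_insert_of_notMem (by simp [ha'])]
    omega
  have h1 := he I J hI hJ
  have h2 := he I J' hI hJ'c
  have h3 := he J J' hJ hJ'c
  have e2 : I ∩ J' = insert a (I ∩ J) := by grind
  have e3 : J ∩ J' = J.erase b := by grind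
  rw [e2, Finset.card_insert_of_notMem (by simp [ha'])] at h2
  rw [e3] at h3
  have h4 := hr.modular (e I ⊓ e J') (e J ⊓ e J')
  have h5 := hr.mono (sup_le inf_le_right inf_le_right : (e I ⊓ e J') ⊔ (e J ⊓ e J') ≤ e J')
  have h6 := he.rank hJ'c
  have h7 : (e I ⊓ e J') ⊓ (e J ⊓ e J') ≤ e I ⊓ e J := inf_le_inf inf_le_left inf_le_left
  rw [← hr.eq_of_le h7 (by omega)]
  exact inf_le_left.trans inf_le_right

/-- The set `J` is moved towards `T` by trading `b ∈ J \ T` for `c ∈ T \ J`. The meet stays below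
because it lies under two members of the star at `J - b`, namely `e J` and the image of `J - b + a`
with `a ∈ I \ J`, and so under the whole star. -/
lemma IsRankIsometry.inf_le_of_inter_subset (hr : IsRank r) (he : IsRankIsometry r k m e)
    (hs : StarType k e) {I J T : Finset α} (hI : I.card = k) (hJ : J.card = k) (hT : T.card = k)
    (h : I ∩ J ⊆ T) : e I ⊓ e J ≤ e T := by
  induction hN : (J \ T).card generalizing J with
  | zero =>
    rw [Finset.card_eq_zero, Finset.sdiff_eq_empty_iff_subset] at hN
    rw [Finset.eq_of_subset_of_card_le hN (by omega)]
    exact inf_le_right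
  | succ N ih =>
    have h0 : (J \ T).Nonempty := Finset.card_pos.mp (by omega)
    obtain ⟨b, hb⟩ := h0
    obtain ⟨c, hc⟩ : (T \ J).Nonempty := by
      rw [Finset.sdiff_nonempty]
      intro h'
      rw [Finset.eq_of_subset_of_card_le h' (by omega)] at hN
      simp at hN
    rw [Finset.mem_sdiff] at hb hc
    have hbI : b ∉ I := fun hb' => hb.2 (h (Finset.mem_inter.mpr ⟨hb', hb.1⟩))
    obtain ⟨a, ha⟩ : (I \ J).Nonempty := by
      rw [Finset.sdiff_nonempty]
      intro h'
      rw [Finset.eq_of_subset_of_card_le h' (by omega)] at hbI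
      exact hbI hb.1
    rw [Finset.mem_sdiff] at ha
    have hcard := Finset.card_erase_add_one hb.1
    have h1 := he.inf_le_exchange hr hI hJ ha.1 ha.2 hb.1 hbI
    have h2 : e I ⊓ e J ≤ e (insert c (J.erase b)) := by
      refine le_trans (le_inf h1 inf_le_right) ?_
      have := hs (J.erase b) a b c (by omega) (by simp [ha.2]) (by simp) (by simp [hc.2])
        (fun h => ha.2 (h ▸ hb.1))
      rwa [Finset.insert_erase hb.1] at this
    refine le_trans (le_inf inf_le_left h2) (ih ?_ ?_ ?_)
    · rw [Finset.card_insert_of_notMem (by simp [hc.2])]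
      omega
    · intro x hx
      simp only [Finset.mem_inter, Finset.mem_insert, Finset.mem_erase] at hx
      rcases hx.2 with h3 | h3
      · exact h3 ▸ hc.1
      · exact h (Finset.mem_inter.mpr ⟨hx.1, h3.2⟩)
    · have : insert c (J.erase b) \ T = (J \ T).erase b := by
        ext x
        have : x = c → x ∈ T := fun h => h ▸ hc.1
        simp only [Finset.mem_sdiff, Finset.mem_insert, Finset.mem_erase]
        tauto
      rw [this, Finset.card_erase_of_mem (by simp [hb])]
      omega

end Dichotomy

/-! ### Extending an embedding to smaller index sets -/

section Extension

variable {L : Type*} [Lattice L] {α : Type*} [DecidableEq α] {r : L → ℕ} {k s : ℕ}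

/-- The extension of an embedding `e` of `J(n,k)` to all subsets with at most `k` elements. -/
structure IsExtension (r : L → ℕ) (k s : ℕ) (e E : Finset α → L) : Prop where
  eq : ∀ I, I.card = k → E I = e I
  rank : ∀ M, M.card ≤ k → r (E M) = s + M.card
  inf : ∀ M N, M.card ≤ k → N.card ≤ k → E M ⊓ E N = E (M ∩ N)

lemma exists_inter_eq [Fintype α] {M N : Finset α} (hM : M.card ≤ k) (hN : N.card ≤ k)
    (hkn : 2 * k ≤ Fintype.card α) :
    ∃ I J : Finset α, I.card = k ∧ J.card = k ∧ M ⊆ I ∧ N ⊆ J ∧ I ∩ J = M ∩ N := by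
  have hu := Finset.card_union_add_card_inter M N
  obtain ⟨A, hA, hAc⟩ := Finset.exists_subset_card_eq (s := (M ∪ N)ᶜ) (n := k - M.card) (by
    rw [Finset.card_compl]; omega)
  have hd1 : Disjoint M A := Finset.disjoint_left.mpr fun x hx hx' => by
    have := hA hx'
    simp [hx] at this
  have hd2 : Disjoint N A := Finset.disjoint_left.mpr fun x hx hx' => by
    have := hA hx'
    simp [hx] at this
  obtain ⟨B, hB, hBc⟩ := Finset.exists_subset_card_eq (s := (M ∪ N ∪ A)ᶜ) (n := k - N.card) (by
    rw [Finset.card_compl]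
    have := Finset.card_union_le (M ∪ N) A
    omega)
  have hd3 : Disjoint N B := Finset.disjoint_left.mpr fun x hx hx' => by
    have := hB hx'
    simp [hx] at this
  refine ⟨M ∪ A, N ∪ B, ?_, ?_, Finset.subset_union_left, Finset.subset_union_left, ?_⟩
  · rw [Finset.card_union_of_disjoint hd1]
    omega
  · rw [Finset.card_union_of_disjoint hd3]
    omega
  · ext x
    have h1 := @hA x
    have h2 := @hB x
    simp only [Finset.mem_inter, Finset.mem_union, Finset.mem_compl] at h1 h2 ⊢
    tauto

/-- The value at `M` is the meet of all `e T` with `M ⊆ T`. By `inf_le_of_inter_subset` this meet is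
already reached by two `k`-sets intersecting in `M`, and `2 * k ≤ n` leaves room for such sets;
ranks and meets are read off from them. -/
lemma IsRankIsometry.exists_extension [OrderTop L] [Fintype α] (hr : IsRank r) {e : Finset α → L}
    (he : IsRankIsometry r k (s + k) e)
    (hs : StarType k e) (hkn : 2 * k ≤ Fintype.card α) : ∃ E, IsExtension r k s e E := by
  classical
  set E : Finset α → L := fun M => (Finset.univ.filter fun T => M ⊆ T ∧ T.card = k).inf e with hE
  have hle : ∀ M T, M ⊆ T → T.card = k → E M ≤ e T := fun M T h h' =>
    Finset.inf_le (by simp [h, h'])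
  have hmono : ∀ M N, M ⊆ N → E M ≤ E N := fun M N h => Finset.inf_mono fun T hT => by
    simp only [Finset.mem_filter, Finset.mem_univ, true_and] at hT ⊢
    exact ⟨h.trans hT.1, hT.2⟩
  have hkey : ∀ I J, I.card = k → J.card = k → E (I ∩ J) = e I ⊓ e J := fun I J hI hJ => by
    refine le_antisymm (le_inf (hle _ _ Finset.inter_subset_left hI)
      (hle _ _ Finset.inter_subset_right hJ)) (Finset.le_inf fun T hT => ?_)
    simp only [Finset.mem_filter, Finset.mem_univ, true_and] at hT
    exact he.inf_le_of_inter_subset hr hs hI hJ hT.2 hT.1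
  refine ⟨E, fun I hI => ?_, fun M hM => ?_, fun M N hM hN => ?_⟩
  · have := hkey I I hI hI
    simpa using this
  · obtain ⟨I, J, hI, hJ, -, -, h⟩ := exists_inter_eq hM hM hkn
    rw [Finset.inter_self] at h
    have := he I J hI hJ
    rw [← h, hkey I J hI hJ]
    omega
  · obtain ⟨I, J, hI, hJ, h1, h2, h⟩ := exists_inter_eq hM hN hkn
    refine le_antisymm ?_ (le_inf (hmono _ _ Finset.inter_subset_left)
      (hmono _ _ Finset.inter_subset_right))
    rw [← h, hkey I J hI hJ]
    exact inf_le_inf (hle _ _ h1 hI) (hle _ _ h2 hJ)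

lemma IsExtension.le_iff {e E : Finset α → L} (h : IsExtension r k s e E) {M N : Finset α}
    (hM : M.card ≤ k) (hN : N.card ≤ k) : E M ≤ E N ↔ M ⊆ N := by
  rw [← inf_eq_left, h.inf M N hM hN, ← Finset.inter_eq_left]
  refine ⟨fun h' => ?_, fun h' => by rw [h']⟩
  have h1 := h.rank (M ∩ N) ((Finset.card_le_card Finset.inter_subset_left).trans hM)
  rw [h', h.rank M hM] at h1
  exact Finset.eq_of_subset_of_card_le Finset.inter_subset_left (by omega)

lemma IsExtension.exists_inf [OrderTop L] {e E : Finset α → L} (h : IsExtension r k s e E)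
    (Y : Finset (Finset α)) (hY : Y.Nonempty) (hk : ∀ I ∈ Y, I.card = k) :
    ∃ M : Finset α, M.card ≤ k ∧ Y.inf e = E M := by
  induction hY using Finset.Nonempty.cons_induction with
  | singleton I => exact ⟨I, (hk I (by simp)).le, by simp [h.eq I (hk I (by simp))]⟩
  | cons I Y hI hY ih =>
    obtain ⟨M, hM, h'⟩ := ih fun J hJ => hk J (by simp [hJ])
    have hIk := hk I (by simp)
    refine ⟨I ∩ M, (Finset.card_le_card Finset.inter_subset_left).trans hIk.le, ?_⟩
    rw [Finset.inf_cons, h', ← h.eq I hIk, h.inf _ _ hIk.le hM]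

end Extension

/-! ### Frames: the Boolean lattices spanned by bases -/

section Frame

variable {L : Type*} [Lattice L] {α : Type*} [DecidableEq α] {r : L → ℕ} {s : ℕ}

/-- A Boolean sublattice with rank function `I ↦ s + |I|`: the spans of the subsets of a base of a
parabolic subspace. -/
structure IsFrame (r : L → ℕ) (s : ℕ) (F : Finset α → L) : Prop where
  sup : ∀ I J, F (I ∪ J) = F I ⊔ F J
  rank : ∀ I, r (F I) = s + I.card

namespace IsFrame

variable {F : Finset α → L} (hF : IsFrame r s F)
include hF

lemma mono {I J : Finset α} (h : I ⊆ J) : F I ≤ F J := by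
  rw [← Finset.union_eq_right.mpr h, hF.sup]
  exact le_sup_left

lemma inf (hr : IsRank r) (I J : Finset α) : F I ⊓ F J = F (I ∩ J) := by
  refine hr.inf_eq (hF.mono Finset.inter_subset_left) (hF.mono Finset.inter_subset_right) ?_
  have h1 := hr.modular (F I) (F J)
  rw [← hF.sup, hF.rank, hF.rank, hF.rank] at h1
  have := Finset.card_union_add_card_inter I J
  rw [hF.rank]
  omega

lemma le_iff {I J : Finset α} : F I ≤ F J ↔ I ⊆ J := by
  refine ⟨fun h => ?_, hF.mono⟩
  have h1 : F (I ∪ J) = F J := by rw [hF.sup, sup_eq_right.mpr h]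
  have h2 := hF.rank (I ∪ J)
  rw [h1, hF.rank] at h2
  rw [← Finset.union_eq_right]
  exact (Finset.eq_of_subset_of_card_le Finset.subset_union_right (by omega)).symm

lemma injective : Function.Injective F := fun _ _ h =>
  Finset.Subset.antisymm (hF.le_iff.mp h.le) (hF.le_iff.mp h.ge)

lemma le_of_singleton {I : Finset α} {z : L} (h0 : F ∅ ≤ z) (h : ∀ i ∈ I, F {i} ≤ z) :
    F I ≤ z := by
  induction I using Finset.induction_on with
  | empty => exact h0
  | insert a I ha ih =>
    rw [Finset.insert_eq, hF.sup]
    exact sup_le (h a (by simp)) (ih fun i hi => h i (by simp [hi]))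

lemma inf_eq [OrderTop L] (hr : IsRank r) (Y : Finset (Finset α)) (hY : Y.Nonempty)
    (M : Finset α) (hM : ∀ a, a ∈ M ↔ ∀ I ∈ Y, a ∈ I) : Y.inf F = F M := by
  induction hY using Finset.Nonempty.cons_induction generalizing M with
  | singleton I =>
    have : M = I := by ext a; simp [hM]
    simp [this]
  | cons I Y hI hY ih =>
    have hfin : ∃ N : Finset α, ∀ a, a ∈ N ↔ ∀ I ∈ Y, a ∈ I := by
      obtain ⟨J, hJ⟩ := hY
      exact ⟨J.filter fun a => ∀ I ∈ Y, a ∈ I, fun a => by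
        simp only [Finset.mem_filter, and_iff_right_iff_imp]
        exact fun h => h J hJ⟩
    obtain ⟨N, hN⟩ := hfin
    have : M = I ∩ N := by ext a; simp [hM, hN]
    rw [Finset.inf_cons, ih N hN, this, hF.inf hr]

lemma dual [OrderTop L] [Fintype α] (hr : IsRank r) :
    IsFrame (fun x : Lᵒᵈ => r ⊤ - r (ofDual x)) (r ⊤ - s - Fintype.card α)
      (fun I => toDual (F Iᶜ)) where
  sup I J := by
    rw [Finset.compl_union, ← hF.inf hr]
    rfl
  rank I := by
    have h1 := hr.mono (le_top (a := F Finset.univ))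
    have h2 := I.card_le_univ
    rw [hF.rank, Finset.card_univ] at h1
    simp only [ofDual_toDual, hF.rank, Finset.card_compl]
    omega

end IsFrame

end Frame

open OrderDual

/-! ### Comparing an embedding with a frame when `2k < n` -/

section Rigidity

variable {L : Type*} [Lattice L] [BoundedOrder L] {α : Type*} [DecidableEq α] [Fintype α] {r : L → ℕ}
  {k s : ℕ} {e E F : Finset α → L}

/-- The member `F I` of a frame lies in the image of the embedding `e`. -/
def Hit (k : ℕ) (e F : Finset α → L) (I : Finset α) : Prop :=
  I.card = k ∧ ∃ I', I'.card = k ∧ e I' = F I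

/-- If the common members of `e` and a frame `F` cover the index set, then `e` maps stars to
stars. -/
lemma IsFrame.starType_of_cover (hr : IsRank r) (hF : IsFrame r s F)
    (he : IsRankIsometry r k (s + k) e) (hk : 2 ≤ k) (hkn : 2 * k < Fintype.card α)
    (hcov : ∀ i, ∃ I, Hit k e F I ∧ i ∈ I) : StarType k e := by
  refine (he.starType_or_dual hr hk (by omega)).resolve_right fun hs => ?_
  have hU := hF.rank Finset.univ
  rw [Finset.card_univ] at hU
  have htop := hr.mono (le_top (a := F Finset.univ))
  -- With this bottom rank in the order dual, `E ∅` has rank `s + 2k` in the original order, and it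
  -- lies above every member of `e`.
  obtain ⟨s', hs'⟩ : ∃ s', r ⊤ - (s + k) = s' + k := ⟨r ⊤ - s - 2 * k, by omega⟩
  have hd := he.dual hr
  rw [hs'] at hd
  obtain ⟨E, hE⟩ := hd.exists_extension hr.dual hs hkn.le
  have hz := hE.rank ∅ (by simp)
  have hzle : ∀ I, I.card = k → e I ≤ ofDual (E ∅) := fun I hI => by
    have h1 := (hE.le_iff (M := ∅) (N := I) (by simp) hI.le).mpr (by simp)
    rw [hE.eq I hI] at h1
    exact h1
  have hz' := hr.mono (le_top (a := ofDual (E ∅)))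
  -- Since the common members cover all indices, `F Finset.univ`, of rank `s + n > s + 2k`, would
  -- lie below `E ∅`.
  have hall : F Finset.univ ≤ ofDual (E ∅) := by
    have hF1 : ∀ i, F {i} ≤ ofDual (E ∅) := fun i => by
      obtain ⟨I, ⟨-, I', hI', h'⟩, hi⟩ := hcov i
      exact (hF.mono (Finset.singleton_subset_iff.mpr hi)).trans (h' ▸ hzle I' hI')
    obtain ⟨i⟩ : Nonempty α := Fintype.card_pos_iff.mp (by omega)
    exact hF.le_of_singleton ((hF.mono (Finset.empty_subset {i})).trans (hF1 i)) fun i _ => hF1 i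
  have := hr.mono hall
  simp only [Finset.card_empty] at hz
  omega

/-- A member of a frame which is an intersection of members of `e` occurs in the extension of
`e`. -/
lemma IsFrame.exists_eq_extension (hr : IsRank r) (hF : IsFrame r s F)
    (hE : IsExtension r k s e E) {M : Finset α} (hM : ∃ I, Hit k e F I ∧ M ⊆ I)
    (hsep : ∀ j ∉ M, ∃ I, Hit k e F I ∧ M ⊆ I ∧ j ∉ I) :
    ∃ N : Finset α, N.card ≤ k ∧ N.card = M.card ∧ F M = E N := by
  classical
  set Y := Finset.univ.filter fun I => Hit k e F I ∧ M ⊆ I with hY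
  set Y' := Finset.univ.filter fun I' => I'.card = k ∧ ∃ I ∈ Y, e I' = F I with hY'
  obtain ⟨I₀, h₀, hM₀⟩ := hM
  have hYmem : ∀ I, I ∈ Y ↔ Hit k e F I ∧ M ⊆ I := fun I => by simp [hY]
  have hYmem' : ∀ I', I' ∈ Y' ↔ I'.card = k ∧ ∃ I ∈ Y, e I' = F I := fun I' => by simp [hY']
  have h1 : Y.inf F = F M := hF.inf_eq hr Y ⟨I₀, (hYmem _).mpr ⟨h₀, hM₀⟩⟩ M fun a => by
    refine ⟨fun ha I hI => ((hYmem I).mp hI).2 ha, fun h => ?_⟩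
    by_contra ha
    obtain ⟨I, hI, hMI, haI⟩ := hsep a ha
    exact haI (h I ((hYmem I).mpr ⟨hI, hMI⟩))
  have h2 : Y'.inf e = Y.inf F := by
    refine le_antisymm (Finset.le_inf fun I hI => ?_) (Finset.le_inf fun I' hI' => ?_)
    · obtain ⟨I', hI', h'⟩ := ((hYmem I).mp hI).1.2
      exact h' ▸ Finset.inf_le ((hYmem' I').mpr ⟨hI', I, hI, h'⟩)
    · obtain ⟨-, I, hI, h'⟩ := (hYmem' I').mp hI'
      exact h' ▸ Finset.inf_le hI
  obtain ⟨I', hI', h'⟩ := h₀.2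
  obtain ⟨N, hN, h3⟩ := hE.exists_inf Y'
    ⟨I', (hYmem' I').mpr ⟨hI', I₀, (hYmem _).mpr ⟨h₀, hM₀⟩, h'⟩⟩
    fun I hI => ((hYmem' I).mp hI).1
  have h4 : F M = E N := by rw [← h1, ← h2, h3]
  refine ⟨N, hN, ?_, h4⟩
  have h5 := hF.rank M
  rw [h4, hE.rank N hN] at h5
  omega

lemma IsFrame.exists_eq_extension_singleton (hr : IsRank r) (hF : IsFrame r s F)
    (hE : IsExtension r k s e E) {i : α} (hi : ∃ I, Hit k e F I ∧ i ∈ I)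
    (hsep : ∀ j, j ≠ i → ∃ I, Hit k e F I ∧ i ∈ I ∧ j ∉ I) : ∃ a, F {i} = E {a} := by
  obtain ⟨N, -, hN, h⟩ := hF.exists_eq_extension hr hE (M := {i}) (by simpa using hi)
    (fun j hj => by simpa using hsep j (by simpa using hj))
  obtain ⟨a, rfl⟩ := Finset.card_eq_one.mp (by simpa using hN)
  exact ⟨a, h⟩

/-- The member of `e` indexed by `p(I)` lies above all atoms of `F I`, and both have rank `s + k`.
-/
lemma IsFrame.exists_perm (hr : IsRank r) (hF : IsFrame r s F) (hE : IsExtension r k s e E)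
    (hk : 1 ≤ k) (p : α → α) (hp : ∀ i, F {i} = E {p i}) :
    ∃ π : Equiv.Perm α, ∀ I, I.card = k → e (I.image π) = F I := by
  have hinj : Function.Injective p := fun i j hij => by
    have : F {i} = F {j} := by rw [hp, hp, hij]
    simpa using hF.injective this
  refine ⟨Equiv.ofBijective p (Finite.injective_iff_bijective.mp hinj), fun I hI => ?_⟩
  have hc : (I.image p).card = k := by rw [Finset.card_image_of_injective _ hinj, hI]
  change e (I.image p) = F I
  rw [← hE.eq _ hc]
  have hle : ∀ i ∈ I, F {i} ≤ E (I.image p) := fun i hi => by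
    rw [hp]
    exact (hE.le_iff (by simpa using hk) hc.le).mpr (by
      simpa using ⟨i, hi, rfl⟩)
  obtain ⟨i, hi⟩ : I.Nonempty := Finset.card_pos.mp (by omega)
  refine (hr.eq_of_le (hF.le_of_singleton
    ((hF.mono (Finset.empty_subset {i})).trans (hle i hi)) hle) ?_).symm
  rw [hE.rank _ hc.le, hF.rank, hc, hI]

/-- Separation makes each singleton an intersection of index sets of common members, so every atom
of `F` is an atom of the extension of `e`. -/
lemma IsFrame.exists_perm_of_separated_of_lt (hr : IsRank r) (hF : IsFrame r s F)
    (he : IsRankIsometry r k (s + k) e) (hk : 2 ≤ k) (hkn : 2 * k < Fintype.card α)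
    (hsep : ∀ i j, i ≠ j → ∃ I, Hit k e F I ∧ i ∈ I ∧ j ∉ I) :
    ∃ π : Equiv.Perm α, ∀ I, I.card = k → e (I.image π) = F I := by
  have : Nontrivial α := Fintype.one_lt_card_iff_nontrivial.mp (by omega)
  have hcov : ∀ i, ∃ I, Hit k e F I ∧ i ∈ I := fun i => by
    obtain ⟨j, hj⟩ := exists_ne i
    obtain ⟨I, h1, h2, -⟩ := hsep i j hj.symm
    exact ⟨I, h1, h2⟩
  obtain ⟨E, hE⟩ := he.exists_extension hr (hF.starType_of_cover hr he hk hkn hcov) hkn.le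
  choose p hp using fun i => hF.exists_eq_extension_singleton hr hE (hcov i)
    fun j hj => hsep i j hj.symm
  exact hF.exists_perm hr hE (by omega) p hp

/-- Replacing one atom of a frame. -/
lemma IsFrame.exists_replace (hr : IsRank r) (hF : IsFrame r s F) {i j : α} (hij : i ≠ j) {q : L}
    (hq0 : F ∅ ≤ q) (hq : r q = s + 1) (hqij : q ≤ F {i, j}) (hqj : r (q ⊓ F {j}) ≤ s) :
    ∃ F', IsFrame r s F' ∧ F' ∅ = F ∅ ∧ F' Finset.univ = F Finset.univ ∧ F' {i} = q ∧
      ∀ I, i ∉ I → F' I = F I := by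
  set F' : Finset α → L := fun I => if i ∈ I then q ⊔ F (I.erase i) else F I with hF'
  -- For `i ∉ I` the element `q` meets `F I` inside `F {j}`, hence only in rank `s`, so adjoining
  -- `q` raises the rank by exactly one.
  have hrank : ∀ I, i ∉ I → r (q ⊔ F I) = s + I.card + 1 := fun I hI => by
    have h1 := hr.modular q (F I)
    have h2 : q ⊓ F I ≤ q ⊓ F {j} := by
      refine le_inf inf_le_left ?_
      calc q ⊓ F I ≤ F {i, j} ⊓ F I := inf_le_inf_right _ hqij
        _ = F ({i, j} ∩ I) := hF.inf hr _ _
        _ ≤ F {j} := hF.mono fun x hx => by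
          simp only [Finset.mem_inter, Finset.mem_insert, Finset.mem_singleton] at hx ⊢
          rcases hx with ⟨rfl | rfl, h⟩
          · exact absurd h hI
          · rfl
    have h3 := hr.mono h2
    have h4 := hr.mono (le_inf hq0 (hF.mono (Finset.empty_subset I)))
    rw [hF.rank, Finset.card_empty] at h4
    rw [hF.rank] at h1
    omega
  have hfr : IsFrame r s F' := by
    refine ⟨fun I J => ?_, fun I => ?_⟩
    · by_cases hI : i ∈ I <;> by_cases hJ : i ∈ J
      · simp only [hF', hI, hJ, if_true, Finset.mem_union, true_or, Finset.erase_union_distrib,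
          hF.sup]
        rw [sup_sup_distrib_left]
      · simp only [hF', hI, hJ, if_true, if_false, Finset.mem_union, true_or,
          Finset.erase_union_distrib, Finset.erase_eq_of_notMem hJ, hF.sup, sup_assoc]
      · simp only [hF', hI, hJ, if_true, if_false, Finset.mem_union, or_true,
          Finset.erase_union_distrib, Finset.erase_eq_of_notMem hI, hF.sup]
        rw [sup_left_comm]
      · simp only [hF', hI, hJ, if_false, Finset.mem_union, or_self, hF.sup]
    · by_cases hI : i ∈ I
      · simp only [hF', hI, if_true]
        rw [hrank _ (by simp), add_assoc, Finset.card_erase_add_one hI]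
      · simp only [hF', hI, if_false, hF.rank]
  refine ⟨F', hfr, by simp [hF'], ?_, ?_, fun I hI => by simp [hF', hI]⟩
  · refine hr.eq_of_le ?_ (by rw [hfr.rank, hF.rank])
    simp only [hF', Finset.mem_univ, if_true]
    exact sup_le (hqij.trans (hF.mono (Finset.subset_univ _))) (hF.mono (Finset.subset_univ _))
  · simpa [hF'] using hq0

/-- The common members isolate every index except `i`, and also the pair `{i, j}`, so only the atom
at `i` can differ. The pair gives `F {i, j} = E N` with two elements in `N`; one is `p j`, and the
other provides the new atom. -/
lemma IsFrame.exists_frame_of_lt (hr : IsRank r) (hF : IsFrame r s F)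
    (he : IsRankIsometry r k (s + k) e) (hk : 2 ≤ k) (hkn : 2 * k < Fintype.card α)
    {i j : α} (hij : i ≠ j) (hX : ∀ I, I.card = k → (Hit k e F I ↔ ¬(i ∈ I ∧ j ∉ I))) :
    ∃ F', IsFrame r s F' ∧ F' ∅ = F ∅ ∧ F' Finset.univ = F Finset.univ ∧
      ∃ π : Equiv.Perm α, ∀ I, I.card = k → e (I.image π) = F' I := by
  have hex : ∀ A B : Finset α, A.card ≤ 2 → B.card ≤ 2 → Disjoint A B →
      ∃ I, I.card = k ∧ A ⊆ I ∧ ∀ x ∈ B, x ∉ I := fun A B hA hB hAB => by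
    obtain ⟨I, h1, h2, h3⟩ := Finset.exists_subsuperset_card_eq (s := A) (t := Bᶜ) (n := k)
      (Finset.subset_compl_iff_disjoint_right.mpr hAB) (by omega)
      (by rw [Finset.card_compl]; omega)
    exact ⟨I, h3, h1, fun x hx hx' => by simpa [hx] using h2 hx'⟩
  have hpt : ∀ l, l ≠ i → ∀ x, x ≠ l → ∃ I, Hit k e F I ∧ l ∈ I ∧ x ∉ I := fun l hl x hx => by
    obtain ⟨I, h1, h2, h3⟩ := hex {l} {i, x} (by simp) Finset.card_le_two (by
      simp [hl, hx.symm])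
    simp only [Finset.singleton_subset_iff, Finset.mem_insert, Finset.mem_singleton] at h2 h3
    exact ⟨I, (hX I h1).mpr fun h => h3 i (by simp) h.1, h2, h3 x (by simp)⟩
  have hpr : ∀ x ∉ ({i, j} : Finset α), ∃ I, Hit k e F I ∧ {i, j} ⊆ I ∧ x ∉ I := fun x hx => by
    obtain ⟨I, h1, h2, h3⟩ := hex {i, j} {x} Finset.card_le_two (by simp) (by simpa using hx)
    exact ⟨I, (hX I h1).mpr fun h => h.2 (h2 (by simp)), h2, h3 x (by simp)⟩
  obtain ⟨l, hl⟩ : ∃ l, l ∉ ({i, j} : Finset α) := by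
    obtain ⟨l, hl⟩ : (({i, j} : Finset α)ᶜ).Nonempty := Finset.card_pos.mp (by
      rw [Finset.card_compl]
      have := Finset.card_le_two (a := i) (b := j)
      omega)
    exact ⟨l, by simpa using hl⟩
  obtain ⟨hli, hlj⟩ : l ≠ i ∧ l ≠ j := by simpa using hl
  have hcov : ∀ x, ∃ I, Hit k e F I ∧ x ∈ I := fun x => by
    by_cases hx : x = i
    · obtain ⟨I, h1, h2, -⟩ := hpr l hl
      exact ⟨I, h1, hx ▸ h2 (by simp)⟩
    · obtain ⟨I, h1, h2, -⟩ := hpt x hx i (Ne.symm hx)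
      exact ⟨I, h1, h2⟩
  obtain ⟨E, hE⟩ := he.exists_extension hr (hF.starType_of_cover hr he hk hkn hcov) hkn.le
  have hp' : ∀ l, ∃ a, l ≠ i → F {l} = E {a} := fun l => by
    by_cases hl : l = i
    · exact ⟨l, fun h => absurd hl h⟩
    · obtain ⟨a, ha⟩ := hF.exists_eq_extension_singleton hr hE (hcov l) (hpt l hl)
      exact ⟨a, fun _ => ha⟩
  choose p hp using hp'
  obtain ⟨N, hNk, hN, hNE⟩ := hF.exists_eq_extension hr hE (M := {i, j}) (by
    obtain ⟨I, h1, h2, -⟩ := hpr l hl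
    exact ⟨I, h1, h2⟩) hpr
  rw [Finset.card_pair hij] at hN
  have hpj := hp j hij.symm
  have hjN : p j ∈ N := by
    have h1 : F {j} ≤ F {i, j} := hF.mono (by simp)
    rw [hpj, hNE, hE.le_iff (by simp; omega) hNk] at h1
    simpa using h1
  obtain ⟨a, haN, haj⟩ := Finset.exists_mem_ne (by omega : 1 < N.card) (p j)
  have haE : E {a} ≤ F {i, j} := by
    rw [hNE, hE.le_iff (by simp; omega) hNk]
    simpa using haN
  -- Both bottoms are the meet of the common atoms coming from `j` and `l`.
  have h0 : F ∅ = E ∅ := by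
    have h1 := hF.inf hr {j} {l}
    rw [hpj, hp l hli, hE.inf _ _ (by simp; omega) (by simp; omega)] at h1
    have h2 : p j ≠ p l := fun h => by
      have : F {j} = F {l} := by rw [hpj, hp l hli, h]
      exact hlj (by simpa using (hF.injective this).symm)
    rw [Finset.singleton_inter_of_notMem (by simpa using h2),
      Finset.singleton_inter_of_notMem (by simpa using hlj.symm)] at h1
    exact h1.symm
  obtain ⟨F', hF', hF'0, hF'u, hF'i, hF'n⟩ := hF.exists_replace hr hij (q := E {a})
    (h0 ▸ (hE.le_iff (by simp) (by simp; omega)).mpr (by simp))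
    (by simpa using hE.rank {a} (by simp; omega)) haE (by
      rw [hpj, hE.inf _ _ (by simp; omega) (by simp; omega),
        Finset.singleton_inter_of_notMem (by simpa using haj), hE.rank _ (by simp)]
      simp)
  refine ⟨F', hF', hF'0, hF'u, hF'.exists_perm hr hE (by omega) (Function.update p i a) ?_⟩
  intro x
  by_cases hx : x = i
  · subst hx
    simpa using hF'i
  · rw [Function.update_of_ne hx, hF'n _ (by simpa using Ne.symm hx), hp x hx]

end Rigidity

/-! ### Reduction of `n < 2k` to `n > 2k` -/

section RigidityDual

variable {L : Type*} [Lattice L] [BoundedOrder L] {α : Type*} [DecidableEq α] [Fintype α] {r : L → ℕ}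
  {k s : ℕ} {e F : Finset α → L}

/-- Complements identify `J(n,k)` with `J(n,n-k)`. Combined with order reversal this respects frames
as well, and turns `n < 2k` into `2(n - k) < n`. -/
lemma IsRankIsometry.complDual (hr : IsRank r) {m : ℕ} (he : IsRankIsometry r k m e)
    (hk : k ≤ Fintype.card α) :
    IsRankIsometry (fun x : Lᵒᵈ => r ⊤ - r (ofDual x)) (Fintype.card α - k) (r ⊤ - m)
      (fun I => toDual (e Iᶜ)) := by
  intro I J hI hJ
  have hI' := I.card_compl
  have hJ' := J.card_compl
  have := he.dual hr Iᶜ Jᶜ (by omega) (by omega)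
  have h1 : (Iᶜ ∩ Jᶜ).card = Fintype.card α - (I ∪ J).card := by
    rw [← Finset.compl_union, Finset.card_compl]
  have h2 := Finset.card_union_add_card_inter I J
  have h3 := (I ∪ J).card_le_univ
  have h4 : (I ∩ J).card ≤ I.card := Finset.card_le_card Finset.inter_subset_left
  simp only at this ⊢
  omega

lemma hit_compl_iff (hk : k ≤ Fintype.card α) {I : Finset α} :
    Hit (Fintype.card α - k) (fun I => toDual (e Iᶜ)) (fun I => toDual (F Iᶜ)) I ↔
      Hit k e F Iᶜ := by
  have h1 := I.card_compl
  have h2 := I.card_le_univ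
  refine ⟨fun ⟨hI, I', hI', h⟩ => ⟨by omega, I'ᶜ, ?_, h⟩,
    fun ⟨hI, I', hI', h⟩ => ⟨by omega, I'ᶜ, ?_, ?_⟩⟩
  · rw [Finset.card_compl]; omega
  · rw [Finset.card_compl]; omega
  · simp only [compl_compl, h]

lemma image_perm_compl (π : Equiv.Perm α) (I : Finset α) : (I.image π)ᶜ = Iᶜ.image π := by
  ext x
  simp [← Equiv.eq_symm_apply]

/-- If the common members of a frame and an isometric embedding separate points, then the
embedding is the frame up to a permutation. -/
lemma IsFrame.exists_perm_of_separated (hr : IsRank r) (hF : IsFrame r s F)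
    (he : IsRankIsometry r k (s + k) e) (hk : 2 ≤ k) (hkn : k + 2 ≤ Fintype.card α)
    (hne : Fintype.card α ≠ 2 * k)
    (hsep : ∀ i j, i ≠ j → ∃ I, Hit k e F I ∧ i ∈ I ∧ j ∉ I) :
    ∃ π : Equiv.Perm α, ∀ I, I.card = k → e (I.image π) = F I := by
  rcases lt_or_gt_of_ne hne with h | h
  · have htop := hr.mono (le_top (a := F Finset.univ))
    rw [hF.rank, Finset.card_univ] at htop
    have hd := he.complDual hr (by omega)
    have hs : r ⊤ - (s + k) = r ⊤ - s - Fintype.card α + (Fintype.card α - k) := by omega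
    rw [hs] at hd
    obtain ⟨π, hπ⟩ := (hF.dual hr).exists_perm_of_separated_of_lt hr.dual hd (by omega)
      (by omega) fun i j hij => by
        obtain ⟨I, h1, h2, h3⟩ := hsep j i hij.symm
        exact ⟨Iᶜ, (hit_compl_iff (by omega)).mpr (by rwa [compl_compl]), by simp [h2, h3]⟩
    refine ⟨π, fun I hI => ?_⟩
    have := hπ Iᶜ (by rw [Finset.card_compl, hI])
    rw [image_perm_compl, compl_compl] at this
    exact this
  · exact hF.exists_perm_of_separated_of_lt hr he hk h hsep

lemma IsFrame.exists_frame (hr : IsRank r) (hF : IsFrame r s F)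
    (he : IsRankIsometry r k (s + k) e) (hk : 2 ≤ k) (hkn : k + 2 ≤ Fintype.card α)
    (hne : Fintype.card α ≠ 2 * k)
    {i j : α} (hij : i ≠ j) (hX : ∀ I, I.card = k → (Hit k e F I ↔ ¬(i ∈ I ∧ j ∉ I))) :
    ∃ F', IsFrame r s F' ∧ F' ∅ = F ∅ ∧ F' Finset.univ = F Finset.univ ∧
      ∃ π : Equiv.Perm α, ∀ I, I.card = k → e (I.image π) = F' I := by
  rcases lt_or_gt_of_ne hne with h | h
  · have htop := hr.mono (le_top (a := F Finset.univ))
    rw [hF.rank, Finset.card_univ] at htop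
    have hd := he.complDual hr (by omega)
    have hs : r ⊤ - (s + k) = r ⊤ - s - Fintype.card α + (Fintype.card α - k) := by omega
    rw [hs] at hd
    -- Complementation exchanges the roles of `i` and `j`.
    obtain ⟨F', hF', h0, hu, π, hπ⟩ := (hF.dual hr).exists_frame_of_lt hr.dual hd (by omega)
      (by omega) hij.symm fun I hI => by
        rw [hit_compl_iff (by omega), hX _ (by rw [Finset.card_compl]; omega)]
        simp only [Finset.mem_compl]
        tauto
    have hF'' : IsFrame r s (fun I => ofDual (F' Iᶜ)) := by
      refine ⟨fun I J => ?_, fun I => ?_⟩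
      · rw [Finset.compl_union, ← hF'.inf hr.dual]
        rfl
      · have h1 := hF'.rank Iᶜ
        have h2 := hr.mono (le_top (a := ofDual (F' Iᶜ)))
        have h3 := I.card_le_univ
        rw [Finset.card_compl] at h1
        omega
    refine ⟨_, hF'', ?_, ?_, π, fun I hI => ?_⟩
    · simpa using congrArg ofDual hu
    · simpa using congrArg ofDual h0
    · have := hπ Iᶜ (by rw [Finset.card_compl, hI])
      rw [image_perm_compl, compl_compl] at this
      exact congrArg ofDual this
  · exact hF.exists_frame_of_lt hr he hk h hij hX

end RigidityDual

/-! ### Families of `k`-sets separating two indices -/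

section Counting

variable {α : Type*} [DecidableEq α] [Fintype α] {k : ℕ}

/-- The `k`-subsets containing `i` and not containing `j`. -/
def sepSet (k : ℕ) (i j : α) : Finset (Finset α) :=
  Finset.univ.filter fun I => I.card = k ∧ i ∈ I ∧ j ∉ I

lemma mem_sepSet {i j : α} {I : Finset α} : I ∈ sepSet k i j ↔ I.card = k ∧ i ∈ I ∧ j ∉ I := by
  simp [sepSet]

lemma exists_perm_pair {i j i' j' : α} (h : i ≠ j) (h' : i' ≠ j') :
    ∃ σ : Equiv.Perm α, σ i = i' ∧ σ j = j' := by
  have h1 : Equiv.swap i i' j ≠ i' := fun h2 => by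
    exact h ((Equiv.swap i i').injective ((Equiv.swap_apply_left i i').trans h2.symm))
  refine ⟨(Equiv.swap i i').trans (Equiv.swap (Equiv.swap i i' j) j'), ?_, ?_⟩
  · simp only [Equiv.trans_apply, Equiv.swap_apply_left]
    exact Equiv.swap_apply_of_ne_of_ne h1.symm h'
  · simp

lemma card_sepSet {i j i' j' : α} (h : i ≠ j) (h' : i' ≠ j') :
    (sepSet k i j).card = (sepSet k i' j').card := by
  obtain ⟨σ, rfl, rfl⟩ := exists_perm_pair h h'
  refine Finset.card_bij' (fun I _ => I.image σ) (fun I _ => I.image σ.symm) ?_ ?_ ?_ ?_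
  · intro I hI
    simp only [mem_sepSet] at hI ⊢
    rw [Finset.card_image_of_injective _ σ.injective]
    simpa using hI
  · intro I hI
    simp only [mem_sepSet] at hI ⊢
    rw [Finset.card_image_of_injective _ σ.symm.injective]
    simpa [Equiv.symm_apply_eq] using hI
  · intro I _
    simp [Finset.image_image]
  · intro I _
    simp [Finset.image_image]

lemma exists_mem_sepSet (hk : 2 ≤ k) (hkn : k + 2 ≤ Fintype.card α) {i j i' j' : α} (h : i ≠ j)
    (h' : i' ≠ j') (hne : (i, j) ≠ (i', j')) : ∃ I ∈ sepSet k i j, I ∉ sepSet k i' j' := by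
  by_cases hi : i = i'
  · have hj : j ≠ j' := fun hj => hne (by rw [hi, hj])
    obtain ⟨I, h1, h2, h3⟩ := Finset.exists_subsuperset_card_eq (s := {i, j'}) (t := {j}ᶜ) (n := k)
      (by simp [Finset.subset_iff, h, Ne.symm hj])
      (Finset.card_le_two.trans hk) (by rw [Finset.card_compl, Finset.card_singleton]; omega)
    refine ⟨I, mem_sepSet.mpr ⟨h3, h1 (by simp), fun h4 => by simpa using h2 h4⟩, fun h4 => ?_⟩
    exact (mem_sepSet.mp h4).2.2 (h1 (by simp))
  · obtain ⟨I, h1, h2, h3⟩ := Finset.exists_subsuperset_card_eq (s := {i}) (t := {j, i'}ᶜ) (n := k)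
      (by simp [h, hi]) (by rw [Finset.card_singleton]; omega) (by
        rw [Finset.card_compl]
        have := Finset.card_le_two (a := j) (b := i')
        omega)
    refine ⟨I, mem_sepSet.mpr ⟨h3, h1 (by simp), fun h4 => by simpa using h2 h4⟩, fun h4 => ?_⟩
    simpa using h2 (mem_sepSet.mp h4).2.1

/-- A map of `k`-subsets which permutes the sets `sepSet k i j` preserves the sizes of
intersections. -/
lemma card_inter_eq_of_sepSet (hk : 2 ≤ k) (hkn : k + 2 ≤ Fintype.card α)
    (φ : Finset α → Finset α) (hφ : ∀ I, I.card = k → (φ I).card = k)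
    (hsep : ∀ i j, i ≠ j → ∃ i' j', i' ≠ j' ∧
      ∀ I, I.card = k → ((i ∈ I ∧ j ∉ I) ↔ (i' ∈ φ I ∧ j' ∉ φ I)))
    {I J : Finset α} (hI : I.card = k) (hJ : J.card = k) :
    (φ I ∩ φ J).card = (I ∩ J).card := by
  choose g₁ g₂ hg hgs using hsep
  let P := {p : α × α // p.1 ≠ p.2}
  let ψ : P → P := fun p => ⟨(g₁ _ _ p.2, g₂ _ _ p.2), hg _ _ p.2⟩
  have hψ : ∀ (p : P) (I : Finset α), I.card = k →
      ((p.1.1 ∈ I ∧ p.1.2 ∉ I) ↔ ((ψ p).1.1 ∈ φ I ∧ (ψ p).1.2 ∉ φ I)) :=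
    fun p I hI => hgs _ _ p.2 I hI
  -- Equal values at `p` and `q` would make the separating family of `p` a part of that of `q`,
  -- which happens for `p = q` only.
  have hinj : Function.Injective ψ := by
    intro p q hpq
    by_contra hne
    obtain ⟨I, h1, h2⟩ := exists_mem_sepSet hk hkn p.2 q.2 fun h => hne (Subtype.ext h)
    rw [mem_sepSet] at h1 h2
    refine h2 ⟨h1.1, (hψ q I h1.1).mpr ?_⟩
    rw [← hpq]
    exact (hψ p I h1.1).mp h1.2
  have hsurj := Finite.injective_iff_surjective.mp hinj
  -- For `k`-sets with `t = |I ∩ J|` the number of ordered pairs separated by both is `t * (n - 2k +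
  -- t)`. It is strictly increasing in `t` over the possible values, so it determines `t`.
  have key : ∀ I J : Finset α, (Finset.univ.filter fun p : P =>
      (p.1.1 ∈ I ∧ p.1.2 ∉ I) ∧ (p.1.1 ∈ J ∧ p.1.2 ∉ J)).card
        = (I ∩ J).card * (I ∪ J)ᶜ.card := fun I J => by
    rw [← Finset.card_product]
    refine Finset.card_bij (fun p _ => p.1) ?_ ?_ ?_
    · intro p hp
      simp only [Finset.mem_filter, Finset.mem_univ, true_and, Finset.mem_product,
        Finset.mem_inter, Finset.mem_compl, Finset.mem_union] at hp ⊢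
      tauto
    · intro p _ q _ h
      exact Subtype.ext h
    · intro p hp
      simp only [Finset.mem_product, Finset.mem_inter, Finset.mem_compl, Finset.mem_union] at hp
      refine ⟨⟨p, fun h => hp.2 (h ▸ Or.inl hp.1.1)⟩, ?_, rfl⟩
      simp only [Finset.mem_filter, Finset.mem_univ, true_and]
      tauto
  have heq : (I ∩ J).card * (I ∪ J)ᶜ.card = (φ I ∩ φ J).card * (φ I ∪ φ J)ᶜ.card := by
    rw [← key, ← key]
    refine Finset.card_bij (fun p _ => ψ p) ?_ (fun p _ q _ h => hinj h) ?_
    · intro p hp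
      simp only [Finset.mem_filter, Finset.mem_univ, true_and] at hp ⊢
      rwa [← hψ p I hI, ← hψ p J hJ]
    · intro q hq
      obtain ⟨p, rfl⟩ := hsurj q
      simp only [Finset.mem_filter, Finset.mem_univ, true_and] at hq
      rw [← hψ p I hI, ← hψ p J hJ] at hq
      exact ⟨p, by simpa using hq, rfl⟩
  have c1 := Finset.card_union_add_card_inter I J
  have c2 := Finset.card_union_add_card_inter (φ I) (φ J)
  rw [hφ I hI, hφ J hJ] at c2
  rw [hI, hJ] at c1
  have u1 := (I ∪ J).card_le_univ
  have u2 := (φ I ∪ φ J).card_le_univ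
  rw [Finset.card_compl, Finset.card_compl] at heq
  rcases lt_trichotomy (φ I ∩ φ J).card (I ∩ J).card with h | h | h
  · exact absurd heq (Nat.mul_lt_mul'' h (by omega)).ne'
  · exact h
  · exact absurd heq (Nat.mul_lt_mul'' h (by omega)).ne

end Counting

/-! ### Recognizing frames by counting missed members -/

section Frames

variable {L : Type*} [Lattice L] [BoundedOrder L] {α : Type*} [DecidableEq α] [Fintype α]
  {r : L → ℕ} {k s : ℕ} {e F : Finset α → L}

/-- An isometric embedding of `J(n,k)` missing as many members of a frame as there are sets
separating two points consists of the members of a frame with the same bounds. -/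
lemma IsFrame.exists_frame_of_card (hr : IsRank r) (hF : IsFrame r s F)
    (he : IsRankIsometry r k (s + k) e) (hk : 2 ≤ k) (hkn : k + 2 ≤ Fintype.card α)
    (hne : Fintype.card α ≠ 2 * k) {i₀ j₀ : α} (h₀ : i₀ ≠ j₀) {M : Finset (Finset α)}
    (hM : ∀ I, I ∈ M ↔ I.card = k ∧ ¬ Hit k e F I) (hcard : M.card = (sepSet k i₀ j₀).card) :
    ∃ i j, i ≠ j ∧ M = sepSet k i j ∧
      ∃ F', IsFrame r s F' ∧ F' ∅ = F ∅ ∧ F' Finset.univ = F Finset.univ ∧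
        ∃ π : Equiv.Perm α, ∀ I, I.card = k → e (I.image π) = F' I := by
  by_cases hsep : ∀ i j, i ≠ j → ∃ I, Hit k e F I ∧ i ∈ I ∧ j ∉ I
  · exfalso
    obtain ⟨π, hπ⟩ := hF.exists_perm_of_separated hr he hk hkn hne hsep
    have h1 : M = ∅ := by
      refine Finset.eq_empty_of_forall_notMem fun I hI => ?_
      obtain ⟨hI, h'⟩ := (hM I).mp hI
      exact h' ⟨hI, I.image π, by rwa [Finset.card_image_of_injective _ π.injective], hπ I hI⟩
    obtain ⟨I, hI, -⟩ := exists_mem_sepSet hk hkn h₀ h₀.symm (by simp [h₀])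
    rw [h1, Finset.card_empty, eq_comm, Finset.card_eq_zero] at hcard
    simp [hcard] at hI
  · push Not at hsep
    obtain ⟨i, j, hij, h⟩ := hsep
    -- For an unseparated pair the whole separating family is missed, and all such families have the
    -- same size as `M`.
    have h1 : M = sepSet k i j := by
      refine (Finset.eq_of_subset_of_card_le (fun I hI => ?_) ?_).symm
      · rw [mem_sepSet] at hI
        exact (hM I).mpr ⟨hI.1, fun h' => hI.2.2 (h I h' hI.2.1)⟩
      · rw [hcard, card_sepSet h₀ hij]
    refine ⟨i, j, hij, h1, hF.exists_frame hr he hk hkn hne hij fun I hI => ?_⟩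
    have h2 := hM I
    rw [h1, mem_sepSet] at h2
    tauto

omit [BoundedOrder L] [Fintype α] in
lemma IsFrame.reindex (hF : IsFrame r s F) (π : Equiv.Perm α) :
    IsFrame r s fun I => F (I.image π) where
  sup I J := by rw [Finset.image_union, hF.sup]
  rank I := by rw [hF.rank, Finset.card_image_of_injective _ π.injective]

/-- A bijection from the `k`-subsets onto the `k`-members of a frame compatible with the sets
`sepSet k i j` comes from a frame with the same bounds. -/
lemma IsFrame.exists_frame_eq (hr : IsRank r) (hF : IsFrame r s F) (hk : 2 ≤ k)
    (hkn : k + 2 ≤ Fintype.card α) (hne : Fintype.card α ≠ 2 * k)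
    (h1 : ∀ I, I.card = k → ∃ I', I'.card = k ∧ e I = F I')
    (h2 : ∀ I', I'.card = k → ∃ I, I.card = k ∧ e I = F I')
    (hsep : ∀ i j, i ≠ j → ∃ i' j', i' ≠ j' ∧ ∀ I I', I.card = k → I'.card = k → e I = F I' →
      ((i ∈ I ∧ j ∉ I) ↔ (i' ∈ I' ∧ j' ∉ I'))) :
    ∃ F', IsFrame r s F' ∧ F' ∅ = F ∅ ∧ F' Finset.univ = F Finset.univ ∧
      ∀ I, I.card = k → e I = F' I := by
  have h1' : ∀ I, ∃ I', I.card = k → I'.card = k ∧ e I = F I' := fun I => by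
    by_cases hI : I.card = k
    · obtain ⟨I', h⟩ := h1 I hI
      exact ⟨I', fun _ => h⟩
    · exact ⟨∅, fun h => absurd h hI⟩
  choose φ hφ using h1'
  -- Compatibility with separating families gives the right intersection sizes, so `e` is an
  -- isometry hitting every member of the frame.
  have he : IsRankIsometry r k (s + k) e := by
    intro I J hI hJ
    have := card_inter_eq_of_sepSet hk hkn φ (fun I hI => (hφ I hI).1) (fun i j hij => by
      obtain ⟨i', j', hij', h⟩ := hsep i j hij
      exact ⟨i', j', hij', fun I hI => h I (φ I) hI (hφ I hI).1 (hφ I hI).2⟩) hI hJ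
    rw [(hφ I hI).2, (hφ J hJ).2, hF.inf hr, hF.rank, this]
    omega
  obtain ⟨π, hπ⟩ := hF.exists_perm_of_separated hr he hk hkn hne fun i j hij => by
    obtain ⟨I, hI, -⟩ := exists_mem_sepSet hk hkn hij hij.symm (by simp [hij])
    rw [mem_sepSet] at hI
    exact ⟨I, ⟨hI.1, h2 I hI.1⟩, hI.2⟩
  refine ⟨_, hF.reindex π⁻¹, by simp, ?_, fun I hI => ?_⟩
  · rw [Finset.image_univ_of_surjective π⁻¹.surjective]
  · rw [← hπ _ (by rwa [Finset.card_image_of_injective _ π⁻¹.injective]), Finset.image_image]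
    congr 1
    ext x
    simp

end Frames

open Module

/-! ### Elementary moves between bases -/

section Bases

variable {R V : Type*} [DivisionRing R] [AddCommGroup V] [Module R V] {ι : Type*} [DecidableEq ι]

lemma linearIndependent_update_add {v : ι → V} (hv : LinearIndependent R v) {i j : ι} (h : i ≠ j)
    (c : R) : LinearIndependent R (Function.update v i (v i + c • v j)) := by
  have := (linearIndependent_add_smul_iff (R := R) (v := v) (c := Pi.single i c) (i := j)
    (by simp [h.symm])).mpr hv
  have h' : Function.update v i (v i + c • v j) = v + fun l => (Pi.single i c : ι → R) l • v j := by
    ext l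
    by_cases hl : l = i
    · subst hl; simp
    · simp [hl]
  rw [h']
  exact this

lemma linearIndependent_update_smul {v : ι → V} (hv : LinearIndependent R v) (i : ι) {c : R}
    (hc : c ≠ 0) : LinearIndependent R (Function.update v i (c • v i)) := by
  have := hv.units_smul (Function.update 1 i (Units.mk0 c hc))
  convert this using 1
  ext l
  by_cases hl : l = i
  · subst hl; simp [Units.smul_def]
  · simp [hl]

/-- A property of bases invariant under elementary moves on the indices outside `T₀` passes from a
base to every base with the same members on `T₀`. -/
theorem basis_induction [Fintype ι] [FiniteDimensional R V] (hcard : Fintype.card ι = finrank R V) (Q : (ι → V) → Prop)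
    (T₀ : Finset ι)
    (hadd : ∀ v i j, ∀ c : R, LinearIndependent R v → i ∉ T₀ → i ≠ j → Q v →
      Q (Function.update v i (v i + c • v j)))
    (hsmul : ∀ v i, ∀ c : R, LinearIndependent R v → c ≠ 0 → Q v →
      Q (Function.update v i (c • v i)))
    (hswap : ∀ v i j, LinearIndependent R v → i ∉ T₀ → j ∉ T₀ → Q v → Q (v ∘ Equiv.swap i j))
    {v w : ι → V} (hv : LinearIndependent R v) (hw : LinearIndependent R w)
    (h : ∀ i ∈ T₀, v i = w i) (hQ : Q v) : Q w := by
  have key : ∀ T : Finset ι, Disjoint T T₀ → ∃ u, Q u ∧ LinearIndependent R u ∧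
      ∀ i ∈ T ∪ T₀, u i = w i := by
    intro T
    induction T using Finset.induction_on with
    | empty => exact fun _ => ⟨v, hQ, hv, by simpa using h⟩
    | insert t T ht ih =>
      intro hT
      rw [Finset.disjoint_insert_left] at hT
      obtain ⟨u, hu, hul, huw⟩ := ih hT.2
      have hspan : Submodule.span R (Set.range u) = ⊤ :=
        hul.span_eq_top_of_card_eq_finrank' hcard
      obtain ⟨c, hc⟩ := (Submodule.mem_span_range_iff_exists_fun R).mp
        (hspan ▸ Submodule.mem_top : w t ∈ _)
      -- Otherwise `w t` would depend on the members of `w` already in place.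
      obtain ⟨i, hi, hci⟩ : ∃ i, i ∉ T ∪ T₀ ∧ c i ≠ 0 := by
        by_contra hcon
        push Not at hcon
        have htT : t ∉ (↑(T ∪ T₀) : Set ι) := by simp [ht, hT.1]
        refine hw.notMem_span_image htT ?_
        rw [← hc]
        refine Submodule.sum_mem _ fun i _ => ?_
        by_cases hi : i ∈ T ∪ T₀
        · rw [huw i hi]
          exact Submodule.smul_mem _ _ (Submodule.subset_span ⟨i, hi, rfl⟩)
        · rw [hcon i hi, zero_smul]
          exact Submodule.zero_mem _
      have hi' : i ∉ T ∧ i ∉ T₀ := by simpa using hi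
      -- The vector `w t` is assembled at position `i`, one summand per move; a final swap brings it
      -- to position `t`.
      have step : ∀ S : Finset ι, i ∉ S →
          Q (Function.update u i (c i • u i + ∑ j ∈ S, c j • u j)) ∧
          LinearIndependent R (Function.update u i (c i • u i + ∑ j ∈ S, c j • u j)) := by
        intro S
        induction S using Finset.induction_on with
        | empty =>
          intro _
          simp only [Finset.sum_empty, add_zero]
          exact ⟨hsmul u i _ hul hci hu, linearIndependent_update_smul hul i hci⟩
        | insert a S ha ih =>
          intro hia
          rw [Finset.mem_insert, not_or] at hia
          obtain ⟨h1, h2⟩ := ih hia.2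
          have h3 := hadd _ i a (c a) h2 hi'.2 hia.1 h1
          have h4 := linearIndependent_update_add h2 hia.1 (c a)
          rw [Function.update_self, Function.update_idem, Function.update_of_ne (Ne.symm hia.1),
            add_assoc, add_comm (∑ j ∈ S, c j • u j)] at h3 h4
          rw [Finset.sum_insert ha]
          exact ⟨h3, h4⟩
      obtain ⟨h1, h2⟩ := step (Finset.univ.erase i) (by simp)
      rw [Finset.add_sum_erase _ (fun j => c j • u j) (Finset.mem_univ i), hc] at h1 h2
      refine ⟨_, hswap _ i t h2 hi'.2 hT.1 h1, h2.comp _ (Equiv.swap i t).injective,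
        fun l hl => ?_⟩
      by_cases hlt : l = t
      · subst hlt
        simp
      · have hl' : l ∈ T ∪ T₀ := by
          simp only [Finset.mem_union, Finset.mem_insert] at hl ⊢
          tauto
        have hli : l ≠ i := fun h => hi (h ▸ hl')
        simp [Equiv.swap_apply_of_ne_of_ne hli hlt, hli, huw l hl']
  obtain ⟨u, hu, -, huw⟩ := key T₀ᶜ disjoint_compl_left
  have : u = w := funext fun i => huw i (by simpa using em' _)
  exact this ▸ hu

/-- The span of the members of a family with index in `I`. -/
def subspan (R : Type*) {V : Type*} [DivisionRing R] [AddCommGroup V] [Module R V] {ι : Type*}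
    (v : ι → V) (I : Finset ι) : Submodule R V :=
  Submodule.span R (v '' (I : Set ι))

lemma subspan_update_of_notMem {v : ι → V} {i : ι} {x : V} {I : Finset ι} (h : i ∉ I) :
    subspan R (Function.update v i x) I = subspan R v I := by
  unfold subspan
  congr 1
  refine Set.image_congr fun l hl => Function.update_of_ne ?_ _ _
  rintro rfl
  exact h hl

lemma subspan_comp_perm (v : ι → V) (σ : Equiv.Perm ι) (I : Finset ι) :
    subspan R (v ∘ σ) I = subspan R v (I.image σ) := by
  rw [subspan, subspan, Finset.coe_image, Set.image_comp]

lemma subspan_le_iff {v : ι → V} {I : Finset ι} {P : Submodule R V} :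
    subspan R v I ≤ P ↔ ∀ i ∈ I, v i ∈ P := by
  rw [subspan, Submodule.span_le, Set.image_subset_iff]
  rfl

lemma mem_subspan {v : ι → V} {I : Finset ι} {i : ι} (h : i ∈ I) : v i ∈ subspan R v I :=
  Submodule.subset_span ⟨i, h, rfl⟩

lemma subspan_update_smul {v : ι → V} {i : ι} {c : R} (hc : c ≠ 0) (I : Finset ι) :
    subspan R (Function.update v i (c • v i)) I = subspan R v I := by
  by_cases hi : i ∈ I
  · refine le_antisymm (subspan_le_iff.mpr fun l hl => ?_) (subspan_le_iff.mpr fun l hl => ?_)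
    · by_cases hli : l = i
      · subst hli
        rw [Function.update_self]
        exact Submodule.smul_mem _ _ (mem_subspan hl)
      · rw [Function.update_of_ne hli]
        exact mem_subspan hl
    · have h1 := mem_subspan (R := R) (v := Function.update v i (c • v i)) hl
      by_cases hli : l = i
      · subst hli
        rw [Function.update_self] at h1
        exact (Submodule.smul_mem_iff _ hc).mp h1
      · rwa [Function.update_of_ne hli] at h1
  · exact subspan_update_of_notMem hi

lemma subspan_update_add {v : ι → V} {i j : ι} (hij : i ≠ j) (c : R) {I : Finset ι}
    (h : i ∈ I → j ∈ I) : subspan R (Function.update v i (v i + c • v j)) I = subspan R v I := by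
  by_cases hi : i ∈ I
  · refine le_antisymm (subspan_le_iff.mpr fun l hl => ?_) (subspan_le_iff.mpr fun l hl => ?_)
    · by_cases hli : l = i
      · subst hli
        rw [Function.update_self]
        exact Submodule.add_mem _ (mem_subspan hl) (Submodule.smul_mem _ _ (mem_subspan (h hl)))
      · rw [Function.update_of_ne hli]
        exact mem_subspan hl
    · have h1 := mem_subspan (R := R) (v := Function.update v i (v i + c • v j)) hl
      have h2 := mem_subspan (R := R) (v := Function.update v i (v i + c • v j)) (h hi)
      rw [Function.update_of_ne hij.symm] at h2
      by_cases hli : l = i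
      · subst hli
        rw [Function.update_self] at h1
        exact (Submodule.add_mem_iff_left _ (Submodule.smul_mem _ _ h2)).mp h1
      · rwa [Function.update_of_ne hli] at h1
  · exact subspan_update_of_notMem hi

/-- Replacing `v i` by `v i + c • v j` in a family, or replacing `v j` by the same vector, gives
families with common subspans. -/
lemma subspan_update_exchange {v : ι → V} {i j : ι} {x : V} {J : Finset ι}
    (hi : i ∈ J) (hj : j ∉ J) :
    subspan R (Function.update v j x) (insert j (J.erase i)) =
      subspan R (Function.update v i x) J := by
  have hij : i ≠ j := fun h => hj (h ▸ hi)
  unfold subspan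
  congr 1
  ext y
  simp only [Set.mem_image, Finset.coe_insert, Finset.coe_erase, Set.mem_insert_iff]
  constructor
  · rintro ⟨l, rfl | ⟨hl, hli⟩, rfl⟩
    · exact ⟨i, hi, by simp⟩
    · have hli' : l ≠ i := hli
      have hlj : l ≠ j := fun h => hj (h ▸ hl)
      exact ⟨l, hl, by simp [hli', hlj]⟩
  · rintro ⟨l, hl, rfl⟩
    by_cases hli : l = i
    · subst hli
      exact ⟨j, Or.inl rfl, by simp⟩
    · have hlj : l ≠ j := fun h => hj (h ▸ hl)
      exact ⟨l, Or.inr ⟨hl, hli⟩, by simp [hli, hlj]⟩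

end Bases

open Module

/-! ### Families with the same image -/

section SameImage

variable {L : Type*} {α : Type*} {k : ℕ}

/-- `a` and `b` have the same image of the set of all `k`-subsets. -/
def SameImage (k : ℕ) (a b : Finset α → L) : Prop :=
  (∀ I, I.card = k → ∃ I', I'.card = k ∧ a I = b I') ∧
    ∀ I', I'.card = k → ∃ I, I.card = k ∧ a I = b I'

variable [DecidableEq α] [Lattice L] {r : L → ℕ} {m : ℕ}

lemma IsRankIsometry.injOn {e : Finset α → L} (he : IsRankIsometry r k m e) {I J : Finset α}
    (hI : I.card = k) (hJ : J.card = k) (h : e I = e J) : I = J := by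
  have h1 := he I J hI hJ
  rw [h, inf_idem, he.rank hJ] at h1
  have h2 : I ∩ J = I := Finset.eq_of_subset_of_card_le Finset.inter_subset_left (by omega)
  have h3 : I ∩ J = J := Finset.eq_of_subset_of_card_le Finset.inter_subset_right (by omega)
  rw [← h2, h3]

/-- As `e` is injective on `k`-sets, the common image has as many elements as there are `k`-sets, so
`a` is injective on them too. -/
lemma SameImage.injOn [Fintype α] {a e : Finset α → L} (h : SameImage k a e)
    (he : IsRankIsometry r k m e) {I J : Finset α}
    (hI : I.card = k) (hJ : J.card = k) (hIJ : a I = a J) : I = J := by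
  classical
  have h1 : (Finset.powersetCard k Finset.univ).image a =
      (Finset.powersetCard k (Finset.univ : Finset α)).image e := by
    ext x
    simp only [Finset.mem_image, Finset.mem_powersetCard_univ]
    constructor
    · rintro ⟨I, hI, rfl⟩
      obtain ⟨I', hI', h'⟩ := h.1 I hI
      exact ⟨I', hI', h'.symm⟩
    · rintro ⟨I', hI', rfl⟩
      exact h.2 I' hI'
  have h2 : ((Finset.powersetCard k (Finset.univ : Finset α)).image e).card =
      (Finset.powersetCard k (Finset.univ : Finset α)).card :=
    Finset.card_image_of_injOn fun I hI J hJ h => he.injOn (by simpa using hI) (by simpa using hJ) h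
  rw [← h1, Finset.card_image_iff] at h2
  exact h2 (by simpa using hI) (by simpa using hJ) hIJ

end SameImage

/-! ### From one good apartment to all apartments, and the map on points -/

section Propagation

variable {R V : Type*} [DivisionRing R] [AddCommGroup V] [Module R V]
  {ι : Type*} [Fintype ι] [DecidableEq ι] {L : Type*} [Lattice L] [BoundedOrder L] {r : L → ℕ}
  {k s : ℕ} {f : Submodule R V → L}

/-- Apartments are mapped to images of isometric embeddings of the Johnson graph. -/
def MapsToJohnson (ι : Type*) [DecidableEq ι] (r : L → ℕ) (k m : ℕ) (f : Submodule R V → L) :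
    Prop :=
  ∀ v : ι → V, LinearIndependent R v → ∃ e, IsRankIsometry r k m e ∧
    SameImage k (fun I => f (subspan R v I)) e

lemma MapsToJohnson.injOn {m : ℕ} (hf : MapsToJohnson ι r k m f) {v : ι → V}
    (hv : LinearIndependent R v) {I J : Finset ι} (hI : I.card = k) (hJ : J.card = k)
    (h : f (subspan R v I) = f (subspan R v J)) : I = J := by
  obtain ⟨e, he, hs⟩ := hf v hv
  exact hs.injOn he hI hJ h

/-- Elementary moves of the base preserve apartments of the parabolic subspace, and the sets of
subspaces containing `v i₀` and not `v j₀` are mapped to sets of the same kind. -/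
lemma MapsToJohnson.exists_move (hr : IsRank r) (hf : MapsToJohnson ι r k (s + k) f) (hk : 2 ≤ k)
    (hkn : k + 2 ≤ Fintype.card ι) (hne : Fintype.card ι ≠ 2 * k) {v : ι → V}
    (hv : LinearIndependent R v) {F : Finset ι → L} (hF : IsFrame r s F)
    (hs : SameImage k (fun I => f (subspan R v I)) F) {i₀ j₀ : ι} (h₀ : i₀ ≠ j₀) {c : R}
    (hc : c ≠ 0) :
    ∃ i j, i ≠ j ∧ (∀ I I', I.card = k → I'.card = k → f (subspan R v I) = F I' →
        ((i₀ ∈ I ∧ j₀ ∉ I) ↔ (i ∈ I' ∧ j ∉ I'))) ∧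
      ∃ F', IsFrame r s F' ∧ F' ∅ = F ∅ ∧ F' Finset.univ = F Finset.univ ∧
        SameImage k
          (fun I => f (subspan R (Function.update v i₀ (v i₀ + c • v j₀)) I)) F' := by
  classical
  set v' := Function.update v i₀ (v i₀ + c • v j₀) with hv'
  have hv'l : LinearIndependent R v' := linearIndependent_update_add hv h₀ c
  obtain ⟨e, he, hse⟩ := hf v' hv'l
  -- This third base contains both the old vector `v i₀` and the new one. It spans the lost
  -- subspaces as well as those that replace them.
  set v'' := Function.update v j₀ (v i₀ + c • v j₀) with hv''
  have hv''l : LinearIndependent R v'' := by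
    have h1 := linearIndependent_update_add (linearIndependent_update_smul hv j₀ hc) h₀.symm 1
    rw [Function.update_self, Function.update_idem, Function.update_of_ne h₀, one_smul,
      add_comm] at h1
    exact h1
  set M := Finset.univ.filter fun I' : Finset ι => I'.card = k ∧ ¬ Hit k e F I' with hM
  -- A frame member is missed by the moved apartment exactly when it is the image of a subspace
  -- changed by the move.
  have hkey : ∀ I I', I.card = k → I'.card = k → f (subspan R v I) = F I' →
      (I ∈ sepSet k i₀ j₀ ↔ I' ∈ M) := by
    intro I I' hI hI' hII'
    have hMI : I' ∈ M ↔ ¬ Hit k e F I' := by simp [hM, hI']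
    rw [hMI, mem_sepSet, ← not_iff_not, not_not]
    constructor
    · intro h
      have h1 : subspan R v' I = subspan R v I := subspan_update_add h₀ c fun h2 => by tauto
      obtain ⟨J', hJ', h'⟩ := hse.1 I hI
      exact ⟨hI', J', hJ', h'.symm.trans ((congrArg f h1).trans hII')⟩
    · rintro ⟨-, J', hJ', h'⟩ hsep
      obtain ⟨J, hJ, h''⟩ := hse.2 J' hJ'
      have h1 : f (subspan R v' J) = f (subspan R v I) := h''.trans (h'.trans hII'.symm)
      by_cases hJs : i₀ ∈ J ∧ j₀ ∉ J
      -- Within the apartment of `v''` the map `f` is injective, but only one of the two index sets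
      -- contains `j₀`.
      · have h2 : subspan R v'' I = subspan R v I := subspan_update_of_notMem hsep.2.2
        have h3 : subspan R v'' (insert j₀ (J.erase i₀)) = subspan R v' J :=
          subspan_update_exchange hJs.1 hJs.2
        have h4 : (insert j₀ (J.erase i₀)).card = k := by
          have := Finset.card_erase_add_one hJs.1
          rw [Finset.card_insert_of_notMem (by simp [hJs.2])]
          omega
        rw [← h2, ← h3] at h1
        have h5 := hf.injOn hv''l h4 hI h1
        exact hsep.2.2 (h5 ▸ by simp)
      -- The move does not affect `J`, so injectivity on the apartment of `v` forces `J = I`.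
      · have h2 : subspan R v' J = subspan R v J := subspan_update_add h₀ c fun h2 => by tauto
        rw [h2] at h1
        have h3 := hf.injOn hv hJ hI h1
        exact hJs (h3 ▸ hsep.2)
  have hcard : M.card = (sepSet k i₀ j₀).card := by
    symm
    have hs1 : ∀ I, ∃ I', I.card = k → I'.card = k ∧ f (subspan R v I) = F I' := fun I => by
      by_cases hI : I.card = k
      · obtain ⟨I', h⟩ := hs.1 I hI
        exact ⟨I', fun _ => h⟩
      · exact ⟨∅, fun h => absurd h hI⟩
    choose φ hφ using hs1
    refine Finset.card_bij (fun I _ => φ I) ?_ ?_ ?_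
    · intro I hI
      have hIk := (mem_sepSet.mp hI).1
      exact (hkey I _ hIk (hφ I hIk).1 (hφ I hIk).2).mp hI
    · intro I hI J hJ h
      have hIk := (mem_sepSet.mp hI).1
      have hJk := (mem_sepSet.mp hJ).1
      exact hf.injOn hv hIk hJk (by rw [(hφ I hIk).2, (hφ J hJk).2, h])
    · intro I' hI'
      have hI'k : I'.card = k := (Finset.mem_filter.mp hI').2.1
      obtain ⟨I, hI, h⟩ := hs.2 I' hI'k
      refine ⟨I, (hkey I I' hI hI'k h).mpr hI', ?_⟩
      exact hF.injective ((hφ I hI).2.symm.trans h)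
  obtain ⟨i, j, hij, hMij, F', hF', h0, hu, π, hπ⟩ := hF.exists_frame_of_card hr he hk hkn hne h₀
    (M := M) (fun I => by simp [hM]) hcard
  refine ⟨i, j, hij, fun I I' hI hI' h => ?_, F', hF', h0, hu, ?_, ?_⟩
  · have := hkey I I' hI hI' h
    rw [hMij, mem_sepSet, mem_sepSet] at this
    tauto
  · intro I hI
    obtain ⟨J, hJ, h⟩ := hse.1 I hI
    have hJ' : (J.image π.symm).card = k := by
      rwa [Finset.card_image_of_injective _ π.symm.injective]
    refine ⟨J.image π.symm, hJ', h.trans ?_⟩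
    rw [← hπ _ hJ', Finset.image_image]
    simp
  · intro I hI
    obtain ⟨J, hJ, h⟩ := hse.2 (I.image π)
      (by rwa [Finset.card_image_of_injective _ π.injective])
    exact ⟨J, hJ, h.trans (hπ I hI)⟩

lemma sameImage_comp_perm {v : ι → V} {F : Finset ι → L}
    (hs : SameImage k (fun I => f (subspan R v I)) F) (σ : Equiv.Perm ι) :
    SameImage k (fun I => f (subspan R (v ∘ σ) I)) F := by
  refine ⟨fun I hI => ?_, fun I' hI' => ?_⟩
  · obtain ⟨I', h⟩ := hs.1 (I.image σ) (by rwa [Finset.card_image_of_injective _ σ.injective])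
    exact ⟨I', h.1, by simpa only [subspan_comp_perm] using h.2⟩
  · obtain ⟨I, hI, h⟩ := hs.2 I' hI'
    refine ⟨I.image σ.symm, by rwa [Finset.card_image_of_injective _ σ.symm.injective], ?_⟩
    simp only [subspan_comp_perm, Finset.image_image]
    rw [← h]
    simp

/-- All apartments are mapped to apartments of the same parabolic subspace, compatibly with the
inclusion of indices. -/
theorem MapsToJohnson.exists_frame [FiniteDimensional R V] (hr : IsRank r)
    (hf : MapsToJohnson ι r k (s + k) f) (hcard : Fintype.card ι = finrank R V) (hk : 2 ≤ k)
    (hkn : k + 2 ≤ Fintype.card ι) (hne : Fintype.card ι ≠ 2 * k) {v₀ : ι → V}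
    (hv₀ : LinearIndependent R v₀) {F₀ : Finset ι → L} (hF₀ : IsFrame r s F₀)
    (hs₀ : SameImage k (fun I => f (subspan R v₀ I)) F₀) {v : ι → V}
    (hv : LinearIndependent R v) :
    ∃ F, IsFrame r s F ∧ F ∅ = F₀ ∅ ∧ F Finset.univ = F₀ Finset.univ ∧
      ∀ I, I.card = k → f (subspan R v I) = F I := by
  obtain ⟨F, hF, h0, hu, hs⟩ : ∃ F, IsFrame r s F ∧ F ∅ = F₀ ∅ ∧
      F Finset.univ = F₀ Finset.univ ∧ SameImage k (fun I => f (subspan R v I)) F := by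
    refine basis_induction hcard (fun v => ∃ F, IsFrame r s F ∧ F ∅ = F₀ ∅ ∧
      F Finset.univ = F₀ Finset.univ ∧ SameImage k (fun I => f (subspan R v I)) F) ∅ ?_ ?_ ?_
      hv₀ hv (by simp) ⟨F₀, hF₀, rfl, rfl, hs₀⟩
    · rintro v i j c hv - hij ⟨F, hF, h0, hu, hs⟩
      by_cases hc : c = 0
      · refine ⟨F, hF, h0, hu, ?_⟩
        simpa [hc] using hs
      · obtain ⟨-, -, -, -, F', hF', h0', hu', hs'⟩ :=
          hf.exists_move hr hk hkn hne hv hF hs hij hc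
        exact ⟨F', hF', h0'.trans h0, hu'.trans hu, hs'⟩
    · rintro v i c hv hc ⟨F, hF, h0, hu, hs⟩
      refine ⟨F, hF, h0, hu, ?_⟩
      simpa only [subspan_update_smul hc] using hs
    · rintro v i j hv - - ⟨F, hF, h0, hu, hs⟩
      exact ⟨F, hF, h0, hu, sameImage_comp_perm hs _⟩
  -- So far only the images agree as sets. A move with `c = 1` for each pair of indices shows that
  -- `f` respects separating families, which upgrades this to equality index by index.
  obtain ⟨F', hF', h0', hu', h⟩ := hF.exists_frame_eq hr hk hkn hne hs.1 hs.2 fun i₀ j₀ h₀ => by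
    obtain ⟨i, j, hij, h, -⟩ := hf.exists_move hr hk hkn hne hv hF hs h₀ one_ne_zero
    exact ⟨i, j, hij, h⟩
  exact ⟨F', hF', h0'.trans h0, hu'.trans hu, h⟩

/-- Since `k ≤ n - 2`, the `k`-sets through `a` that avoid `i` still intersect in `{a}` alone. An
atom is thus insensitive to moves at another index. -/
lemma IsFrame.singleton_eq (hr : IsRank r) {F F' : Finset ι → L} (hF : IsFrame r s F)
    (hF' : IsFrame r s F') (hk : 1 ≤ k) (hkn : k + 2 ≤ Fintype.card ι) {a i : ι} (hai : a ≠ i)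
    (h : ∀ I, I.card = k → a ∈ I → i ∉ I → F I = F' I) : F {a} = F' {a} := by
  classical
  set Y := Finset.univ.filter fun I : Finset ι => I.card = k ∧ a ∈ I ∧ i ∉ I with hY
  have hex : ∀ x, x ≠ a → ∃ I ∈ Y, x ∉ I := fun x hx => by
    obtain ⟨I, h1, h2, h3⟩ := Finset.exists_subsuperset_card_eq (s := {a}) (t := {i, x}ᶜ) (n := k)
      (by simp [hai, hx.symm]) (by rw [Finset.card_singleton]; omega) (by
        rw [Finset.card_compl]
        have := Finset.card_le_two (a := i) (b := x)
        omega)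
    refine ⟨I, ?_, fun h4 => by simpa using h2 h4⟩
    simp only [hY, Finset.mem_filter, Finset.mem_univ, true_and]
    exact ⟨h3, h1 (by simp), fun h4 => by simpa using h2 h4⟩
  have hne : Y.Nonempty := by
    obtain ⟨I, hI, -⟩ := hex i hai.symm
    exact ⟨I, hI⟩
  have hmem : ∀ b, b ∈ ({a} : Finset ι) ↔ ∀ I ∈ Y, b ∈ I := fun b => by
    rw [Finset.mem_singleton]
    constructor
    · rintro rfl I hI
      simp only [hY, Finset.mem_filter] at hI
      exact hI.2.2.1
    · intro hb
      by_contra hba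
      obtain ⟨I, hI, h1⟩ := hex b hba
      exact h1 (hb I hI)
  rw [← hF.inf_eq hr Y hne {a} hmem, ← hF'.inf_eq hr Y hne {a} hmem]
  refine Finset.inf_congr rfl fun I hI => ?_
  simp only [hY, Finset.mem_filter, Finset.mem_univ, true_and] at hI
  exact h I hI.1 hI.2.1 hI.2.2

omit [DecidableEq ι] in
/-- A linearly independent family can be completed to a base with a prescribed index type. -/
lemma exists_linearIndependent_extend [FiniteDimensional R V]
    (hcard : Fintype.card ι = finrank R V) {κ : Type*} {w : κ → V} (hw : LinearIndependent R w) :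
    ∃ v : ι → V, LinearIndependent R v ∧ ∃ j : κ → ι, Function.Injective j ∧ v ∘ j = w := by
  have hli : LinearIndepOn R id (Set.range w) := hw.linearIndepOn_id
  let b := Basis.extend hli
  have : Fintype (hli.extend (Set.subset_univ _)) := FiniteDimensional.fintypeBasisIndex b
  have hmem : ∀ x, w x ∈ hli.extend (Set.subset_univ _) := fun x => hli.subset_extend _ ⟨x, rfl⟩
  obtain ⟨e⟩ : Nonempty (ι ≃ hli.extend (Set.subset_univ _)) :=
    Fintype.card_eq.mp (by rw [hcard, finrank_eq_card_basis b])
  refine ⟨b ∘ e, b.linearIndependent.comp _ e.injective, fun x => e.symm ⟨w x, hmem x⟩, ?_, ?_⟩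
  · intro x y hxy
    exact hw.injective (by simpa using hxy)
  · ext x
    simp [b]

lemma exists_linearIndependent_apply_eq [FiniteDimensional R V]
    (hcard : Fintype.card ι = finrank R V) (i : ι) {x : V} (hx : x ≠ 0) :
    ∃ v : ι → V, LinearIndependent R v ∧ v i = x := by
  obtain ⟨v, hv, j, -, hvj⟩ := exists_linearIndependent_extend hcard
    (w := fun _ : Unit => x) (LinearIndependent.of_subsingleton () (by simpa using hx))
  refine ⟨v ∘ Equiv.swap i (j ()), hv.comp _ (Equiv.injective _), ?_⟩
  simpa using congrFun hvj ()

/-- If `f` maps every apartment to a frame then there is a map of vectors compatible with all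
these frames. -/
theorem exists_pointMap [FiniteDimensional R V] (hr : IsRank r)
    (hcard : Fintype.card ι = finrank R V) (hk : 1 ≤ k) (hkn : k + 2 ≤ Fintype.card ι)
    (hf : ∀ v : ι → V, LinearIndependent R v →
      ∃ F, IsFrame r s F ∧ ∀ I, I.card = k → f (subspan R v I) = F I) :
    ∃ g : V → L, ∀ v : ι → V, LinearIndependent R v →
      ∃ F, IsFrame r s F ∧ (∀ I, I.card = k → f (subspan R v I) = F I) ∧ ∀ i, g (v i) = F {i} := by
  have : Nontrivial ι := Fintype.one_lt_card_iff_nontrivial.mp (by omega)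
  obtain ⟨a⟩ : Nonempty ι := inferInstance
  have hex : ∀ x : V, ∃ p : L, x ≠ 0 → ∃ v : ι → V, LinearIndependent R v ∧ v a = x ∧
      ∃ F, IsFrame r s F ∧ (∀ I, I.card = k → f (subspan R v I) = F I) ∧ F {a} = p := fun x => by
    by_cases hx : x = 0
    · exact ⟨⊤, fun h => absurd hx h⟩
    · obtain ⟨v, hv, hva⟩ := exists_linearIndependent_apply_eq hcard a hx
      obtain ⟨F, hF, h⟩ := hf v hv
      exact ⟨F {a}, fun _ => ⟨v, hv, hva, F, hF, h, rfl⟩⟩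
  choose g hg using hex
  refine ⟨g, fun v hv => ?_⟩
  obtain ⟨F, hF, h⟩ := hf v hv
  refine ⟨F, hF, h, fun i => ?_⟩
  obtain ⟨w, hw, hwa, Fw, hFw, hfw, hgw⟩ := hg (v i) (hv.ne_zero i)
  -- Two bases with the same vector at `a` are linked by moves that leave the atom at `a` unchanged,
  -- so the point depends on the vector alone.
  obtain ⟨F', hF', h', ha'⟩ : ∃ F', IsFrame r s F' ∧
      (∀ I, I.card = k → f (subspan R (v ∘ Equiv.swap a i) I) = F' I) ∧ F' {a} = g (v i) := by
    refine basis_induction hcard (fun u => ∃ F', IsFrame r s F' ∧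
      (∀ I, I.card = k → f (subspan R u I) = F' I) ∧ F' {a} = g (v i)) {a} ?_ ?_ ?_
      (v := w) hw (hv.comp _ (Equiv.swap a i).injective) (by simp [hwa]) ⟨Fw, hFw, hfw, hgw⟩
    · rintro u l j c hu hl hlj ⟨F, hF, h, ha⟩
      obtain ⟨F', hF', h'⟩ := hf _ (linearIndependent_update_add hu hlj c)
      refine ⟨F', hF', h', ?_⟩
      rw [← ha]
      refine hF'.singleton_eq hr hF hk hkn (i := l) (by simpa [eq_comm] using hl) fun I hI _ hlI => ?_
      rw [← h I hI, ← h' I hI, subspan_update_of_notMem hlI]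
    · rintro u l c hu hc ⟨F, hF, h, ha⟩
      exact ⟨F, hF, fun I hI => by rw [subspan_update_smul hc, h I hI], ha⟩
    · rintro u l j hu hl hj ⟨F, hF, h, ha⟩
      refine ⟨_, hF.reindex (Equiv.swap l j), fun I hI => ?_, ?_⟩
      · rw [subspan_comp_perm, h]
        rwa [Finset.card_image_of_injective _ (Equiv.swap l j).injective]
      · rw [Finset.mem_singleton] at hl hj
        rw [Finset.image_singleton, Equiv.swap_apply_of_ne_of_ne (Ne.symm hl) (Ne.symm hj), ha]
  obtain ⟨b, hb⟩ := exists_ne a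
  rw [← ha']
  have h2 := hF'.singleton_eq hr (hF.reindex (Equiv.swap a i)) hk hkn hb.symm fun I hI _ _ => by
    rw [← h' I hI, subspan_comp_perm, h]
    rwa [Finset.card_image_of_injective _ (Equiv.swap a i).injective]
  rw [h2]
  simp

end Propagation

open Module Submodule

/-! ### A fundamental theorem of projective geometry without surjectivity -/

section Fundamental

variable {R V R' W : Type*} [DivisionRing R] [AddCommGroup V] [Module R V]
  [DivisionRing R'] [AddCommGroup W] [Module R' W]

/-- A map of the nonzero vectors to the one-dimensional subspaces of `W` which sends lines into
lines and preserves the independence of at most three points. -/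
structure IsPointMap (R' : Type*) [DivisionRing R'] [Module R' W] (g : V → Submodule R' W) :
    Prop where
  exists_span : ∀ x, x ≠ 0 → ∃ y, y ≠ 0 ∧ g x = span R' {y}
  smul : ∀ (c : R) x, c ≠ 0 → x ≠ 0 → g (c • x) = g x
  line : ∀ x y, x ≠ 0 → y ≠ 0 → x + y ≠ 0 → g (x + y) ≤ g x ⊔ g y
  indep_two : ∀ x y, x ≠ 0 → y ∉ span R {x} → ∀ a, a ∈ g x → a ∈ g y → a = 0
  indep_three : ∀ x y z, x ≠ 0 → y ∉ span R {x} → z ∉ span R {x, y} → ∀ a ∈ g x, ∀ b ∈ g y,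
    ∀ c ∈ g z, a + b + c = 0 → a = 0 ∧ b = 0 ∧ c = 0

lemma add_mem_span_pair_iff {e v w u : V} (hw : w ∈ span R {e, v}) :
    w + u ∈ span R {e, v} ↔ u ∈ span R {e, v} :=
  Submodule.add_mem_iff_right _ hw

lemma span_pair_le {e v w : V} (hw : w ∈ span R {e, v}) : span R {e, w} ≤ span R {e, v} := by
  rw [span_le]
  rintro x (rfl | rfl)
  · exact subset_span (by simp)
  · exact hw

lemma span_singleton_le_pair (e v : V) : span R {e} ≤ span R {e, v} :=
  span_mono (by simp)

namespace IsPointMap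

variable {g : V → Submodule R' W} (hg : IsPointMap (R := R) R' g)
include hg

lemma eq_span {x : V} (hx : x ≠ 0) {y : W} (hy : y ∈ g x) (hy0 : y ≠ 0) : g x = span R' {y} := by
  obtain ⟨z, -, h⟩ := hg.exists_span x hx
  rw [h] at hy ⊢
  obtain ⟨c, rfl⟩ := mem_span_singleton.mp hy
  refine (span_singleton_smul_eq (IsUnit.mk0 c ?_) z).symm
  rintro rfl
  simp at hy0

lemma neg {x : V} (hx : x ≠ 0) : g (-x) = g x := by
  rw [← neg_one_smul R]
  exact hg.smul _ _ (by simp) hx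

section Normalized

variable {e : V} {x₁ : W} {l : V → W}

/-- A nonzero vector of `g (e + v)` has a nonzero component along `x₁`, as `e + v` and `v` are
independent, and can be scaled to make it `x₁`. Fixing `x₁` thus fixes a scale at every `v` off the
line of `e`. -/
lemma exists_normalized {e : V} (he : e ≠ 0) {x₁ : W} (hx : g e = span R' {x₁}) {v : V}
    (hv : v ∉ span R {e}) : ∃ w ∈ g v, x₁ + w ∈ g (e + v) := by
  have hv0 : v ≠ 0 := fun h => hv (h ▸ zero_mem _)
  have hev : e + v ≠ 0 := fun h => hv (by
    rw [eq_neg_of_add_eq_zero_right h]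
    exact neg_mem (mem_span_singleton_self e))
  obtain ⟨y, hy0, hy⟩ := hg.exists_span _ hev
  have hy' : y ∈ g (e + v) := hy ▸ mem_span_singleton_self y
  obtain ⟨a, ha, w, hw, haw⟩ := mem_sup.mp (hg.line e v he hv0 hev hy')
  rw [hx] at ha
  obtain ⟨c, rfl⟩ := mem_span_singleton.mp ha
  have hc : c ≠ 0 := by
    rintro rfl
    rw [zero_smul, zero_add] at haw
    subst haw
    refine hy0 (hg.indep_two v (e + v) hv0 (fun h => ?_) w hw hy')
    rw [Submodule.add_mem_iff_left _ (mem_span_singleton_self v)] at h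
    obtain ⟨t, ht⟩ := mem_span_singleton.mp h
    refine hv (mem_span_singleton.mpr ⟨t⁻¹, ?_⟩)
    rw [← ht, smul_smul, inv_mul_cancel₀, one_smul]
    rintro rfl
    rw [zero_smul] at ht
    exact he ht.symm
  refine ⟨c⁻¹ • w, smul_mem _ _ hw, ?_⟩
  have : x₁ + c⁻¹ • w = c⁻¹ • y := by
    rw [← haw, smul_add, smul_smul, inv_mul_cancel₀ hc, one_smul]
  rw [this]
  exact smul_mem _ _ hy'

variable (he : e ≠ 0) (hx0 : x₁ ≠ 0) (hx : g e = span R' {x₁})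
  (hl : ∀ v, v ∉ span R {e} → l v ∈ g v ∧ x₁ + l v ∈ g (e + v))
include he hx0 hx hl

lemma add_normalized_ne_zero {v : V} (hv : v ∉ span R {e}) : x₁ + l v ≠ 0 := fun h => by
  have h1 : x₁ = -l v := eq_neg_of_add_eq_zero_left h
  refine hx0 (hg.indep_two e v he hv x₁ (hx ▸ mem_span_singleton_self x₁) ?_)
  rw [h1]
  exact neg_mem (hl v hv).1

lemma normalized_ne_zero {v : V} (hv : v ∉ span R {e}) : l v ≠ 0 := fun h => by
  have h1 := (hl v hv).2
  rw [h, add_zero] at h1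
  refine hx0 (hg.indep_two e (e + v) he (fun h2 => hv ?_) x₁ (hx ▸ mem_span_singleton_self x₁) h1)
  rwa [Submodule.add_mem_iff_right _ (mem_span_singleton_self e)] at h2

lemma normalized_unique {v : V} (hv : v ∉ span R {e}) {w : W} (hw : w ∈ g v)
    (hw' : x₁ + w ∈ g (e + v)) : w = l v := by
  have hev : e + v ≠ 0 := fun h => hv (by
    rw [eq_neg_of_add_eq_zero_right h]
    exact neg_mem (mem_span_singleton_self e))
  rw [hg.eq_span hev (hl v hv).2 (hg.add_normalized_ne_zero he hx0 hx hl hv)] at hw'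
  obtain ⟨c, hc⟩ := mem_span_singleton.mp hw'
  have h1 : (c - 1) • x₁ = w - c • l v := by
    rw [sub_smul, one_smul, sub_eq_sub_iff_add_eq_add, ← smul_add, hc, add_comm]
  have h2 := hg.indep_two e v he hv ((c - 1) • x₁)
    (hx ▸ smul_mem _ _ (mem_span_singleton_self x₁))
    (h1 ▸ sub_mem hw (smul_mem _ _ (hl v hv).1))
  have h3 : c = 1 := by
    rcases smul_eq_zero.mp h2 with h | h
    · exact sub_eq_zero.mp h
    · exact absurd h hx0
  rw [h3] at hc
  simpa using hc.symm

/-- The point `e + v + w` lies on the line through `e + v` and `w` and on the line through `e + w`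
and `v`; comparing components puts `x₁ + l v + l w` in its image. Likewise `v + w` lies on the line
through `v` and `w` and on that through `e + v + w` and `e`. Uniqueness of the normalization
concludes. -/
lemma normalized_add_of_indep {v w : V} (hv : v ∉ span R {e}) (hw : w ∉ span R {e, v}) :
    l (v + w) = l v + l w := by
  have hwe : w ∉ span R {e} := fun h => hw (span_singleton_le_pair e v h)
  have hvw : v + w ∉ span R {e} := fun h =>
    hw ((add_mem_span_pair_iff (subset_span (by simp))).mp (span_singleton_le_pair e v h))
  have hne : ∀ {u : V}, u ∉ span R {e} → u ≠ 0 := fun hu h => hu (h ▸ zero_mem _)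
  have hadd : ∀ {u : V}, u ∉ span R {e} → e + u ∉ span R {e} := fun hu h =>
    hu ((Submodule.add_mem_iff_right _ (mem_span_singleton_self e)).mp h)
  have hxm : ∀ c : R', c • x₁ ∈ g e := fun c => hx ▸ smul_mem _ _ (mem_span_singleton_self x₁)
  have hevw := hne (hadd hvw)
  have hspan : ∀ {u : V}, u ∉ span R {e} → g (e + u) = span R' {x₁ + l u} := fun hu =>
    hg.eq_span (hne (hadd hu)) (hl _ hu).2 (hg.add_normalized_ne_zero he hx0 hx hl hu)
  have h1 : x₁ + (l v + l w) ∈ g (e + (v + w)) := by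
    obtain ⟨y, hy0, hy⟩ := hg.exists_span _ hevw
    have hym : y ∈ g (e + (v + w)) := hy ▸ mem_span_singleton_self y
    have m1 : y ∈ g (e + v) ⊔ g w := by
      have := hg.line (e + v) w (hne (hadd hv)) (hne hwe) (by rwa [add_assoc])
      rw [add_assoc] at this
      exact this hym
    have m2 : y ∈ g (e + w) ⊔ g v := by
      have := hg.line (e + w) v (hne (hadd hwe)) (hne hv) (by rwa [add_assoc, add_comm w])
      rw [add_assoc, add_comm w] at this
      exact this hym
    rw [hspan hv] at m1
    rw [hspan hwe] at m2
    obtain ⟨p, hp, w', hw', rfl⟩ := mem_sup.mp m1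
    obtain ⟨q, hq, v', hv', hqv⟩ := mem_sup.mp m2
    obtain ⟨a, rfl⟩ := mem_span_singleton.mp hp
    obtain ⟨b, rfl⟩ := mem_span_singleton.mp hq
    obtain ⟨-, -, h3⟩ := hg.indep_three e v w he hv hw ((a - b) • x₁) (hxm _) (a • l v - v')
      (sub_mem (smul_mem _ _ (hl v hv).1) hv') (w' - b • l w)
      (sub_mem hw' (smul_mem _ _ (hl w hwe).1)) (by
        rw [sub_smul]
        have : a • x₁ - b • x₁ + (a • l v - v') + (w' - b • l w) =
          (a • (x₁ + l v) + w') - (b • (x₁ + l w) + v') := by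
          rw [smul_add, smul_add]; abel
        rw [this, hqv, sub_self])
    obtain ⟨h4, -, -⟩ := hg.indep_three e v w he hv hw ((a - b) • x₁) (hxm _) (a • l v - v')
      (sub_mem (smul_mem _ _ (hl v hv).1) hv') (w' - b • l w)
      (sub_mem hw' (smul_mem _ _ (hl w hwe).1)) (by
        rw [sub_smul]
        have : a • x₁ - b • x₁ + (a • l v - v') + (w' - b • l w) =
          (a • (x₁ + l v) + w') - (b • (x₁ + l w) + v') := by
          rw [smul_add, smul_add]; abel
        rw [this, hqv, sub_self])
    have hab : a = b := sub_eq_zero.mp ((smul_eq_zero.mp h4).resolve_right hx0)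
    subst hab
    rw [sub_eq_zero] at h3
    subst h3
    rw [← smul_add, add_assoc] at hym hy0
    have ha : a ≠ 0 := fun h => hy0 (by rw [h, zero_smul])
    exact (smul_mem_iff _ ha).mp hym
  have h2 : l v + l w ∈ g (v + w) := by
    obtain ⟨y, hy0, hy⟩ := hg.exists_span _ (hne hvw)
    have hym : y ∈ g (v + w) := hy ▸ mem_span_singleton_self y
    have hnz : x₁ + (l v + l w) ≠ 0 := fun h => hx0
      (hg.indep_three e v w he hv hw x₁ (by simpa using hxm 1) _ (hl v hv).1 _ (hl w hwe).1
        (by rwa [add_assoc])).1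
    have m1 : y ∈ g v ⊔ g w := hg.line v w (hne hv) (hne hwe) (hne hvw) hym
    have m2 : y ∈ g (e + (v + w)) ⊔ g e := by
      have := hg.line (e + (v + w)) (-e) hevw (neg_ne_zero.mpr he) (by
        rw [add_neg_cancel_comm]; exact hne hvw)
      rw [add_neg_cancel_comm, hg.neg he] at this
      exact this hym
    rw [hg.eq_span hevw h1 hnz, hx] at m2
    obtain ⟨v', hv', w', hw', rfl⟩ := mem_sup.mp m1
    obtain ⟨p, hp, q, hq, hpq⟩ := mem_sup.mp m2
    obtain ⟨a, rfl⟩ := mem_span_singleton.mp hp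
    obtain ⟨b, rfl⟩ := mem_span_singleton.mp hq
    obtain ⟨-, h3, h4⟩ := hg.indep_three e v w he hv hw ((a + b) • x₁) (hxm _) (a • l v - v')
      (sub_mem (smul_mem _ _ (hl v hv).1) hv') (a • l w - w')
      (sub_mem (smul_mem _ _ (hl w hwe).1) hw') (by
        have : (a + b) • x₁ + (a • l v - v') + (a • l w - w') =
          (a • (x₁ + (l v + l w)) + b • x₁) - (v' + w') := by
          rw [smul_add, smul_add, add_smul]; abel
        rw [this, hpq, sub_self])
    rw [sub_eq_zero] at h3 h4
    rw [← h3, ← h4, ← smul_add] at hym hy0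
    have ha : a ≠ 0 := fun h => hy0 (by rw [h, zero_smul])
    exact (smul_mem_iff _ ha).mp hym
  exact (hg.normalized_unique he hx0 hx hl hvw h2 h1).symm

variable (hdim : ∀ v, ∃ u : V, u ∉ span R {e, v})
include hdim

/-- For `w` in the plane of `e` and `v`, a vector `u` off that plane reduces to the independent
case: `l (v + w + u)` is expanded in two ways. -/
lemma normalized_add {v w : V} (hv : v ∉ span R {e}) (hw : w ∉ span R {e})
    (hvw : v + w ∉ span R {e}) : l (v + w) = l v + l w := by
  have hadd := fun {v w} => hg.normalized_add_of_indep (v := v) (w := w) he hx0 hx hl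
  by_cases hwv : w ∈ span R {e, v}
  · obtain ⟨u, hu⟩ := hdim v
    have hvm : v ∈ span R {e, v} := subset_span (by simp)
    have h1 := hadd hvw fun h => hu (span_pair_le (add_mem hvm hwv) h)
    have h2 := hadd hw fun h => hu (span_pair_le hwv h)
    have h3 := hadd hv (w := w + u) fun h => hu ((Submodule.add_mem_iff_right _ hwv).mp h)
    rw [← add_assoc, h1, h2, ← add_assoc] at h3
    exact add_right_cancel h3
  · exact hadd hv hwv

/-- On the line of `e` the normalization says nothing; this difference, independent of `v`, serves
as the value at `z`. -/
lemma normalized_sub_eq {z v w : V} (hz : z ∈ span R {e}) (hv : v ∉ span R {e})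
    (hw : w ∉ span R {e}) : l (z + v) - l v = l (z + w) - l w := by
  have hadd := fun {v w} => hg.normalized_add_of_indep (v := v) (w := w) he hx0 hx hl
  have key : ∀ {v u : V}, v ∉ span R {e} → u ∉ span R {e, v} →
      l (z + v) - l v = l (z + u) - l u := by
    intro v u hv hu
    have hz' : z ∈ span R {e, v} := span_singleton_le_pair e v hz
    have hvm : v ∈ span R {e, v} := subset_span (by simp)
    have h1 := hadd (v := z + v) (w := u) (fun h => hv ((Submodule.add_mem_iff_right _ hz).mp h))
      fun h => hu (span_pair_le (add_mem hz' hvm) h)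
    have h2 := hadd hv (w := z + u) fun h => hu ((Submodule.add_mem_iff_right _ hz').mp h)
    rw [show z + v + u = v + (z + u) by abel, h2] at h1
    rw [sub_eq_sub_iff_add_eq_add, ← h1, add_comm]
  by_cases hwv : w ∈ span R {e, v}
  · obtain ⟨u, hu⟩ := hdim v
    rw [key hv hu, key hw fun h => hu (span_pair_le hwv h)]
  · exact key hv hwv

lemma exists_additive : ∃ L : V →+ W, ∀ v, v ≠ 0 → L v ≠ 0 ∧ L v ∈ g v := by
  classical
  obtain ⟨u₀, hu₀⟩ := hdim 0
  replace hu₀ : u₀ ∉ span R {e} := fun h => hu₀ (span_singleton_le_pair e 0 h)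
  have hsub := fun {z v w} => hg.normalized_sub_eq (z := z) (v := v) (w := w) he hx0 hx hl hdim
  have hind := fun {v w} => hg.normalized_add_of_indep (v := v) (w := w) he hx0 hx hl
  have hza : ∀ {z v : V}, z ∈ span R {e} → v ∉ span R {e} → z + v ∉ span R {e} :=
    fun hz hv h => hv ((Submodule.add_mem_iff_right _ hz).mp h)
  set L : V → W := fun v => if v ∈ span R {e} then l (v + u₀) - l u₀ else l v with hL
  have hLz : ∀ {z v}, z ∈ span R {e} → v ∉ span R {e} → L z = l (z + v) - l v := fun hz hv => by
    simp only [hL, hz, if_true]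
    exact hsub hz hu₀ hv
  have hLv : ∀ {v}, v ∉ span R {e} → L v = l v := fun hv => by simp only [hL, hv, if_false]
  have hmixed : ∀ {z v}, z ∈ span R {e} → v ∉ span R {e} → L (z + v) = L z + L v :=
    fun hz hv => by rw [hLz hz hv, hLv (hza hz hv), hLv hv, sub_add_cancel]
  have hLadd : ∀ v w, L (v + w) = L v + L w := by
    intro v w
    by_cases hv : v ∈ span R {e} <;> by_cases hw : w ∈ span R {e}
    · rw [hLz (add_mem hv hw) hu₀, hLz hw hu₀, hLz hv (hza hw hu₀), add_assoc]
      abel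
    · exact hmixed hv hw
    · rw [add_comm, hmixed hw hv, add_comm]
    · by_cases hvw : v + w ∈ span R {e}
      · obtain ⟨u, hu⟩ := hdim v
        have hvm : v ∈ span R {e, v} := subset_span (by simp)
        have hwm : w ∈ span R {e, v} :=
          (Submodule.add_mem_iff_right _ hvm).mp (span_singleton_le_pair e v hvw)
        have h1 := hind hv (w := w + u) fun h => hu ((Submodule.add_mem_iff_right _ hwm).mp h)
        have h2 := hind hw (w := u) fun h => hu (span_pair_le hwm h)
        have hue : u ∉ span R {e} := fun h => hu (span_singleton_le_pair e v h)
        rw [hLz hvw hue, hLv hv, hLv hw, add_assoc, h1, h2]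
        abel
      · rw [hLv hvw, hLv hv, hLv hw]
        exact hg.normalized_add he hx0 hx hl hdim hv hw hvw
  refine ⟨AddMonoidHom.mk' L hLadd, fun v hv => ?_⟩
  change L v ≠ 0 ∧ L v ∈ g v
  by_cases hve : v ∈ span R {e}
  · obtain ⟨t, rfl⟩ := mem_span_singleton.mp hve
    have ht : t ≠ 0 := fun h => hv (by rw [h, zero_smul])
    rw [hg.smul t e ht he]
    have hne : ∀ {u : V}, u ∉ span R {e} → u ≠ 0 := fun hu h => hu (h ▸ zero_mem _)
    constructor
    · rw [hLz hve hu₀, sub_ne_zero]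
      intro h
      refine hg.normalized_ne_zero he hx0 hx hl hu₀ (hg.indep_two u₀ (t • e + u₀) (hne hu₀)
        (fun h1 => ?_) _ (hl u₀ hu₀).1 (h ▸ (hl _ (hza hve hu₀)).1))
      rw [Submodule.add_mem_iff_left _ (mem_span_singleton_self u₀), smul_mem_iff _ ht] at h1
      obtain ⟨c, hc⟩ := mem_span_singleton.mp h1
      refine hu₀ (mem_span_singleton.mpr ⟨c⁻¹, ?_⟩)
      rw [← hc, smul_smul, inv_mul_cancel₀, one_smul]
      rintro rfl
      rw [zero_smul] at hc
      exact he hc.symm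
    -- The value at `t • e` lies in `g e + g u` for every `u` off the line. Two choices of `u`,
    -- independent together with `e`, leave only `g e`.
    · have key : ∀ {u}, u ∉ span R {e} → ∃ a ∈ g e, ∃ b ∈ g u, L (t • e) = a + b := by
        intro u hu
        have h1 := hg.line (t • e) u hv (hne hu) (hne (hza hve hu)) (hl _ (hza hve hu)).1
        rw [hg.smul t e ht he] at h1
        obtain ⟨a, ha, b, hb, h⟩ := mem_sup.mp h1
        refine ⟨a, ha, b - l u, sub_mem hb (hl u hu).1, ?_⟩
        rw [hLz hve hu, ← h, add_sub_assoc]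
      obtain ⟨u, hu⟩ := hdim u₀
      obtain ⟨a, ha, b, hb, h1⟩ := key hu₀
      obtain ⟨a', ha', b', hb', h2⟩ := key fun h => hu (span_singleton_le_pair e u₀ h)
      have h3 := (hg.indep_three e u₀ u he hu₀ hu (a - a') (sub_mem ha ha') b hb (-b')
        (neg_mem hb') (by
          have : a - a' + b + -b' = (a + b) - (a' + b') := by abel
          rw [this, ← h1, ← h2, sub_self])).2.1
      rw [h1, h3, add_zero]
      exact ha
  · rw [hLv hve]
    exact ⟨hg.normalized_ne_zero he hx0 hx hl hve, (hl v hve).1⟩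

end Normalized

/-- Multiplication by `a` acts on `L u`, `L w` and `L (u + w)` by some factors; additivity and the
independence of the images of `u` and `w` make them equal. -/
lemma smul_transfer {L : V →+ W} (hL : ∀ v, v ≠ 0 → L v ≠ 0 ∧ L v ∈ g v) {a : R} {c : R'}
    {u w : V} (hu : u ≠ 0) (hw : w ∉ span R {u}) (h : L (a • u) = c • L u) :
    L (a • w) = c • L w := by
  by_cases ha : a = 0
  · subst ha
    rw [zero_smul, map_zero] at h ⊢
    rw [(smul_eq_zero.mp h.symm).resolve_right (hL u hu).1, zero_smul]
  have hw0 : w ≠ 0 := fun h => hw (h ▸ zero_mem _)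
  have huw : u + w ≠ 0 := fun h => hw (by
    rw [eq_neg_of_add_eq_zero_right h]
    exact neg_mem (mem_span_singleton_self u))
  have hmem : ∀ {x : V}, x ≠ 0 → ∃ d : R', d • L x = L (a • x) := fun {x} hx => by
    have h1 := (hL (a • x) (smul_ne_zero ha hx)).2
    rw [hg.smul a x ha hx, hg.eq_span hx (hL x hx).2 (hL x hx).1] at h1
    exact mem_span_singleton.mp h1
  obtain ⟨d, hd⟩ := hmem hw0
  obtain ⟨d', hd'⟩ := hmem huw
  rw [smul_add, map_add, map_add, h, ← hd, smul_add] at hd'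
  have h1 : (d' - c) • L u = (d - d') • L w := by
    rw [sub_smul, sub_smul, sub_eq_sub_iff_add_eq_add, hd', add_comm]
  have h2 := hg.indep_two u w hu hw ((d' - c) • L u) (smul_mem _ _ (hL u hu).2)
    (h1 ▸ smul_mem _ _ (hL w hw0).2)
  rw [h2] at h1
  have h3 := sub_eq_zero.mp ((smul_eq_zero.mp h2).resolve_right (hL u hu).1)
  have h4 := sub_eq_zero.mp ((smul_eq_zero.mp h1.symm).resolve_right (hL w hw0).1)
  rw [← hd, h4, h3]

/-- The fundamental theorem of projective geometry for maps which need not be surjective. -/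
theorem exists_semilinear [FiniteDimensional R V] (h3 : 3 ≤ finrank R V) :
    ∃ (σ : R →+* R') (l : V →ₛₗ[σ] W), ∀ v, v ≠ 0 → l v ≠ 0 ∧ l v ∈ g v := by
  have hdim : ∀ e v, ∃ u : V, u ∉ span R {e, v} := fun e v => by
    classical
    by_contra! h
    have h1 : span R {e, v} = ⊤ := eq_top_iff'.mpr h
    have h2 := finrank_span_le_card (R := R) ({e, v} : Set V)
    rw [h1, finrank_top] at h2
    have h4 : ({e, v} : Set V).toFinset.card ≤ 2 := by
      simpa using Finset.card_le_two (a := e) (b := v)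
    omega
  have : Nontrivial V := nontrivial_of_finrank_pos (R := R) (by omega)
  obtain ⟨e, he⟩ := exists_ne (0 : V)
  obtain ⟨x₁, hx0, hx⟩ := hg.exists_span e he
  have hex : ∀ v, ∃ w, v ∉ span R {e} → w ∈ g v ∧ x₁ + w ∈ g (e + v) := fun v => by
    by_cases hv : v ∈ span R {e}
    · exact ⟨0, fun h => absurd hv h⟩
    · obtain ⟨w, h⟩ := hg.exists_normalized he hx hv
      exact ⟨w, fun _ => h⟩
  choose l hl using hex
  obtain ⟨L, hL⟩ := hg.exists_additive he hx0 hx hl (hdim e)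
  have hσ : ∀ a : R, ∃ c : R', L (a • e) = c • L e := fun a => by
    by_cases ha : a = 0
    · exact ⟨0, by simp [ha]⟩
    · have h1 := (hL (a • e) (smul_ne_zero ha he)).2
      rw [hg.smul a e ha he, hg.eq_span he (hL e he).2 (hL e he).1] at h1
      obtain ⟨c, hc⟩ := mem_span_singleton.mp h1
      exact ⟨c, hc.symm⟩
  choose s hs using hσ
  have hLe := (hL e he).1
  have hall : ∀ (a : R) (v : V), L (a • v) = s a • L v := fun a v => by
    by_cases hv0 : v = 0
    · simp [hv0]
    by_cases hv : v ∈ span R {e}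
    -- For `v` on the line of `e` the factor is transferred to a vector off the line and back.
    · obtain ⟨u, hu⟩ := hdim e 0
      replace hu : u ∉ span R {e} := fun h => hu (span_singleton_le_pair e 0 h)
      have h1 := hg.smul_transfer hL he hu (hs a)
      refine hg.smul_transfer hL (u := u) (fun (h : u = 0) => hu (h ▸ zero_mem _)) (fun h => ?_) h1
      obtain ⟨c, hc⟩ := mem_span_singleton.mp h
      refine hu ((smul_mem_iff _ (s := c) ?_).mp (hc ▸ hv))
      rintro rfl
      exact hv0 (by rw [← hc, zero_smul])
    · exact hg.smul_transfer hL he hv (hs a)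
  have hcancel : ∀ {a b : R'}, a • L e = b • L e → a = b := fun h =>
    smul_left_injective R' hLe h
  let σ : R →+* R' :=
    { toFun := s
      map_one' := hcancel (by rw [← hs, one_smul, one_smul])
      map_mul' := fun a b => hcancel (by rw [← hs, mul_smul, hall, hs, smul_smul])
      map_zero' := hcancel (by rw [← hs, zero_smul, zero_smul, map_zero])
      map_add' := fun a b => hcancel (by rw [← hs, add_smul, map_add, hs, hs, add_smul]) }
  exact ⟨σ, { toFun := L, map_add' := L.map_add, map_smul' := hall }, hL⟩

end IsPointMap

end Fundamental

/-! ### From maps of apartments to semilinear embeddings -/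

open Module Submodule

lemma isRank_finrank (R V : Type*) [DivisionRing R] [AddCommGroup V] [Module R V]
    [FiniteDimensional R V] : IsRank (fun P : Submodule R V => finrank R P) where
  strictMono _ _ h := Submodule.finrank_lt_finrank_of_lt h
  modular a b := Submodule.finrank_sup_add_finrank_inf_eq a b

section Induced

variable {R V R' W : Type*} [DivisionRing R] [AddCommGroup V] [Module R V]
  [DivisionRing R'] [AddCommGroup W] [Module R' W] {ι : Type*} [Fintype ι] [DecidableEq ι]

lemma IsFrame.le_of_forall {L : Type*} [Lattice L] [BoundedOrder L] {r : L → ℕ} {s k : ℕ}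
    {F : Finset ι → L} (hr : IsRank r) (hF : IsFrame r s F) {M : Finset ι} (hM : M.card ≤ k)
    (hk : k < Fintype.card ι) {z : L} (h : ∀ I, I.card = k → M ⊆ I → z ≤ F I) : z ≤ F M := by
  classical
  set Y := Finset.univ.filter fun I : Finset ι => I.card = k ∧ M ⊆ I with hY
  have hex : ∀ B : Finset ι, B.card ≤ 1 → Disjoint M B → ∃ I ∈ Y, Disjoint I B :=
    fun B hB hMB => by
      obtain ⟨I, h1, h2, h3⟩ := Finset.exists_subsuperset_card_eq (s := M) (t := Bᶜ) (n := k)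
        (Finset.subset_compl_iff_disjoint_right.mpr hMB) hM (by rw [Finset.card_compl]; omega)
      exact ⟨I, by simp [hY, h1, h3], Finset.subset_compl_iff_disjoint_right.mp h2⟩
  have hne : Y.Nonempty := by
    obtain ⟨I, hI, -⟩ := hex ∅ (by simp) (by simp)
    exact ⟨I, hI⟩
  rw [← hF.inf_eq hr Y hne M fun a => ⟨fun ha I hI => ?_, fun ha => ?_⟩]
  · refine Finset.le_inf fun I hI => ?_
    simp only [hY, Finset.mem_filter, Finset.mem_univ, true_and] at hI
    exact h I hI.1 hI.2
  · simp only [hY, Finset.mem_filter, Finset.mem_univ, true_and] at hI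
    exact hI.2 ha
  · by_contra haM
    obtain ⟨I, hI, hd⟩ := hex {a} (by simp) (by simpa using haM)
    exact (Finset.disjoint_singleton_right.mp hd) (ha I hI)

omit [Fintype ι] in
lemma IsFrame.eq_subspan [FiniteDimensional R' W] {F : Finset ι → Submodule R' W}
    (hF : IsFrame (fun P : Submodule R' W => finrank R' P) 0 F) {w : ι → W}
    (hw : ∀ i, F {i} = span R' {w i}) (I : Finset ι) : F I = subspan R' w I := by
  induction I using Finset.induction_on with
  | empty =>
    have := hF.rank ∅
    rw [Finset.card_empty, Nat.add_zero, Submodule.finrank_eq_zero] at this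
    simp [this, subspan]
  | insert a I ha ih =>
    rw [Finset.insert_eq, hF.sup, ih, hw, subspan, subspan, ← span_union]
    simp [Set.image_insert_eq]

lemma spanImage_subspan {σ : R →+* R'} (l : V →ₛₗ[σ] W) {κ : Type*} [DecidableEq κ]
    (v : κ → V) (I : Finset κ) :
    spanImage l (subspan R v I) = subspan R' (l ∘ v) I := by
  refine le_antisymm ?_ ?_
  · rw [spanImage, span_le]
    rintro _ ⟨x, hx, rfl⟩
    induction hx using span_induction with
    | mem x hx =>
      obtain ⟨i, hi, rfl⟩ := hx
      exact subset_span ⟨i, hi, rfl⟩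
    | zero => rw [map_zero]; exact zero_mem _
    | add x y _ _ hx hy => rw [map_add]; exact add_mem hx hy
    | smul a x _ hx => rw [LinearMap.map_smulₛₗ]; exact smul_mem _ _ hx
  · rw [subspan_le_iff]
    exact fun i hi => subset_span ⟨v i, mem_subspan hi, rfl⟩

omit [DecidableEq ι] in
lemma exists_eq_subspan [FiniteDimensional R V] (hcard : Fintype.card ι = finrank R V)
    (P : Submodule R V) : ∃ v : ι → V, LinearIndependent R v ∧ ∃ I : Finset ι,
      I.card = finrank R P ∧ P = subspan R v I := by
  classical
  let b := finBasis R P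
  have hb : LinearIndependent R (fun i => (b i : V)) :=
    b.linearIndependent.map' P.subtype (ker_subtype P)
  obtain ⟨v, hv, j, hj, hvj⟩ := exists_linearIndependent_extend hcard hb
  refine ⟨v, hv, Finset.univ.image j, by simp [Finset.card_image_of_injective _ hj], ?_⟩
  have h1 : v '' (Finset.univ.image j : Finset ι) = P.subtype '' Set.range b := by
    rw [Finset.coe_image, Finset.coe_univ, Set.image_univ, ← Set.range_comp, hvj, ← Set.range_comp]
    rfl
  rw [subspan, h1, span_image, b.span_eq, Submodule.map_top, range_subtype]

omit [DecidableEq ι] in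
lemma exists_linearIndependent_pair [FiniteDimensional R V] (hcard : Fintype.card ι = finrank R V)
    {x y : V} (hx : x ≠ 0) (hy : y ∉ span R {x}) :
    ∃ v : ι → V, LinearIndependent R v ∧ ∃ a b, a ≠ b ∧ v a = x ∧ v b = y := by
  have h : LinearIndependent R ![y, x] := by
    refine linearIndependent_finCons.mpr
      ⟨LinearIndependent.of_subsingleton 0 (by simpa using hx), ?_⟩
    rwa [Matrix.range_cons, Matrix.range_empty, Set.union_empty]
  obtain ⟨v, hv, j, hj, hvj⟩ := exists_linearIndependent_extend hcard h
  exact ⟨v, hv, j 1, j 0, hj.ne (by decide), congrFun hvj 1, congrFun hvj 0⟩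

omit [DecidableEq ι] in
lemma exists_linearIndependent_triple [FiniteDimensional R V]
    (hcard : Fintype.card ι = finrank R V) {x y z : V} (hx : x ≠ 0) (hy : y ∉ span R {x})
    (hz : z ∉ span R {x, y}) : ∃ v : ι → V, LinearIndependent R v ∧
      ∃ a b c, a ≠ b ∧ a ≠ c ∧ b ≠ c ∧ v a = x ∧ v b = y ∧ v c = z := by
  have h : LinearIndependent R ![z, y, x] := by
    refine linearIndependent_finCons.mpr ⟨linearIndependent_finCons.mpr
      ⟨LinearIndependent.of_subsingleton 0 (by simpa using hx), ?_⟩, ?_⟩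
    · rwa [Matrix.range_cons, Matrix.range_empty, Set.union_empty]
    · rwa [Matrix.range_cons, Matrix.range_cons, Matrix.range_empty, Set.union_empty,
        Set.union_comm, Set.singleton_union]
  obtain ⟨v, hv, j, hj, hvj⟩ := exists_linearIndependent_extend hcard h
  exact ⟨v, hv, j 2, j 1, j 0, hj.ne (by decide), hj.ne (by decide), hj.ne (by decide),
    congrFun hvj 2, congrFun hvj 1, congrFun hvj 0⟩

variable [FiniteDimensional R V] [FiniteDimensional R' W]

/-- A map sending every apartment to an apartment, compatibly with indices, is induced by a
semilinear embedding. -/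
theorem exists_semilinearEmbedding {k : ℕ} (hcard : Fintype.card ι = finrank R V)
    (hk : 2 ≤ k) (hkn : k + 2 ≤ Fintype.card ι) {f : Submodule R V → Submodule R' W}
    (hf : ∀ v : ι → V, LinearIndependent R v →
      ∃ F, IsFrame (fun P : Submodule R' W => finrank R' P) 0 F ∧
        ∀ I, I.card = k → f (subspan R v I) = F I) :
    ∃ (σ : R →+* R') (l : V →ₛₗ[σ] W), IsSemilinearEmbedding l ∧
      ∀ P : Submodule R V, finrank R P = k → f P = spanImage l P := by
  have hr := isRank_finrank R' W
  have hr0 : ∀ {F : Finset ι → Submodule R' W},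
      IsFrame (fun P : Submodule R' W => finrank R' P) 0 F → F ∅ = ⊥ := fun hF => by
    have := hF.rank ∅
    rwa [Finset.card_empty, Nat.add_zero, Submodule.finrank_eq_zero] at this
  have : Nontrivial ι := Fintype.one_lt_card_iff_nontrivial.mp (by omega)
  obtain ⟨a⟩ : Nonempty ι := inferInstance
  obtain ⟨b, hb⟩ := exists_ne a
  obtain ⟨g, hg⟩ := exists_pointMap hr hcard (by omega) hkn hf
  have hsmul : ∀ (c : R) x, c ≠ 0 → x ≠ 0 → g (c • x) = g x := fun c x hc hx => by
    obtain ⟨v, hv, rfl⟩ := exists_linearIndependent_apply_eq hcard a hx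
    obtain ⟨F, hF, hfF, hgF⟩ := hg v hv
    obtain ⟨F', hF', hfF', hgF'⟩ := hg _ (linearIndependent_update_smul hv a hc)
    have := hgF' a
    rw [Function.update_self] at this
    rw [this, hgF]
    refine hF'.singleton_eq hr hF (by omega) hkn hb.symm fun I hI _ _ => ?_
    rw [← hfF I hI, ← hfF' I hI, subspan_update_smul hc]
  have hpm : IsPointMap (R := R) R' g := by
    refine ⟨fun x hx => ?_, hsmul, fun x y hx hy hxy => ?_, fun x y hx hy p hp hp' => ?_,
      fun x y z hx hy hz p hp q hq t ht hsum => ?_⟩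
    · obtain ⟨v, hv, rfl⟩ := exists_linearIndependent_apply_eq hcard a hx
      obtain ⟨F, hF, -, hgF⟩ := hg v hv
      rw [hgF]
      obtain ⟨w, hw, h⟩ := finrank_eq_one_iff'.mp (by simpa using hF.rank {a})
      refine ⟨w, by simpa using hw, le_antisymm (fun u hu => ?_) ?_⟩
      · obtain ⟨c, hc⟩ := h ⟨u, hu⟩
        exact mem_span_singleton.mpr ⟨c, congrArg Subtype.val hc⟩
      · rw [span_singleton_le_iff_mem]
        exact w.2
    · by_cases hyx : y ∈ span R {x}
      · obtain ⟨c, rfl⟩ := mem_span_singleton.mp hyx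
        have h1 : x + c • x = (1 + c) • x := by rw [add_smul, one_smul]
        rw [h1] at hxy ⊢
        rw [hsmul (1 + c) x (fun h => hxy (by rw [h, zero_smul])) hx]
        exact le_sup_left
      · obtain ⟨v, hv, i, j, hij, rfl, rfl⟩ := exists_linearIndependent_pair hcard hx hyx
        obtain ⟨F, hF, hfF, hgF⟩ := hg v hv
        -- With `x + y` in place of `x`, index sets containing both `i` and `j` span the same
        -- subspaces as before. So the point of `x + y` lies below each such `F I`, and their meet
        -- is `F {i, j}`.
        obtain ⟨F', hF', hfF', hgF'⟩ := hg _ (linearIndependent_update_add hv hij 1)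
        have h1 := hgF' i
        rw [Function.update_self, one_smul] at h1
        rw [h1, hgF, hgF, ← hF.sup]
        refine hF.le_of_forall hr (Finset.card_le_two.trans hk) (by omega) fun I hI hij' => ?_
        have h2 : i ∈ I := hij' (by simp)
        have h3 : j ∈ I := hij' (by simp)
        rw [← hfF I hI, ← subspan_update_add hij 1 fun _ => h3, hfF' I hI]
        exact hF'.mono (by simpa using h2)
    · obtain ⟨v, hv, i, j, hij, rfl, rfl⟩ := exists_linearIndependent_pair hcard hx hy
      obtain ⟨F, hF, -, hgF⟩ := hg v hv
      rw [hgF] at hp hp'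
      have h1 : p ∈ F {i} ⊓ F {j} := ⟨hp, hp'⟩
      rw [hF.inf hr, Finset.singleton_inter_of_notMem (by simpa using hij), hr0 hF] at h1
      simpa using h1
    · obtain ⟨v, hv, i, j, l, hij, hil, hjl, rfl, rfl, rfl⟩ :=
        exists_linearIndependent_triple hcard hx hy hz
      obtain ⟨F, hF, -, hgF⟩ := hg v hv
      rw [hgF] at hp hq ht
      have key : ∀ {i j l p q t}, i ≠ j → i ≠ l → p ∈ F {i} → q ∈ F {j} → t ∈ F {l} →
          p + q + t = 0 → p = 0 := by
        intro i j l p q t hij hil hp hq ht h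
        have h1 : p = -(q + t) := by
          rw [add_assoc] at h
          exact eq_neg_of_add_eq_zero_left h
        have h2 : p ∈ F {i} ⊓ F {j, l} := by
          refine ⟨hp, ?_⟩
          rw [h1]
          exact neg_mem (add_mem (hF.mono (by simp) hq) (hF.mono (by simp) ht))
        rw [hF.inf hr, Finset.singleton_inter_of_notMem (by simp [hij, hil]), hr0 hF] at h2
        simpa using h2
      exact ⟨key hij hil hp hq ht hsum,
        key hij.symm hjl hq hp ht (by rw [add_comm q p, hsum]),
        key hil.symm hjl.symm ht hp hq (by rw [add_assoc, add_comm, hsum])⟩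
  obtain ⟨σ, l, hl⟩ := hpm.exists_semilinear (by omega)
  have hFl : ∀ v : ι → V, LinearIndependent R v →
      ∃ F, IsFrame (fun P : Submodule R' W => finrank R' P) 0 F ∧
      (∀ I, I.card = k → f (subspan R v I) = F I) ∧ ∀ I, F I = subspan R' (l ∘ v) I := by
    intro v hv
    obtain ⟨F, hF, hfF, hgF⟩ := hg v hv
    refine ⟨F, hF, hfF, hF.eq_subspan fun i => ?_⟩
    obtain ⟨h1, h2⟩ := hl (v i) (hv.ne_zero i)
    rw [← hgF, hpm.eq_span (hv.ne_zero i) h2 h1]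
    rfl
  refine ⟨σ, l, ⟨?_, fun v hv => ?_⟩, fun P hP => ?_⟩
  · rw [injective_iff_map_eq_zero]
    intro x hx
    by_contra h
    exact (hl x h).1 hx
  · obtain ⟨e⟩ : Nonempty (ι ≃ Fin (finrank R V)) := Fintype.card_eq.mp (by simp [hcard])
    obtain ⟨F, hF, -, h⟩ := hFl (v ∘ e) (hv.comp _ e.injective)
    have h1 : LinearIndependent R' (l ∘ v ∘ e) := by
      rw [linearIndependent_iff_card_eq_finrank_span, Set.finrank]
      have h2 := hF.rank Finset.univ
      rw [h, subspan, Finset.coe_univ, Set.image_univ, Finset.card_univ, zero_add] at h2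
      exact h2.symm
    rw [← Function.comp_assoc] at h1
    exact (linearIndependent_equiv e).mp h1
  · obtain ⟨v, hv, I, hI, rfl⟩ := exists_eq_subspan hcard P
    obtain ⟨F, -, hfF, h⟩ := hFl v hv
    rw [hfF I (hI.trans hP), h, spanImage_subspan]

end Induced

open Module Submodule

/-! ### Path distances in Johnson and Grassmann graphs -/

section Distance

/-- An edge lowers `δ` by at most one, so walks have length at least `δ`; `hstep` builds a walk of
exactly that length. -/
lemma dist_eq_of_step {α : Type*} {G : SimpleGraph α} (δ : α → α → ℕ) (h0 : ∀ x, δ x x = 0)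
    (hc : ∀ x y, δ x y = 0 → x = y) (hadj : ∀ x z y, G.Adj x z → δ x y ≤ δ z y + 1)
    (hstep : ∀ x y, δ x y ≠ 0 → ∃ z, G.Adj x z ∧ δ z y + 1 ≤ δ x y) (x y : α) :
    G.dist x y = δ x y := by
  have hw : ∀ N x, δ x y = N → ∃ p : G.Walk x y, p.length = N := by
    intro N
    induction N with
    | zero =>
      intro x hx
      obtain rfl := hc x y hx
      exact ⟨SimpleGraph.Walk.nil, rfl⟩
    | succ N ih =>
      intro x hx
      obtain ⟨z, hz, h⟩ := hstep x y (by omega)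
      have := hadj x z y hz
      obtain ⟨p, hp⟩ := ih z (by omega)
      exact ⟨SimpleGraph.Walk.cons hz p, by simp [hp]⟩
  have hle : ∀ {x y} (p : G.Walk x y), δ x y ≤ p.length := by
    intro x y p
    induction p with
    | nil => simp [h0]
    | cons h p ih =>
      rw [SimpleGraph.Walk.length_cons]
      exact (hadj _ _ _ h).trans (Nat.add_le_add_right ih 1)
  obtain ⟨p, hp⟩ := hw _ x rfl
  obtain ⟨q, hq⟩ := p.reachable.exists_walk_length_eq_dist
  exact le_antisymm (hp ▸ SimpleGraph.dist_le p) (hq ▸ hle q)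

lemma johnsonGraph_dist {n k : ℕ} (X Y : {X : Finset (Fin n) // X.card = k}) :
    (johnsonGraph n k).dist X Y = k - (X.1 ∩ Y.1).card := by
  have hle : ∀ X Y : {X : Finset (Fin n) // X.card = k}, (X.1 ∩ Y.1).card ≤ k := fun X Y =>
    (Finset.card_le_card Finset.inter_subset_left).trans X.2.le
  refine dist_eq_of_step (fun X Y => k - (X.1 ∩ Y.1).card) (fun X => ?_) (fun X Y h => ?_)
    (fun X Z Y h => ?_) (fun X Y h => ?_) X Y
  · simp [X.2]
  · have h1 : X.1 ∩ Y.1 = X.1 :=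
      Finset.eq_of_subset_of_card_le Finset.inter_subset_left (by rw [X.2]; omega)
    have h2 : X.1 ∩ Y.1 = Y.1 :=
      Finset.eq_of_subset_of_card_le Finset.inter_subset_right (by rw [Y.2]; omega)
    exact Subtype.ext (h1.symm.trans h2)
  · have h : (X.1 ∩ Z.1).card + 1 = k := h
    have h1 := Finset.card_union_add_card_inter (X.1 ∩ Z.1) (Z.1 ∩ Y.1)
    have h2 : (X.1 ∩ Z.1 ∪ Z.1 ∩ Y.1).card ≤ Z.1.card := Finset.card_le_card
      (Finset.union_subset Finset.inter_subset_right Finset.inter_subset_left)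
    have h3 : ((X.1 ∩ Z.1) ∩ (Z.1 ∩ Y.1)).card ≤ (X.1 ∩ Y.1).card := Finset.card_le_card
      (Finset.inter_subset_inter Finset.inter_subset_left Finset.inter_subset_right)
    rw [Z.2] at h2
    omega
  · obtain ⟨a, ha⟩ : (X.1 \ Y.1).Nonempty := by
      rw [Finset.sdiff_nonempty]
      intro h1
      rw [Finset.inter_eq_left.mpr h1, X.2] at h
      omega
    obtain ⟨b, hb⟩ : (Y.1 \ X.1).Nonempty := by
      rw [Finset.sdiff_nonempty]
      intro h1
      rw [Finset.inter_eq_right.mpr h1, Y.2] at h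
      omega
    rw [Finset.mem_sdiff] at ha hb
    have hcard := Finset.card_erase_add_one ha.1
    have hX := X.2
    have hb' : b ∉ X.1.erase a := by simp [hb.2]
    refine ⟨⟨insert b (X.1.erase a), ?_⟩, ?_, ?_⟩
    · rw [Finset.card_insert_of_notMem hb']
      omega
    · change (X.1 ∩ insert b (X.1.erase a)).card + 1 = k
      have : X.1 ∩ insert b (X.1.erase a) = X.1.erase a := by
        ext x
        have : x = b → x ∉ X.1 := fun h => h ▸ hb.2
        simp only [Finset.mem_inter, Finset.mem_insert, Finset.mem_erase]
        tauto
      rw [this]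
      omega
    · have : insert b (X.1.erase a) ∩ Y.1 = insert b (X.1 ∩ Y.1) := by
        ext x
        have h1 : x = b → x ∈ Y.1 := fun h => h ▸ hb.1
        have h2 : x = a → x ∉ Y.1 := fun h => h ▸ ha.2
        simp only [Finset.mem_inter, Finset.mem_insert, Finset.mem_erase]
        tauto
      simp only [this]
      rw [Finset.card_insert_of_notMem (by simp [hb.2])]
      have := hle X Y
      omega

variable {R V : Type*} [DivisionRing R] [AddCommGroup V] [Module R V] [FiniteDimensional R V]

lemma finrank_sup_span_singleton {H : Submodule R V} {v : V} (hv : v ∉ H) :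
    finrank R (H ⊔ span R {v} : Submodule R V) = finrank R H + 1 := by
  have h1 := Submodule.finrank_sup_add_finrank_inf_eq H (span R {v})
  have hv0 : v ≠ 0 := fun h => hv (h ▸ zero_mem _)
  have h2 : H ⊓ span R {v} = ⊥ := by
    rw [← disjoint_iff, disjoint_span_singleton' hv0]
    exact hv
  rw [h2, finrank_bot, finrank_span_singleton hv0] at h1
  omega

lemma exists_hyperplane {A P : Submodule R V} (h : A < P) :
    ∃ H, A ≤ H ∧ H ≤ P ∧ finrank R H + 1 = finrank R P := by
  obtain ⟨H, hAH, hHP⟩ := exists_le_covBy_of_lt h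
  obtain ⟨x, hxP, hxH⟩ := SetLike.exists_of_lt hHP.lt
  have h1 : H ⊔ span R {x} = P := by
    refine (hHP.eq_or_eq le_sup_left (sup_le hHP.le ?_)).resolve_left fun h2 => hxH ?_
    · rwa [span_singleton_le_iff_mem]
    · rw [← h2]
      exact mem_sup_right (mem_span_singleton_self x)
  exact ⟨H, hAH, hHP.le, by rw [← finrank_sup_span_singleton hxH, h1]⟩

lemma finrank_inf_le_of_adj {m : ℕ} {P Z Q : Submodule R V} (hZ : finrank R Z = m)
    (h : finrank R (P ⊓ Z : Submodule R V) + 1 = m) :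
    finrank R (Z ⊓ Q : Submodule R V) ≤ finrank R (P ⊓ Q : Submodule R V) + 1 := by
  have h1 := Submodule.finrank_sup_add_finrank_inf_eq (P ⊓ Z) (Z ⊓ Q)
  have h2 := Submodule.finrank_mono (sup_le inf_le_right inf_le_left : P ⊓ Z ⊔ Z ⊓ Q ≤ Z)
  have h3 := Submodule.finrank_mono (inf_le_inf inf_le_left inf_le_right :
    P ⊓ Z ⊓ (Z ⊓ Q) ≤ P ⊓ Q)
  omega

/-- A hyperplane of `P` containing `P ⊓ Q` is kept, and a vector of `Q` outside `P` is added to it.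
-/
lemma exists_adj_closer {m : ℕ} {P Q : Submodule R V} (hP : finrank R P = m)
    (hQ : finrank R Q = m) (h : finrank R (P ⊓ Q : Submodule R V) ≠ m) :
    ∃ Z : Submodule R V, finrank R Z = m ∧ finrank R (P ⊓ Z : Submodule R V) + 1 = m ∧
      finrank R (P ⊓ Q : Submodule R V) + 1 ≤ finrank R (Z ⊓ Q : Submodule R V) := by
  have hlt : P ⊓ Q < P := lt_of_le_of_ne inf_le_left fun h1 => h (by rw [h1, hP])
  obtain ⟨v, hvQ, hvP⟩ : ∃ v ∈ Q, v ∉ P := by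
    by_contra! h1
    have h1' : Q ≤ P := h1
    exact h (by rw [inf_eq_right.mpr h1', hQ])
  obtain ⟨H, hAH, hHP, hH⟩ := exists_hyperplane hlt
  have hvH : v ∉ H := fun h1 => hvP (hHP h1)
  have hvm : v ∈ H ⊔ span R {v} := mem_sup_right (mem_span_singleton_self v)
  have hZ : finrank R (H ⊔ span R {v} : Submodule R V) = m := by
    rw [finrank_sup_span_singleton hvH, hH, hP]
  refine ⟨H ⊔ span R {v}, hZ, ?_, ?_⟩
  · have h1 := Submodule.finrank_mono (le_inf hHP le_sup_left : H ≤ P ⊓ (H ⊔ span R {v}))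
    have h2 : P ⊓ (H ⊔ span R {v}) < H ⊔ span R {v} :=
      lt_of_le_of_ne inf_le_right fun h2 => hvP (inf_eq_right.mp h2 hvm)
    have h3 := Submodule.finrank_lt_finrank_of_lt h2
    omega
  · have h1 : (P ⊓ Q) ⊔ span R {v} ≤ (H ⊔ span R {v}) ⊓ Q :=
      sup_le (le_inf (hAH.trans le_sup_left) inf_le_right)
        (le_inf le_sup_right (by rwa [span_singleton_le_iff_mem]))
    have h2 := Submodule.finrank_mono h1
    rwa [finrank_sup_span_singleton fun h3 : v ∈ P ⊓ Q => hvP h3.1] at h2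

lemma grassmannGraph_dist {m : ℕ} (P Q : Gr R V m) :
    (grassmannGraph R V m).dist P Q = m - finrank R (P.1 ⊓ Q.1 : Submodule R V) := by
  have hle : ∀ P Q : Gr R V m, finrank R (P.1 ⊓ Q.1 : Submodule R V) ≤ m := fun P Q =>
    (Submodule.finrank_mono inf_le_left).trans P.2.le
  refine dist_eq_of_step (fun P Q => m - finrank R (P.1 ⊓ Q.1 : Submodule R V)) (fun P => ?_)
    (fun P Q h => ?_) (fun P Z Q h => ?_) (fun P Q h => ?_) P Q
  · change m - finrank R (P.1 ⊓ P.1 : Submodule R V) = 0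
    rw [inf_idem, P.2, Nat.sub_self]
  · have h0 : m ≤ finrank R (P.1 ⊓ Q.1 : Submodule R V) := Nat.sub_eq_zero_iff_le.mp h
    have h1 : P.1 ⊓ Q.1 = P.1 := Submodule.eq_of_le_of_finrank_le inf_le_left (P.2.le.trans h0)
    have h2 : P.1 ⊓ Q.1 = Q.1 := Submodule.eq_of_le_of_finrank_le inf_le_right (Q.2.le.trans h0)
    exact Subtype.ext (h1.symm.trans h2)
  · have := finrank_inf_le_of_adj (Q := Q.1) Z.2 h
    omega
  · have h0 : finrank R (P.1 ⊓ Q.1 : Submodule R V) ≠ m := fun h1 => h (by simp [h1])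
    obtain ⟨Z, hZ, h1, h2⟩ := exists_adj_closer P.2 Q.2 h0
    refine ⟨⟨Z, hZ⟩, h1, ?_⟩
    have h3 : finrank R (Z ⊓ Q.1 : Submodule R V) ≤ m := hle ⟨Z, hZ⟩ Q
    change m - finrank R (Z ⊓ Q.1 : Submodule R V) + 1 ≤ m - finrank R (P.1 ⊓ Q.1 : Submodule R V)
    have h4 := hle P Q
    omega

end Distance

/-! ### Translation of graph conditions into rank conditions -/

section Parsing

variable {R V R' V' : Type*} [DivisionRing R] [AddCommGroup V] [Module R V]
  [FiniteDimensional R V] [DivisionRing R'] [AddCommGroup V'] [Module R' V']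
  [FiniteDimensional R' V']

omit [FiniteDimensional R V] in
lemma finrank_subspan {ι : Type*} {v : ι → V} (hv : LinearIndependent R v) (I : Finset ι) :
    finrank R (subspan R v I) = I.card := by
  classical
  rw [subspan, ← Finset.coe_image, finrank_span_finset_eq_card,
    Finset.card_image_of_injective _ hv.injective]
  rw [Finset.coe_image]
  exact (hv.linearIndepOn_id).mono (Set.image_subset_range _ _)

open Classical in
/-- The extension of a map of `k`-dimensional subspaces to all subspaces. -/
noncomputable def extend {k k' : ℕ} (f : Gr R V k → Gr R' V' k') (P : Submodule R V) :
    Submodule R' V' :=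
  if h : finrank R P = k then (f ⟨P, h⟩).1 else ⊥

omit [FiniteDimensional R V] [FiniteDimensional R' V'] in
lemma extend_apply {k k' : ℕ} (f : Gr R V k → Gr R' V' k') (P : Gr R V k) :
    extend f P.1 = (f P).1 := by
  rw [extend, dif_pos P.2]

/-- Preservation of distance alone suffices: in both graphs the distance is the defect of the
intersection. The value `⊥` off the `k`-sets plays no role. -/
lemma exists_rankIsometry {n k m : ℕ} {J : Set (Gr R' V' m)} (hJ : IsJohnsonSubset n k J) :
    ∃ e : Finset (Fin n) → Submodule R' V',
      IsRankIsometry (fun P : Submodule R' V' => finrank R' P) k m e ∧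
      (∀ P ∈ J, ∃ I, I.card = k ∧ P.1 = e I) ∧ ∀ I, I.card = k → ∃ P ∈ J, P.1 = e I := by
  classical
  obtain ⟨e, ⟨-, -, hd⟩, rfl⟩ := hJ
  set E : Finset (Fin n) → Submodule R' V' := fun I =>
    if h : I.card = k then (e ⟨I, h⟩).1 else ⊥ with hE
  have hEe : ∀ I (hI : I.card = k), E I = (e ⟨I, hI⟩).1 := fun I hI => by simp [hE, hI]
  refine ⟨E, fun I J hI hJ => ?_, ?_, ?_⟩
  · have h1 := hd ⟨I, hI⟩ ⟨J, hJ⟩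
    rw [johnsonGraph_dist, grassmannGraph_dist] at h1
    have h2 : (I ∩ J).card ≤ I.card := Finset.card_le_card Finset.inter_subset_left
    have h3 : finrank R' ((e ⟨I, hI⟩).1 ⊓ (e ⟨J, hJ⟩).1 : Submodule R' V') ≤ m :=
      (Submodule.finrank_mono inf_le_left).trans (e ⟨I, hI⟩).2.le
    change finrank R' (E I ⊓ E J : Submodule R' V') + k = m + (I ∩ J).card
    simp only at h1
    rw [hEe I hI, hEe J hJ]
    omega
  · rintro _ ⟨X, rfl⟩
    exact ⟨X.1, X.2, (hEe X.1 X.2).symm⟩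
  · intro I hI
    exact ⟨_, ⟨⟨I, hI⟩, rfl⟩, (hEe I hI).symm⟩

omit [FiniteDimensional R V] in
lemma mem_apartment_iff {ι : Type*} [Fintype ι] {k : ℕ} (b : Basis ι R V) (P : Gr R V k) :
    P ∈ apartment b k ↔ ∃ I : Finset ι, I.card = k ∧ P.1 = subspan R b I := by
  classical
  constructor
  · rintro ⟨I, hI⟩
    refine ⟨I.toFinset, ?_, by simpa [subspan] using hI⟩
    rw [← finrank_subspan b.linearIndependent, ← P.2, hI, subspan, Set.coe_toFinset]
  · rintro ⟨I, -, hI⟩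
    exact ⟨I, hI⟩

lemma IsJMapping.mapsToJohnson {n k k' : ℕ} (hn : finrank R V = n) {f : Gr R V k → Gr R' V' k'}
    (hf : IsJMapping f) :
    MapsToJohnson (Fin n) (fun P : Submodule R' V' => finrank R' P) k k' (extend f) := by
  subst hn
  intro v hv
  set b := Basis.mk hv (hv.span_eq_top_of_card_eq_finrank' (by simp)).ge with hb
  have hbv : (b : Fin (finrank R V) → V) = v := Basis.coe_mk _ _
  obtain ⟨e, he, h1, h2⟩ := exists_rankIsometry (hf _ ⟨b, rfl⟩)
  refine ⟨e, he, fun I hI => ?_, fun I hI => ?_⟩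
  · have hP : finrank R (subspan R v I) = k := by rw [finrank_subspan hv, hI]
    have hm : (⟨subspan R v I, hP⟩ : Gr R V k) ∈ apartment b k := by
      rw [mem_apartment_iff]
      exact ⟨I, hI, by rw [hbv]⟩
    obtain ⟨I', hI', h⟩ := h1 _ ⟨_, hm, rfl⟩
    exact ⟨I', hI', by rw [← h, ← extend_apply]⟩
  · obtain ⟨_, ⟨P, hP, rfl⟩, h⟩ := h2 I hI
    rw [mem_apartment_iff] at hP
    obtain ⟨I', hI', hP⟩ := hP
    exact ⟨I', hI', by rw [← h, ← extend_apply, hP, hbv]⟩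

end Parsing

open Module Submodule

/-! ### Intervals of subspaces and quotients -/

section Interval

variable {K W : Type*} [DivisionRing K] [AddCommGroup W] [Module K W]

/-- For `S ≤ X ≤ U`, the subspace `X / S` of `U / S`. -/
def pull (S U X : Submodule K W) : Submodule K (U ⧸ S.submoduleOf U) :=
  (X.submoduleOf U).map (S.submoduleOf U).mkQ

variable {S U X Y : Submodule K W}

lemma phi_pull (hS : S ≤ X) (hU : X ≤ U) : phi S U (pull S U X) = X := by
  have h : S.submoduleOf U ≤ X.submoduleOf U := Submodule.comap_mono hS
  rw [phi, pull, comap_map_mkQ, sup_eq_right.mpr h, submoduleOf, map_comap_subtype,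
    inf_eq_right.mpr hU]

lemma pull_sup (hX : X ≤ U) (hY : Y ≤ U) : pull S U (X ⊔ Y) = pull S U X ⊔ pull S U Y := by
  rw [pull, submoduleOf_sup_of_le hX hY, Submodule.map_sup]
  rfl

lemma finrank_submoduleOf (hX : X ≤ U) : finrank K (X.submoduleOf U) = finrank K X :=
  (submoduleOfEquivOfLe hX).finrank_eq

lemma finrank_pull [FiniteDimensional K W] (hS : S ≤ X) (hU : X ≤ U) :
    finrank K (pull S U X) + finrank K S = finrank K X := by
  have h := LinearMap.finrank_range_add_finrank_ker
    ((S.submoduleOf U).mkQ.domRestrict (X.submoduleOf U))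
  rw [LinearMap.range_domRestrict, LinearMap.ker_domRestrict, ker_mkQ, finrank_submoduleOf hU]
    at h
  have h1 : finrank K ((S.submoduleOf U).submoduleOf (X.submoduleOf U)) = finrank K S :=
    (finrank_submoduleOf (Submodule.comap_mono hS)).trans (finrank_submoduleOf (hS.trans hU))
  rw [← h1]
  exact h

variable {α : Type*} [DecidableEq α] [Fintype α] {s : ℕ} {F : Finset α → Submodule K W}

lemma IsFrame.pull [FiniteDimensional K W]
    (hF : IsFrame (fun P : Submodule K W => finrank K P) s F) :
    IsFrame (fun P : Submodule K (F Finset.univ ⧸ (F ∅).submoduleOf (F Finset.univ)) =>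
      finrank K P) 0 (fun I => pull (F ∅) (F Finset.univ) (F I)) where
  sup I J := by
    rw [hF.sup, pull_sup (hF.mono (Finset.subset_univ _)) (hF.mono (Finset.subset_univ _))]
  rank I := by
    have h := finrank_pull (hF.mono (Finset.empty_subset I)) (hF.mono (Finset.subset_univ I))
    have h0 := hF.rank ∅
    have hI := hF.rank I
    simp only [Finset.card_empty] at h0 hI ⊢
    omega

variable {R V : Type*} [DivisionRing R] [AddCommGroup V] [Module R V] [FiniteDimensional R V]

/-- All frames provided by `MapsToJohnson.exists_frame` have the same bounds, so `f` takes its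
values on `k`-dimensional subspaces in one interval. In the quotient the frames have bottom rank
`0`, their atoms are points, and `phi` undoes `pull` on the interval. -/
theorem MapsToJohnson.exists_semilinearEmbedding [FiniteDimensional K W] {k : ℕ}
    {f : Submodule R V → Submodule K W}
    (hf : MapsToJohnson (R := R) (V := V) α (fun P : Submodule K W => finrank K P) k (s + k) f)
    (hcard : Fintype.card α = finrank R V) (hk : 2 ≤ k) (hkn : k + 2 ≤ Fintype.card α)
    (hne : Fintype.card α ≠ 2 * k) {v : α → V} (hv : LinearIndependent R v)
    (hF : IsFrame (fun P : Submodule K W => finrank K P) s F)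
    (hs : SameImage k (fun I => f (subspan R v I)) F) :
    ∃ S U : Submodule K W, S ≤ U ∧ finrank K S = s ∧ finrank K U = s + Fintype.card α ∧
      ∃ (σ : R →+* K) (l : V →ₛₗ[σ] (U ⧸ S.submoduleOf U)), IsSemilinearEmbedding l ∧
        ∀ P : Submodule R V, finrank R P = k → f P = phi S U (spanImage l P) := by
  have hr := isRank_finrank K W
  have h0 := hF.rank ∅
  refine ⟨F ∅, F Finset.univ, hF.mono (Finset.empty_subset _), by simpa using h0,
    hF.rank Finset.univ, ?_⟩
  have key : ∀ w : α → V, LinearIndependent R w → ∃ F', IsFrame (fun P : Submodule K W =>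
      finrank K P) s F' ∧ F' ∅ = F ∅ ∧ F' Finset.univ = F Finset.univ ∧
      ∀ I, I.card = k → f (subspan R w I) = F' I := fun w hw =>
    hf.exists_frame hr hcard hk hkn hne hv hF hs hw
  obtain ⟨σ, l, hl, h⟩ := StrongJ.exists_semilinearEmbedding (ι := α) hcard hk hkn
    (f := fun P => StrongJ.pull (F ∅) (F Finset.univ) (f P)) fun w hw => by
      obtain ⟨F', hF', h0, hu, h⟩ := key w hw
      refine ⟨fun I => StrongJ.pull (F ∅) (F Finset.univ) (F' I), ?_, fun I hI => by
        simp only [h I hI]⟩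
      rw [← h0, ← hu]
      exact hF'.pull
  refine ⟨σ, l, hl, fun P hP => ?_⟩
  rw [← h P hP]
  obtain ⟨w, hw, I, hI, rfl⟩ := exists_eq_subspan hcard P
  obtain ⟨F', hF', h0, hu, h'⟩ := key w hw
  rw [h' I (hI.trans hP), ← h0, ← hu]
  exact (phi_pull (hF'.mono (Finset.empty_subset _)) (hF'.mono (Finset.subset_univ _))).symm

end Interval

open Module Submodule

/-! ### Johnson graphs inside frames: diameter and number of vertices -/

section Count

variable {α β : Type*} [Fintype α] [DecidableEq α] [Fintype β] [DecidableEq β]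

/-- Two `k`-sets as far apart as possible: `min k (n - k)` is the diameter of the Johnson graph. -/
lemma exists_card_inter_add {k : ℕ} (hk : k ≤ Fintype.card α) :
    ∃ I J : Finset α, I.card = k ∧ J.card = k ∧
      (I ∩ J).card + min k (Fintype.card α - k) = k := by
  obtain ⟨I, -, hI⟩ := Finset.exists_subset_card_eq (s := (Finset.univ : Finset α)) hk
  obtain ⟨B, hB, hBc⟩ := Finset.exists_subset_card_eq (s := I)
    (n := k - min k (Fintype.card α - k)) (by omega)
  obtain ⟨C, hC, hCc⟩ := Finset.exists_subset_card_eq (s := Iᶜ)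
    (n := min k (Fintype.card α - k)) (by rw [Finset.card_compl]; omega)
  have hCI : Disjoint I C := disjoint_compl_right.mono_right hC
  refine ⟨I, B ∪ C, hI, ?_, ?_⟩
  · rw [Finset.card_union_of_disjoint (hCI.mono_left hB)]
    omega
  · rw [Finset.inter_union_distrib_left, Finset.inter_eq_right.mpr hB,
      Finset.disjoint_iff_inter_eq_empty.mp hCI, Finset.union_empty]
    omega

lemma min_card_le_of_correspondence {k j : ℕ} (hk : k ≤ Fintype.card α)
    (h : ∀ I J : Finset α, I.card = k → J.card = k → ∃ I' J' : Finset β, I'.card = j ∧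
      J'.card = j ∧ (I' ∩ J').card + k = j + (I ∩ J).card) :
    min k (Fintype.card α - k) ≤ min j (Fintype.card β - j) := by
  obtain ⟨I, J, hI, hJ, hIJ⟩ := exists_card_inter_add hk
  obtain ⟨I', J', hI', hJ', h'⟩ := h I J hI hJ
  have h1 := Finset.card_union_add_card_inter I' J'
  have h2 := (I' ∪ J').card_le_univ
  omega

lemma choose_lt_choose_left {a b t : ℕ} (h : a < b) (ht : 0 < t) (hta : t ≤ a) :
    a.choose t < b.choose t := by
  obtain ⟨t, rfl⟩ := Nat.exists_eq_add_one_of_ne_zero ht.ne'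
  have h1 : (a + 1).choose (t + 1) ≤ b.choose (t + 1) := Nat.choose_le_choose _ h
  have h2 : 0 < a.choose t := Nat.choose_pos (by omega)
  rw [Nat.choose_succ_succ'] at h1
  omega

lemma eq_of_choose_eq {a b t : ℕ} (ht : 0 < t) (hta : t ≤ a) (htb : t ≤ b)
    (h : a.choose t = b.choose t) : a = b := by
  rcases lt_trichotomy a b with h1 | h1 | h1
  · exact absurd h (choose_lt_choose_left h1 ht hta).ne
  · exact h1
  · exact absurd h (choose_lt_choose_left h1 ht htb).ne'

lemma choose_min {a k : ℕ} (h : k ≤ a) : a.choose (min k (a - k)) = a.choose k := by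
  rcases min_choice k (a - k) with h1 | h1 <;> rw [h1]
  exact Nat.choose_symm h

/-- A Johnson graph is determined by any of its isometric images in an apartment of a parabolic
subspace. -/
theorem IsRankIsometry.card_eq_of_frame {L : Type*} [Lattice L] {r : L → ℕ} (hr : IsRank r)
    {k j s : ℕ} {e : Finset α → L} (he : IsRankIsometry r k (s + j) e) {F : Finset β → L}
    (hF : IsFrame r s F) (hk : 0 < k) (hkα : k < Fintype.card α)
    (hjβ : j < Fintype.card β)
    (h₁ : ∀ I, I.card = k → ∃ I', I'.card = j ∧ e I = F I')
    (h₂ : ∀ I', I'.card = j → ∃ I, I.card = k ∧ e I = F I') :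
    Fintype.card β = Fintype.card α ∧ (j = k ∨ j + k = Fintype.card α) := by
  classical
  have hcor : ∀ I J I' J', I.card = k → J.card = k → e I = F I' → e J = F J' →
      (I' ∩ J').card + k = j + (I ∩ J).card := by
    intro I J I' J' hI hJ h h'
    have h1 := he I J hI hJ
    rw [h, h', hF.inf hr, hF.rank] at h1
    omega
  -- The correspondence preserves the defects of intersections, so the two diameters agree.
  have hm₁ : min k (Fintype.card α - k) ≤ min j (Fintype.card β - j) :=
    min_card_le_of_correspondence hkα.le fun I J hI hJ => by
      obtain ⟨I', hI', h⟩ := h₁ I hI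
      obtain ⟨J', hJ', h'⟩ := h₁ J hJ
      exact ⟨I', J', hI', hJ', hcor I J I' J' hI hJ h h'⟩
  have hm₂ : min j (Fintype.card β - j) ≤ min k (Fintype.card α - k) :=
    min_card_le_of_correspondence hjβ.le fun I' J' hI' hJ' => by
      obtain ⟨I, hI, h⟩ := h₂ I' hI'
      obtain ⟨J, hJ, h'⟩ := h₂ J' hJ'
      exact ⟨I, J, hI, hJ, by rw [add_comm, add_comm k, hcor I J I' J' hI hJ h h', add_comm]⟩
  have himg : (Finset.powersetCard k Finset.univ).image e =
      (Finset.powersetCard j Finset.univ).image F := by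
    ext x
    simp only [Finset.mem_image, Finset.mem_powersetCard_univ]
    constructor
    · rintro ⟨I, hI, rfl⟩
      obtain ⟨I', hI', h⟩ := h₁ I hI
      exact ⟨I', hI', h.symm⟩
    · rintro ⟨I', hI', rfl⟩
      exact h₂ I' hI'
  -- Both vertex numbers are binomial coefficients with the common diameter `t` as lower entry. They
  -- are strictly increasing in the upper entry, so the ground sets have the same size, and equal
  -- diameters leave two values of `j`.
  have hcard := congrArg Finset.card himg
  rw [Finset.card_image_of_injective _ hF.injective, Finset.card_image_of_injOn,
    Finset.card_powersetCard, Finset.card_powersetCard, Finset.card_univ, Finset.card_univ,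
    ← choose_min hkα.le, ← choose_min hjβ.le, le_antisymm hm₂ hm₁] at hcard
  · have := eq_of_choose_eq (by omega) (by omega) (by omega) hcard
    omega
  · intro I hI J hJ h
    rw [Finset.mem_coe, Finset.mem_powersetCard_univ] at hI hJ
    have h1 := he I J hI hJ
    rw [h, inf_idem, he.rank hJ] at h1
    have h2 : I ∩ J = I := Finset.eq_of_subset_of_card_le Finset.inter_subset_left (by omega)
    have h3 : I ∩ J = J := Finset.eq_of_subset_of_card_le Finset.inter_subset_right (by omega)
    exact h2.symm.trans h3

end Count

/-! ### Apartments of parabolic subspaces as frames -/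

section Apartment

variable {R V : Type*} [DivisionRing R] [AddCommGroup V] [Module R V]

lemma subspan_union {ι : Type*} [DecidableEq ι] (v : ι → V) (I J : Finset ι) :
    subspan R v (I ∪ J) = subspan R v I ⊔ subspan R v J := by
  rw [subspan, Finset.coe_union, Set.image_union, span_union]
  rfl

lemma isFrame_subspan {ι : Type*} [DecidableEq ι] {v : ι → V} (hv : LinearIndependent R v) :
    IsFrame (fun P : Submodule R V => finrank R P) 0 (subspan R v) where
  sup := subspan_union v
  rank I := by
    simp only [finrank_subspan hv, zero_add]

/-- If `S` and `U` are spanned by the index sets `A ⊆ B`, the members between them correspond to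
subsets of `B \ A`, which is enumerated by `ε`. -/
lemma IsApartmentInParabolic.exists_frame {k : ℕ} {S U : Submodule R V} {A : Set (Gr R V k)}
    (h : IsApartmentInParabolic k S U A) :
    ∃ (d : ℕ) (F : Finset (Fin d) → Submodule R V),
      IsFrame (fun P : Submodule R V => finrank R P) (finrank R S) F ∧
      finrank R S < k ∧ k < finrank R S + d ∧
      (∀ P ∈ A, ∃ I, finrank R S + I.card = k ∧ P.1 = F I) ∧
      ∀ I, finrank R S + I.card = k → ∃ P ∈ A, P.1 = F I := by
  classical
  obtain ⟨hSU, hSk, hkU, b, ⟨IS, hIS⟩, ⟨IU, hIU⟩, rfl⟩ := h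
  have hG := isFrame_subspan b.linearIndependent
  rw [← Set.coe_toFinset IS] at hIS
  rw [← Set.coe_toFinset IU] at hIU
  change S = subspan R b IS.toFinset at hIS
  change U = subspan R b IU.toFinset at hIU
  set A := IS.toFinset
  set B := IU.toFinset
  have hAB : A ⊆ B := by rwa [← hG.le_iff, ← hIS, ← hIU]
  have hS : finrank R S = A.card := by rw [hIS, finrank_subspan b.linearIndependent]
  have hU : finrank R U = B.card := by rw [hIU, finrank_subspan b.linearIndependent]
  have hd : (B \ A).card + A.card = B.card := Finset.card_sdiff_add_card_eq_card hAB
  set ε := ((B \ A).orderEmbOfFin rfl).toEmbedding with hε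
  have hεmem : ∀ i, ε i ∈ B \ A := fun i => Finset.orderEmbOfFin_mem _ _ i
  have hdisj : ∀ I : Finset (Fin (B \ A).card), Disjoint A (I.map ε) := by
    intro I
    rw [Finset.disjoint_left]
    intro x hx hx'
    obtain ⟨i, -, rfl⟩ := Finset.mem_map.mp hx'
    exact (Finset.mem_sdiff.mp (hεmem i)).2 hx
  have hsub : ∀ I : Finset (Fin (B \ A).card), A ∪ I.map ε ⊆ B := by
    intro I
    refine Finset.union_subset hAB fun x hx => ?_
    obtain ⟨i, -, rfl⟩ := Finset.mem_map.mp hx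
    exact (Finset.mem_sdiff.mp (hεmem i)).1
  have hcard : ∀ I : Finset (Fin (B \ A).card), (A ∪ I.map ε).card = A.card + I.card := by
    intro I
    rw [Finset.card_union_of_disjoint (hdisj I), Finset.card_map]
  refine ⟨(B \ A).card, fun I => subspan R b (A ∪ I.map ε), ⟨fun I J => ?_, fun I => ?_⟩, hSk,
    by omega, ?_, ?_⟩
  · rw [← subspan_union, Finset.map_union]
    congr 1
    ext x
    simp only [Finset.mem_union]
    tauto
  · simp only [finrank_subspan b.linearIndependent, hcard, hS]
  · rintro P ⟨hP, hSP, hPU⟩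
    obtain ⟨X, hX, hPX⟩ := (mem_apartment_iff b P).mp hP
    rw [hPX, hIS, hG.le_iff] at hSP
    rw [hPX, hIU, hG.le_iff] at hPU
    have hXI : A ∪ (Finset.univ.filter fun i => ε i ∈ X).map ε = X := by
      ext x
      simp only [Finset.mem_union, Finset.mem_map, Finset.mem_filter, Finset.mem_univ, true_and]
      constructor
      · rintro (h | ⟨i, hi, rfl⟩)
        · exact hSP h
        · exact hi
      · intro hx
        by_cases hxA : x ∈ A
        · exact Or.inl hxA
        · have : x ∈ Set.range ((B \ A).orderEmbOfFin rfl) := by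
            rw [Finset.range_orderEmbOfFin]
            exact Finset.mem_coe.mpr (Finset.mem_sdiff.mpr ⟨hPU hx, hxA⟩)
          obtain ⟨i, rfl⟩ := this
          exact Or.inr ⟨i, hx, rfl⟩
    refine ⟨Finset.univ.filter fun i => ε i ∈ X, ?_, by simp only [hXI, hPX]⟩
    rw [hS, ← hcard, hXI, hX]
  · intro I hI
    have hP : finrank R (subspan R b (A ∪ I.map ε)) = k := by
      rw [finrank_subspan b.linearIndependent, hcard, ← hS, hI]
    refine ⟨⟨_, hP⟩, ⟨(mem_apartment_iff b _).mpr ⟨A ∪ I.map ε, ?_, rfl⟩, ?_, ?_⟩, rfl⟩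
    · rw [hcard, ← hS, hI]
    · rw [hIS, hG.le_iff]
      exact Finset.subset_union_left
    · rw [hIU, hG.le_iff]
      exact hsub I

end Apartment

open Module Submodule

/-! ### Annihilators and the dual space -/

section Duality

variable {R V : Type*} [DivisionRing R] [AddCommGroup V] [Module R V]

lemma DualSpace.smul_apply (c : Rᵐᵒᵖ) (φ : DualSpace R V) (x : V) :
    (c • φ) x = φ x * c.unop := rfl

lemma DualSpace.add_apply (φ ψ : DualSpace R V) (x : V) : (φ + ψ) x = φ x + ψ x := rfl

lemma DualSpace.sum_apply {ι : Type*} (s : Finset ι) (φ : ι → DualSpace R V) (x : V) :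
    (∑ i ∈ s, φ i) x = ∑ i ∈ s, φ i x :=
  LinearMap.sum_apply (R := R) (R₂ := R) (σ₁₂ := RingHom.id R) (M := V) (M₂ := R) s φ x

/-- The annihilator in the dual space of a subspace. -/
def perp (X : Submodule R V) : Submodule Rᵐᵒᵖ (DualSpace R V) where
  carrier := {φ | ∀ x ∈ X, φ x = 0}
  zero_mem' := fun _ _ => rfl
  add_mem' := fun hφ hψ x hx => by rw [DualSpace.add_apply, hφ x hx, hψ x hx, add_zero]
  smul_mem' := fun c φ hφ x hx => by rw [DualSpace.smul_apply, hφ x hx, zero_mul]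

lemma le_annih_iff {X : Submodule R V} {T : Submodule Rᵐᵒᵖ (DualSpace R V)} :
    X ≤ annih T ↔ T ≤ perp X :=
  ⟨fun h _ hφ _ hx => h hx _ hφ, fun h _ hx _ hφ => h hφ _ hx⟩

lemma perp_anti {X Y : Submodule R V} (h : X ≤ Y) : perp Y ≤ perp X :=
  fun _ hφ x hx => hφ x (h hx)

lemma perp_sup (X Y : Submodule R V) : perp (X ⊔ Y) = perp X ⊓ perp Y := by
  refine le_antisymm (le_inf (perp_anti le_sup_left) (perp_anti le_sup_right)) ?_
  rw [← le_annih_iff]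
  exact sup_le (le_annih_iff.mpr inf_le_left) (le_annih_iff.mpr inf_le_right)

section Basis

variable {ι : Type*} (b : Basis ι R V)

/-- The coordinate forms of a basis. -/
noncomputable def DualSpace.coord (i : ι) : DualSpace R V := b.coord i

lemma DualSpace.coord_apply (i : ι) (x : V) : DualSpace.coord b i x = b.repr x i := rfl

variable [Fintype ι]

lemma DualSpace.eq_sum (φ : DualSpace R V) :
    φ = ∑ i, MulOpposite.op (φ (b i)) • DualSpace.coord b i := by
  refine DFunLike.ext _ _ fun x => ?_
  rw [DualSpace.sum_apply]
  conv_lhs => rw [← b.sum_repr x, map_sum]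
  exact Finset.sum_congr rfl fun i _ => by
    rw [map_smul, DualSpace.smul_apply]
    rfl

/-- The dual basis, as a basis of the left vector space `DualSpace R V`. -/
noncomputable def dualBasis : Basis ι Rᵐᵒᵖ (DualSpace R V) :=
  Basis.mk (v := fun i => DualSpace.coord b i)
    (by
      classical
      rw [Fintype.linearIndependent_iff]
      intro g hg j
      have h := DFunLike.congr_fun hg (b j)
      rw [DualSpace.sum_apply, Finset.sum_eq_single j] at h
      · rw [DualSpace.smul_apply, DualSpace.coord_apply, b.repr_self, Finsupp.single_eq_same,
          one_mul] at h
        exact MulOpposite.unop_injective h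
      · intro i _ hij
        rw [DualSpace.smul_apply, DualSpace.coord_apply, b.repr_self,
          Finsupp.single_eq_of_ne hij, zero_mul]
      · simp)
    (fun φ _ => by
      rw [DualSpace.eq_sum b φ]
      exact sum_mem fun i _ => smul_mem _ _ (subset_span ⟨i, rfl⟩))

lemma dualBasis_apply (i : ι) (x : V) : dualBasis b i x = b.repr x i := by
  rw [dualBasis, Basis.mk_apply, DualSpace.coord_apply]

variable [DecidableEq ι]

lemma perp_subspan (I : Finset ι) : perp (subspan R b I) = subspan Rᵐᵒᵖ (dualBasis b) Iᶜ := by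
  refine le_antisymm (fun φ hφ => ?_) ?_
  · rw [DualSpace.eq_sum b φ]
    refine sum_mem fun i _ => ?_
    by_cases hi : i ∈ I
    · rw [hφ _ (mem_subspan hi), MulOpposite.op_zero, zero_smul]
      exact zero_mem _
    · refine smul_mem _ _ ?_
      have : dualBasis b i ∈ subspan Rᵐᵒᵖ (dualBasis b) Iᶜ :=
        mem_subspan (Finset.mem_compl.mpr hi)
      rwa [dualBasis, Basis.mk_apply] at this
  · rw [subspan_le_iff]
    intro i hi
    have hi := Finset.mem_compl.mp hi
    have h : subspan R b I ≤ LinearMap.ker (b.coord i) := subspan_le_iff.mpr fun j hj => by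
      rw [LinearMap.mem_ker, b.coord_apply, b.repr_self,
        Finsupp.single_eq_of_ne (ne_of_mem_of_not_mem hj hi).symm]
    intro x hx
    rw [dualBasis_apply]
    exact h hx

lemma annih_perp_subspan (I : Finset ι) : annih (perp (subspan R b I)) = subspan R b I := by
  refine le_antisymm (fun x hx => ?_) (le_annih_iff.mpr le_rfl)
  rw [← b.sum_repr x]
  refine sum_mem fun i _ => ?_
  by_cases hi : i ∈ I
  · exact smul_mem _ _ (mem_subspan hi)
  · rw [perp_subspan] at hx
    rw [← dualBasis_apply b, hx _ (mem_subspan (Finset.mem_compl.mpr hi)), zero_smul]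
    exact zero_mem _

end Basis

variable [FiniteDimensional R V]

instance : FiniteDimensional Rᵐᵒᵖ (DualSpace R V) :=
  Module.Finite.of_basis (dualBasis (Module.finBasis R V))

lemma exists_basis_eq_subspan (X : Submodule R V) :
    ∃ (b : Basis (Fin (finrank R V)) R V) (I : Finset (Fin (finrank R V))),
      X = subspan R b I := by
  obtain ⟨v, hv, I, -, h⟩ := exists_eq_subspan (ι := Fin (finrank R V)) (by simp) X
  refine ⟨Basis.mk hv (hv.span_eq_top_of_card_eq_finrank' (by simp)).ge, I, ?_⟩
  rw [Basis.coe_mk]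
  exact h

lemma annih_perp (X : Submodule R V) : annih (perp X) = X := by
  obtain ⟨b, I, rfl⟩ := exists_basis_eq_subspan X
  exact annih_perp_subspan b I

lemma finrank_perp (X : Submodule R V) : finrank Rᵐᵒᵖ (perp X) + finrank R X = finrank R V := by
  obtain ⟨b, I, rfl⟩ := exists_basis_eq_subspan X
  rw [perp_subspan, finrank_subspan b.linearIndependent,
    finrank_subspan (dualBasis b).linearIndependent, Finset.card_compl, Fintype.card_fin]
  have := I.card_le_univ
  rw [Fintype.card_fin] at this
  omega

/-- One inclusion is formal; dimensions make it an equality. -/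
lemma perp_inf (X Y : Submodule R V) : perp (X ⊓ Y) = perp X ⊔ perp Y := by
  refine (Submodule.eq_of_le_of_finrank_le
    (sup_le (perp_anti inf_le_left) (perp_anti inf_le_right)) ?_).symm
  have h1 := Submodule.finrank_sup_add_finrank_inf_eq X Y
  have h2 := Submodule.finrank_sup_add_finrank_inf_eq (perp X) (perp Y)
  rw [← perp_sup] at h2
  have h3 := finrank_perp X
  have h4 := finrank_perp Y
  have h5 := finrank_perp (X ⊔ Y)
  have h6 := finrank_perp (X ⊓ Y)
  omega

variable {α : Type*} [DecidableEq α]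

lemma IsRankIsometry.perp {k m : ℕ} {e : Finset α → Submodule R V}
    (he : IsRankIsometry (fun P : Submodule R V => finrank R P) k m e) :
    IsRankIsometry (fun P : Submodule Rᵐᵒᵖ (DualSpace R V) => finrank Rᵐᵒᵖ P) k
      (finrank R V - m) (fun I => perp (e I)) := by
  intro I J hI hJ
  have h1 : finrank R (e I ⊓ e J : Submodule R V) + k = m + (I ∩ J).card := he I J hI hJ
  have h2 : finrank R (e I) = m := he.rank hI
  have h3 : finrank R (e J) = m := he.rank hJ
  have h4 := Submodule.finrank_sup_add_finrank_inf_eq (e I) (e J)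
  have h5 := finrank_perp (e I ⊔ e J)
  have h6 := Submodule.finrank_le (e I)
  change finrank Rᵐᵒᵖ (StrongJ.perp (e I) ⊓ StrongJ.perp (e J) :
    Submodule Rᵐᵒᵖ (DualSpace R V)) + k = _
  rw [← perp_sup]
  have h7 : (I ∩ J).card ≤ k := hI ▸ Finset.card_le_card Finset.inter_subset_left
  omega

/-- Annihilators reverse the order, so index sets are complemented to keep joins as unions. For the
isometry above no complement is taken: its index sets keep their size `k`. -/
lemma IsFrame.perp [Fintype α] {s : ℕ} {F : Finset α → Submodule R V}
    (hF : IsFrame (fun P : Submodule R V => finrank R P) s F) :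
    IsFrame (fun P : Submodule Rᵐᵒᵖ (DualSpace R V) => finrank Rᵐᵒᵖ P)
      (finrank R V - s - Fintype.card α) (fun I => perp (F Iᶜ)) where
  sup I J := by
    rw [Finset.compl_union, ← hF.inf (isRank_finrank R V), perp_inf]
  rank I := by
    have h1 := finrank_perp (F Iᶜ)
    have h2 : finrank R (F Iᶜ) = s + Iᶜ.card := hF.rank Iᶜ
    have h3 : finrank R (F Finset.univ) = s + Finset.univ.card := hF.rank Finset.univ
    have h4 := Submodule.finrank_le (F Finset.univ)
    have h5 := I.card_le_univ
    rw [Finset.card_compl] at h2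
    rw [Finset.card_univ] at h3
    change finrank Rᵐᵒᵖ (StrongJ.perp (F Iᶜ)) = _
    omega

omit [FiniteDimensional R V] [DecidableEq α] in
lemma SameImage.perp {k : ℕ} {a b : Finset α → Submodule R V} (h : SameImage k a b) :
    SameImage k (fun I => perp (a I)) (fun I => perp (b I)) :=
  ⟨fun I hI => (h.1 I hI).imp fun _ h => ⟨h.1, by simp only [h.2]⟩,
    fun I hI => (h.2 I hI).imp fun _ h => ⟨h.1, by simp only [h.2]⟩⟩

lemma MapsToJohnson.perp {Q W : Type*} [DivisionRing Q] [AddCommGroup W] [Module Q W] {k m : ℕ}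
    {f : Submodule Q W → Submodule R V}
    (hf : MapsToJohnson (R := Q) (V := W) α (fun P : Submodule R V => finrank R P) k m f) :
    MapsToJohnson (R := Q) (V := W) α (fun P : Submodule Rᵐᵒᵖ (DualSpace R V) => finrank Rᵐᵒᵖ P)
      k (finrank R V - m) (fun P => perp (f P)) := by
  intro v hv
  obtain ⟨e, he, hs⟩ := hf v hv
  exact ⟨_, he.perp, hs.perp⟩

end Duality

open Module Submodule

/-! ### The distinguished apartment and the two cases -/

section Strong

variable {R V R' V' : Type*} [DivisionRing R] [AddCommGroup V] [Module R V]
  [FiniteDimensional R V] [DivisionRing R'] [AddCommGroup V'] [Module R' V']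
  [FiniteDimensional R' V']

omit [FiniteDimensional R V] in
/-- The apartment of a strong `J`-mapping whose image is an apartment in a parabolic subspace. -/
lemma IsStrongJMapping.exists_frame {n k k' : ℕ} (hn : finrank R V = n) (hk : 1 < k)
    (hkn : k + 1 < n) {f : Gr R V k → Gr R' V' k'} (hf : IsStrongJMapping f) :
    ∃ (s j : ℕ) (v : Fin n → V) (F : Finset (Fin n) → Submodule R' V'),
      k' = s + j ∧ (j = k ∨ j + k = n) ∧ LinearIndependent R v ∧
      IsFrame (fun P : Submodule R' V' => finrank R' P) s F ∧
      (∀ I, I.card = k → ∃ I', I'.card = j ∧ extend f (subspan R v I) = F I') ∧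
      ∀ I', I'.card = j → ∃ I, I.card = k ∧ extend f (subspan R v I) = F I' := by
  subst hn
  obtain ⟨hJ, _, ⟨b, rfl⟩, S, U, hA⟩ := hf
  obtain ⟨d, F, hF, hSk, hkU, h₁, h₂⟩ := hA.exists_frame
  obtain ⟨e, he, he₁, he₂⟩ := exists_rankIsometry (hJ _ ⟨b, rfl⟩)
  obtain ⟨j, rfl⟩ := Nat.exists_eq_add_of_le hSk.le
  -- The parabolic apartment, a priori with `d` indices and members of index size `j`, is compared
  -- with `J(n,k)`.
  have hcard := he.card_eq_of_frame (isRank_finrank R' V') hF (by omega)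
    (by rw [Fintype.card_fin]; omega) (by rw [Fintype.card_fin]; omega)
    (fun I hI => by
      obtain ⟨P, hP, h⟩ := he₂ I hI
      obtain ⟨I', hI', h'⟩ := h₁ P hP
      exact ⟨I', by omega, by rw [← h, h']⟩)
    (fun I' hI' => by
      obtain ⟨P, hP, h⟩ := h₂ I' (by omega)
      obtain ⟨I, hI, h'⟩ := he₁ P hP
      exact ⟨I, hI, by rw [← h, h']⟩)
  simp only [Fintype.card_fin] at hcard
  obtain ⟨rfl, hj⟩ := hcard
  refine ⟨finrank R' S, j, b, F, rfl, hj, b.linearIndependent, hF, fun I hI => ?_,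
    fun I' hI' => ?_⟩
  · have hP : finrank R (subspan R b I) = k := by rw [finrank_subspan b.linearIndependent, hI]
    obtain ⟨I', hI', h⟩ := h₁ _ ⟨⟨_, hP⟩, (mem_apartment_iff b _).mpr ⟨I, hI, rfl⟩, rfl⟩
    exact ⟨I', by omega, by rw [← h, ← extend_apply]⟩
  · obtain ⟨_, ⟨P, hP, rfl⟩, h⟩ := h₂ I' (by omega)
    obtain ⟨I, hI, hP⟩ := (mem_apartment_iff b P).mp hP
    exact ⟨I, hI, by rw [← h, ← extend_apply, hP]⟩

end Strong

end StrongJ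

theorem corollary2 {R V R' V' : Type*}
    [DivisionRing R] [AddCommGroup V] [Module R V] [FiniteDimensional R V]
    [DivisionRing R'] [AddCommGroup V'] [Module R' V'] [FiniteDimensional R' V']
    (n n' k k' : ℕ) (hn : Module.finrank R V = n) (hn' : Module.finrank R' V' = n')
    (hk : 1 < k) (hkn : k + 1 < n) (hn2k : n ≠ 2 * k)
    (f : StrongJ.Gr R V k → StrongJ.Gr R' V' k') (hf : StrongJ.IsStrongJMapping f) :
    (∃ S U : Submodule R' V', S ≤ U ∧
      Module.finrank R' S + k = k' ∧ Module.finrank R' U + k = n + k' ∧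
      ∃ (σ : R →+* R') (l : V →ₛₗ[σ] (U ⧸ S.submoduleOf U)),
        StrongJ.IsSemilinearEmbedding l ∧
        ∀ P : StrongJ.Gr R V k,
          (f P : Submodule R' V') = StrongJ.phi S U (StrongJ.spanImage l P.1)) ∨
    (∃ S' U' : Submodule R'ᵐᵒᵖ (StrongJ.DualSpace R' V'), S' ≤ U' ∧
      Module.finrank R'ᵐᵒᵖ S' + k' + k = n' ∧
      Module.finrank R'ᵐᵒᵖ U' + k' + k = n + n' ∧
      ∃ (σ : R →+* R'ᵐᵒᵖ) (l : V →ₛₗ[σ] (U' ⧸ S'.submoduleOf U')),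
        StrongJ.IsSemilinearEmbedding l ∧
        ∀ P : StrongJ.Gr R V k,
          (f P : Submodule R' V') =
            StrongJ.annih (StrongJ.phi S' U' (StrongJ.spanImage l P.1))) := by
  have hJ := hf.1.mapsToJohnson hn
  have hr := StrongJ.isRank_finrank R' V'
  obtain ⟨s, j, v, F, rfl, hj, hv, hF, h₁, h₂⟩ := hf.exists_frame hn hk hkn
  have hcard : Fintype.card (Fin n) = Module.finrank R V := by rw [Fintype.card_fin, hn]
  have hkn' : k + 2 ≤ Fintype.card (Fin n) := by rw [Fintype.card_fin]; omega
  have hne : Fintype.card (Fin n) ≠ 2 * k := by rw [Fintype.card_fin]; exact hn2k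
  rcases hj with rfl | hj
  · left
    obtain ⟨S, U, hSU, hS, hU, σ, l, hl, h⟩ :=
      hJ.exists_semilinearEmbedding hcard hk hkn' hne hv hF ⟨h₁, h₂⟩
    rw [Fintype.card_fin] at hU
    exact ⟨S, U, hSU, by omega, by omega, σ, l, hl, fun P => by
      rw [← StrongJ.extend_apply, h P.1 P.2]⟩
  · right
    have hn'le : s + n ≤ n' := by
      have h1 : Module.finrank R' (F Finset.univ) = s + Finset.univ.card := hF.rank Finset.univ
      have h2 := Submodule.finrank_le (F Finset.univ)
      rw [Finset.card_univ, Fintype.card_fin] at h1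
      omega
    have hJ' := hJ.perp
    have hF' := hF.perp
    -- The annihilated frame has bottom rank `n' - s - n`. As `j = n - k`, its complemented index
    -- sets have size `k`, and the first case applies in the dual space.
    have hm : Module.finrank R' V' - (s + j) =
        Module.finrank R' V' - s - Fintype.card (Fin n) + k := by
      rw [Fintype.card_fin]
      omega
    rw [hm] at hJ'
    have hcompl : ∀ {a b : ℕ}, a + b = n → ∀ I : Finset (Fin n), I.card = a → Iᶜ.card = b := by
      intro a b hab I hI
      rw [Finset.card_compl, Fintype.card_fin]
      omega
    obtain ⟨S, U, hSU, hS, hU, σ, l, hl, h⟩ :=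
      hJ'.exists_semilinearEmbedding hcard hk hkn' hne hv hF' ⟨fun I hI => by
        obtain ⟨I', hI', h⟩ := h₁ I hI
        exact ⟨I'ᶜ, hcompl hj I' hI', by simp only [h, compl_compl]⟩, fun I' hI' => by
        obtain ⟨I, hI, h⟩ := h₂ I'ᶜ (hcompl (by omega) I' hI')
        exact ⟨I, hI, by simp only [h]⟩⟩
    rw [Fintype.card_fin] at hS hU
    exact ⟨S, U, hSU, by omega, by omega, σ, l, hl, fun P => by
      rw [← h P.1 P.2, StrongJ.annih_perp, StrongJ.extend_apply]⟩
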